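/- All graphs are finite and simple. Given labelled $k$-subsets $S=\{s_1,\dots,s_k\}$ and $T=\{t_1,\dots,t_k\}$ of $V(G)$ with $S\cap T=\emptyset$, a paired $k$-to-$k$ disjoint path cover ($k$-PDPC) of $G$ is a collection of paths $P_1,\dots,P_k$ in $G$ such that $P_i$ has endpoints $s_i$ and $t_i$ for each $i$, and $V(P_1),\dots,V(P_k)$ partition $V(G)$. A graph is Hamiltonian-connected if any two distinct vertices are the endpoints of a Hamiltonian path. A bipartite graph with partite sets $A,B$ is Hamiltonian-laceable if $\bigl||A|-|B|\bigr|\le 1$ and any two distinct vertices $s,t$ with $|\{s,t\}\cap A|-|\{s,t\}\cap B|=2(|A|-|B|)$ are the endpoints of a Hamiltonian path. A graph $G$ is a weld of $G_1,\dots,G_\ell$ if the $G_i$ are induced subgraphs of $G$ with the same number of vertices, their vertex sets partition $V(G)$, and for all $i\ne j$ the edges of $G$ between $V(G_i)$ and $V(G_j)$ form a perfect matching between these two sets. A transposition-like graph of rank $1$ is a Hamiltonian-connected or Hamiltonian-laceable graph; for $n\ge 2$, a transposition-like graph of rank $n$ is a weld of $\ell\ge n$ transposition-like graphs of rank $n-1$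 (where $\ell$ may differ from weld to weld). **Theorem.** Let $n\ge 2$ and let $G$ be a bipartite transposition-like graph of rank $n$ with partite sets $V_1$ and $V_2$. Assume that, in the welding process that forms $G$, every rank-$1$ transposition-like graph from which $G$ is built up is either a single vertex or has an even number of vertices. Then for every choice of $(n-1)$-subsets $S=\{s_1,\dots,s_{n-1}\}\subseteq V_1$ and $T=\{t_1,\dots,t_{n-1}\}\subseteq V_2$ (with any labelling), $G$ admits an $(n-1)$-PDPC with $P_i$ joining $s_i$ to $t_i$ for each $i$. -/

import Mathlib

universe u

namespace TranspositionLike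

/-- Given labelled vertices `s₁, …, s_k` and `t₁, …, t_k`, the graph `G` admits a paired `k`-to-`k`
disjoint path cover: there are paths `P_i` from `s_i` to `t_i` whose vertex sets partition
the vertex set of `G`. -/
def HasPairedDPC {V : Type u} (G : SimpleGraph V) {k : ℕ} (s t : Fin k → V) : Prop :=
  ∃ P : ∀ i : Fin k, G.Walk (s i) (t i),
    (∀ i, (P i).IsPath) ∧ ∀ v : V, ∃! i : Fin k, v ∈ (P i).support

/-- `V₁` and `V₂` are partite sets of `G`: they partition the vertex set, and every edge joins
a vertex of `V₁` to a vertex of `V₂`. -/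
def IsBipartition {V : Type u} (G : SimpleGraph V) (V₁ V₂ : Set V) : Prop :=
  G.IsBipartiteWith V₁ V₂ ∧ V₁ ∪ V₂ = Set.univ

/-- A set `X` of end vertices is balanced with respect to the partite sets `V₁`, `V₂` if
`|X ∩ V₁| - |X ∩ V₂| = 2 (|V₁| - |V₂|)`. -/
def IsBalanced {V : Type u} (V₁ V₂ X : Set V) : Prop :=
  ((X ∩ V₁).ncard : ℤ) - ((X ∩ V₂).ncard : ℤ) = 2 * ((V₁.ncard : ℤ) - (V₂.ncard : ℤ))

/-- `G` has a paired `k`-to-`k` disjoint path cover for all disjoint labelled `k`-subsets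
`S = {s₁, …, s_k}` and `T = {t₁, …, t_k}`. -/
def IsPairedCoverable {V : Type u} (G : SimpleGraph V) (k : ℕ) : Prop :=
  ∀ s t : Fin k → V, Function.Injective s → Function.Injective t →
    Disjoint (Set.range s) (Set.range t) → HasPairedDPC G s t

/-- `G`, bipartite with partite sets `V₁` and `V₂`, has a paired `k`-to-`k` disjoint path cover
for all disjoint labelled `k`-subsets `S`, `T` with `S ∪ T` balanced. -/
def IsBalancedPairedCoverable {V : Type u} (G : SimpleGraph V) (V₁ V₂ : Set V) (k : ℕ) : Prop :=
  ∀ s t : Fin k → V, Function.Injective s → Function.Injective t →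
    Disjoint (Set.range s) (Set.range t) →
    IsBalanced V₁ V₂ (Set.range s ∪ Set.range t) → HasPairedDPC G s t

/-- Any two distinct vertices are joined by a Hamiltonian path. -/
def IsHamiltonianConnected {V : Type u} (G : SimpleGraph V) : Prop :=
  IsPairedCoverable G 1

/-- Hamiltonian-laceable graphs: bipartite, with partite sets whose sizes differ by at most one,
and such that any two distinct vertices that form a balanced set are joined by a Hamiltonian
path. (If the sizes differed by two or more, no two vertices would form a balanced set and
the path condition would be void.) -/
def IsHamiltonianLaceable {V : Type u} (G : SimpleGraph V) : Prop :=
  ∃ V₁ V₂ : Set V, IsBipartition G V₁ V₂ ∧ |(V₁.ncard : ℤ) - (V₂.ncard : ℤ)| ≤ 1 ∧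
    IsBalancedPairedCoverable G V₁ V₂ 1

/-- `G` is a weld of the graphs `G_i = G[part i]`, `i = 1, …, ℓ`: their vertex sets partition that
of `G` and have the same size, and, for `i ≠ j`, the edges of `G` between `G_i` and `G_j` form
a perfect matching between the two vertex sets (every vertex of `G_i` has exactly one neighbour
in `G_j`, and vice versa). -/
structure IsWeld {V : Type u} (G : SimpleGraph V) {ℓ : ℕ} (part : Fin ℓ → Set V) : Prop where
  partition : ∀ v : V, ∃! i : Fin ℓ, v ∈ part i
  card_eq : ∀ i j : Fin ℓ, Nat.card (part i) = Nat.card (part j)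
  matching : ∀ i j : Fin ℓ, i ≠ j → ∀ v ∈ part i, ∃! w : V, w ∈ part j ∧ G.Adj v w

/-- A welding process that forms `G` as a transposition-like graph of the given rank.
In rank `1`, `G` is a Hamiltonian-connected or Hamiltonian-laceable graph; in rank `n + 1` with
`n ≥ 1`, `G` is a weld of `ℓ ≥ n + 1` graphs, each with a welding process of rank `n`.
Thus `G` is a transposition-like graph of rank `n` exactly when such a process exists. -/
inductive WeldingProcess : ℕ → {V : Type u} → SimpleGraph V → Type (u + 1)
  | base {V : Type u} {G : SimpleGraph V}
      (h : IsHamiltonianConnected G ∨ IsHamiltonianLaceable G) : WeldingProcess 1 G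
  | weld {V : Type u} {G : SimpleGraph V} {n ℓ : ℕ} (hn : 1 ≤ n) (hℓ : n + 1 ≤ ℓ)
      (part : Fin ℓ → Set V) (hG : IsWeld G part)
      (p : ∀ i : Fin ℓ, WeldingProcess n (G.induce (part i))) : WeldingProcess (n + 1) G

/-- Every rank `1` graph used in the welding process is a single vertex or has an even number of
vertices. -/
def WeldingProcess.BlocksSingleOrEven :
    {n : ℕ} → {V : Type u} → {G : SimpleGraph V} → WeldingProcess n G → Prop
  | _, V, _, .base _ => Nat.card V = 1 ∨ Even (Nat.card V)
  | _, _, _, .weld _ _ _ _ p => ∀ i, (p i).BlocksSingleOrEven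

end TranspositionLike

set_option linter.unusedSectionVars false

/-! The induction on the rank carries the statement `Stage`. The two colour classes have the same
size `m`, the graph is empty or `n * (n - 1) ≤ 2 * m`, and every demand of `j` pairs with sources in
one class and sinks in the other is met by disjoint spanning paths, for `1 ≤ j < n` and for `j = 1`.
A block with evenly many vertices is balanced and has this property at rank `1`. Single-vertex
blocks do not have it, but their weld is complete and bipartite, hence one edge, which has it at
rank `2`.

For the inductive step, let a weld have at least `k + 1` blocks, each able to meet all demands of
fewer than `k` pairs. The task is to meet `k` pairs in the weld. The basic move splits the blocks
into two groups and cuts each pair that runs between them at a matching edge. The size bound gives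
`2 * k ≤ m + 3`, which leaves enough free edges. This already meets fewer than `k` pairs in every
union of blocks (`Weld.coverable_group`), and `k` pairs if each group wholly contains one of them
(`Weld.cover_of_split`), since then neither group receives more than `k - 1` pairs.

In the remaining demands any two pairs touch a common block. Read as edges of a multigraph on the
blocks, the pairs then all touch one block `i`, or they contain two sides of a triangle. In a
triangle, cutting the two pairs that leave `i` produces a separated demand outside `i`
(`Weld.cover_of_triangle`). If a pair lies inside `i`, one pair is set aside, `k - 1` paths cover
the block, and the last pair is obtained by rerouting these paths and repairing them through unused
blocks (`Weld.cover_of_inner`, `Weld.cover_of_star_loop`).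

What is left is `k` pairs with exactly one end each in `i`. The heart of this case is `freeCover`:
the block can be covered by `k` paths, one from each prescribed end, if only the colours of the
other ends are prescribed. The free ends are continued to other blocks. If two pairs can be
continued so that they separate, `Weld.cover_of_split` finishes. If all pairs run between the same
two blocks, both are covered freely and the free ends are linked through the other blocks
(`Weld.cover_of_parallel`). The case `k = 2` needs separate arguments, because there `m` may be `1`.
-/

namespace TranspositionLike

/-! ### Path covers as multisets of end pairs: cutting and joining. -/

section

variable {V : Type*} [DecidableEq V] {G : SimpleGraph V}

/-- `PathCover G X D`: the set `X` is partitioned by the vertex sets of paths of `G` whose pairs of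
end vertices form the multiset `D`. -/
inductive PathCover (G : SimpleGraph V) : Finset V → Multiset (V × V) → Prop
  | nil : PathCover G ∅ 0
  | cons {a b : V} {X : Finset V} {D : Multiset (V × V)} (p : G.Walk a b) (hp : p.IsPath)
      (hd : Disjoint p.support.toFinset X) (h : PathCover G X D) :
      PathCover G (p.support.toFinset ∪ X) ((a, b) ::ₘ D)

namespace PathCover

variable {X Y : Finset V} {D E : Multiset (V × V)} {a b c d v : V}

theorem congr (h : PathCover G X D) (hD : D = E) : PathCover G X E := hD ▸ h

theorem eq_empty (h : PathCover G X 0) : X = ∅ := by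
  generalize hE : (0 : Multiset (V × V)) = E at h
  cases h with
  | nil => rfl
  | cons p hp hd h => exact absurd hE.symm (Multiset.cons_ne_zero)

/-- The demand is a multiset, so any of its pairs can be brought to the front. This inversion
principle underlies all surgery on covers. -/
theorem uncons (h : PathCover G X ((a, b) ::ₘ D)) :
    ∃ (p : G.Walk a b) (Y : Finset V), p.IsPath ∧ Disjoint p.support.toFinset Y ∧
      X = p.support.toFinset ∪ Y ∧ PathCover G Y D := by
  generalize hE : ((a, b) ::ₘ D) = E at h
  induction h generalizing D with
  | nil => exact absurd hE (Multiset.cons_ne_zero)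
  | @cons a' b' X' D' p hp hd h ih =>
    rcases Multiset.cons_eq_cons.1 hE with ⟨h1, h2⟩ | ⟨-, D'', h1, h2⟩
    · cases h1; subst h2
      exact ⟨p, X', hp, hd, rfl, h⟩
    · obtain ⟨q, Y, hq, hdq, rfl, hY⟩ := ih h2.symm
      rw [Finset.disjoint_union_right] at hd
      refine ⟨q, p.support.toFinset ∪ Y, hq, ?_, ?_, ?_⟩
      · exact Finset.disjoint_union_right.2 ⟨hd.1.symm, hdq⟩
      · rw [Finset.union_left_comm]
      · rw [h1]; exact .cons p hp hd.2 hY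

theorem union (h : PathCover G X D) (h' : PathCover G Y E) (hd : Disjoint X Y) :
    PathCover G (X ∪ Y) (D + E) := by
  induction h with
  | nil => simpa using h'
  | cons p hp hd' h ih =>
    rw [Finset.disjoint_union_left] at hd
    rw [Finset.union_assoc, Multiset.cons_add]
    exact .cons p hp (Finset.disjoint_union_right.2 ⟨hd', hd.1⟩) (ih hd.2)

theorem split (h : PathCover G X (D + E)) :
    ∃ Y Z, X = Y ∪ Z ∧ Disjoint Y Z ∧ PathCover G Y D ∧ PathCover G Z E := by
  induction D using Multiset.induction_on generalizing X with
  | empty => exact ⟨∅, X, by simp, by simp, .nil, by simpa using h⟩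
  | cons p D ih =>
    obtain ⟨a, b⟩ := p
    rw [Multiset.cons_add] at h
    obtain ⟨p, Y, hp, hd, rfl, hY⟩ := h.uncons
    obtain ⟨Y, Z, rfl, hYZ, h1, h2⟩ := ih hY
    rw [Finset.disjoint_union_right] at hd
    exact ⟨p.support.toFinset ∪ Y, Z, by rw [Finset.union_assoc],
      Finset.disjoint_union_left.2 ⟨hd.2, hYZ⟩, .cons p hp hd.1 h1, h2⟩

theorem single (v : V) : PathCover G {v} {(v, v)} := by
  have := PathCover.cons (G := G) (.nil : G.Walk v v) (by simp) (by simp) .nil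
  simpa using this

theorem of_walk (p : G.Walk a b) (hp : p.IsPath) :
    PathCover G p.support.toFinset {(a, b)} := by
  simpa using PathCover.cons p hp (by simp) .nil

theorem reverse (h : PathCover G X ((a, b) ::ₘ D)) : PathCover G X ((b, a) ::ₘ D) := by
  obtain ⟨p, Y, hp, hd, rfl, hY⟩ := h.uncons
  have := PathCover.cons p.reverse hp.reverse (by simpa using hd) hY
  simpa using this

theorem reverse_all (h : PathCover G X D) : PathCover G X (D.map Prod.swap) := by
  induction h with
  | nil => exact .nil
  | cons p hp hd h ih =>
    simpa using (PathCover.cons p hp hd ih).reverse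

theorem join (h : PathCover G X ((a, b) ::ₘ (c, d) ::ₘ D)) (hbc : G.Adj b c) :
    PathCover G X ((a, d) ::ₘ D) := by
  obtain ⟨p, Y, hp, hd, rfl, hY⟩ := h.uncons
  obtain ⟨q, Z, hq, hd', rfl, hZ⟩ := hY.uncons
  rw [Finset.disjoint_union_right] at hd
  have hdis : List.Disjoint p.support q.support := by
    simpa [Finset.disjoint_left, List.Disjoint] using hd.1
  have hsup : (p.append (.cons hbc q)).support = p.support ++ q.support := by
    simp [SimpleGraph.Walk.support_append]
  have hpath : (p.append (.cons hbc q)).IsPath := by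
    rw [SimpleGraph.Walk.isPath_def, hsup]
    exact List.Nodup.append hp.support_nodup hq.support_nodup hdis
  have hs : (p.append (.cons hbc q)).support.toFinset =
      p.support.toFinset ∪ q.support.toFinset := by
    rw [hsup, List.toFinset_append]
  have := PathCover.cons _ hpath (by
    rw [hs]; exact Finset.disjoint_union_left.2 ⟨hd.2, hd'⟩) hZ
  rwa [hs, Finset.union_assoc] at this

theorem left_mem (h : PathCover G X ((a, b) ::ₘ D)) : a ∈ X := by
  obtain ⟨p, Y, hp, hd, rfl, hY⟩ := h.uncons
  simp

theorem right_mem (h : PathCover G X ((a, b) ::ₘ D)) : b ∈ X := h.reverse.left_mem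

theorem eq_insert (h : PathCover G X ((a, a) ::ₘ D)) :
    ∃ Y, X = insert a Y ∧ a ∉ Y ∧ PathCover G Y D := by
  obtain ⟨p, Y, hp, hd, rfl, hY⟩ := h.uncons
  obtain rfl : p = .nil := by simpa using hp
  exact ⟨Y, by simp, by simpa using hd, hY⟩

/-- A path can be cut behind its first vertex. -/
theorem cut_first (h : PathCover G X ((a, b) ::ₘ D)) (hab : a ≠ b) :
    ∃ w, G.Adj a w ∧ PathCover G X ((a, a) ::ₘ (w, b) ::ₘ D) := by
  obtain ⟨p, Y, hp, hd, rfl, hY⟩ := h.uncons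
  cases p with
  | nil => exact absurd rfl hab
  | @cons _ w _ haw q =>
    rw [SimpleGraph.Walk.cons_isPath_iff] at hp
    simp only [SimpleGraph.Walk.support_cons, List.toFinset_cons] at hd ⊢
    rw [Finset.disjoint_insert_left] at hd
    refine ⟨w, haw, ?_⟩
    have h1 := PathCover.cons q hp.1 hd.2 hY
    have h2 := (single (G := G) a).union h1 (by
      simp only [Finset.disjoint_singleton_left, Finset.mem_union, not_or]
      exact ⟨by simpa using hp.2, hd.1⟩)
    rw [Multiset.cons_swap]
    simpa using h2

theorem cut_last (h : PathCover G X ((a, b) ::ₘ D)) (hab : a ≠ b) :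
    ∃ w, G.Adj w b ∧ PathCover G X ((a, w) ::ₘ (b, b) ::ₘ D) := by
  obtain ⟨w, hw, h⟩ := h.reverse.cut_first hab.symm
  rw [Multiset.cons_swap] at h
  exact ⟨w, hw.symm, h.reverse⟩

/-- Every covered vertex lies on one of the paths, which can be cut in front of it. -/
theorem exists_cut (h : PathCover G X D) (hv : v ∈ X) :
    ∃ a b E, D = (a, b) ::ₘ E ∧
      (v = a ∨ ∃ u, G.Adj u v ∧ PathCover G X ((a, u) ::ₘ (v, b) ::ₘ E)) := by
  induction h with
  | nil => simp at hv
  | @cons a b X D p hp hd h ih =>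
    by_cases hvp : v ∈ p.support
    · refine ⟨a, b, D, rfl, ?_⟩
      by_cases hva : v = a
      · exact .inl hva
      · right
        have hspec := p.take_spec hvp
        have h3 : p.support = (p.takeUntil v hvp).support ++ (p.dropUntil v hvp).support.tail := by
          rw [← SimpleGraph.Walk.support_append, hspec]
        have hnd := hp.support_nodup
        rw [h3] at hnd
        have hq : PathCover G (p.takeUntil v hvp).support.toFinset {(a, v)} :=
          of_walk _ (hp.takeUntil hvp)
        obtain ⟨u, huv, hq⟩ := PathCover.cut_last (D := 0) (by simpa using hq) (Ne.symm hva)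
        rw [Multiset.cons_swap] at hq
        obtain ⟨Y, hY1, hY2, hq⟩ := hq.eq_insert
        have hr : PathCover G (p.dropUntil v hvp).support.toFinset {(v, b)} :=
          of_walk _ (hp.dropUntil hvp)
        have h4 : (p.dropUntil v hvp).support.toFinset =
            insert v (p.dropUntil v hvp).support.tail.toFinset := by
          rw [← List.toFinset_cons, SimpleGraph.Walk.cons_tail_support]
        have h5 : List.Disjoint (p.takeUntil v hvp).support (p.dropUntil v hvp).support.tail :=
          List.disjoint_of_nodup_append hnd
        have hsub : Y ⊆ (p.takeUntil v hvp).support.toFinset := by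
          rw [hY1]; exact Finset.subset_insert _ _
        have hYd : Disjoint Y (p.dropUntil v hvp).support.toFinset := by
          rw [Finset.disjoint_left]
          intro x hx hx'
          rw [h4, Finset.mem_insert] at hx'
          rcases hx' with rfl | hx'
          · exact hY2 hx
          · exact h5 (by simpa using hsub hx) (by simpa using hx')
        have hYu : Y ∪ (p.dropUntil v hvp).support.toFinset = p.support.toFinset := by
          rw [h3, List.toFinset_append, hY1, h4, Finset.union_insert, Finset.insert_union]
        have h6 := hq.union hr hYd
        rw [hYu] at h6
        exact ⟨u, huv, (h6.union h hd).congr (by simp)⟩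
    · have hvX : v ∈ X := by simpa [hvp] using hv
      obtain ⟨a', b', E, rfl, h'⟩ := ih hvX
      refine ⟨a', b', (a, b) ::ₘ E, Multiset.cons_swap _ _ _, h'.imp_right ?_⟩
      rintro ⟨u, hu, h'⟩
      refine ⟨u, hu, (PathCover.cons p hp hd h').congr ?_⟩
      rw [Multiset.cons_swap, Multiset.cons_swap (a, b)]

theorem disjoint_ends (h : PathCover G X ((a, b) ::ₘ D)) :
    ∀ p ∈ D, a ≠ p.1 ∧ a ≠ p.2 ∧ b ≠ p.1 ∧ b ≠ p.2 := by
  rintro ⟨c, d⟩ hp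
  obtain ⟨D, rfl⟩ := Multiset.exists_cons_of_mem hp
  obtain ⟨Y, Z, rfl, hd, h1, h2⟩ :=
    PathCover.split (D := {(a, b)}) (E := (c, d) ::ₘ D) h
  rw [Finset.disjoint_left] at hd
  have ha : a ∈ Y := PathCover.left_mem (D := 0) h1
  have hb : b ∈ Y := PathCover.right_mem (D := 0) h1
  refine ⟨?_, ?_, ?_, ?_⟩ <;> rintro rfl
  exacts [hd ha h2.left_mem, hd ha h2.right_mem, hd hb h2.left_mem, hd hb h2.right_mem]

theorem mem_of_mem (h : PathCover G X D) : ∀ p ∈ D, p.1 ∈ X ∧ p.2 ∈ X := by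
  rintro ⟨c, d⟩ hp
  obtain ⟨D, rfl⟩ := Multiset.exists_cons_of_mem hp
  exact ⟨h.left_mem, h.right_mem⟩

theorem map {W : Type*} [DecidableEq W] {H : SimpleGraph W} (f : G ↪g H)
    (h : PathCover G X D) :
    PathCover H (X.map f.toEmbedding) (D.map fun p => (f p.1, f p.2)) := by
  induction h with
  | nil => exact .nil
  | @cons a b X D p hp hd h ih =>
    have hs : (p.map f.toHom).support.toFinset = p.support.toFinset.map f.toEmbedding := by
      ext; simp
    have := PathCover.cons (p.map f.toHom) (hp.map f.injective)
      (by rw [hs]; exact (Finset.disjoint_map _).2 hd) ih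
    rw [hs, ← Finset.map_union] at this
    rw [Multiset.map_cons]
    exact this

end PathCover

/-- The multiset forgets the labels. Peeling off one index at a time assigns a path to each label
again. -/
theorem PathCover.hasPairedDPC {V : Type u} [Fintype V] [DecidableEq V] {G : SimpleGraph V} {k : ℕ}
    {s t : Fin k → V}
    (h : PathCover G Finset.univ ((Finset.univ : Finset (Fin k)).val.map fun i => (s i, t i))) :
    HasPairedDPC G s t := by
  have key : ∀ (I : Finset (Fin k)) (X : Finset V),
      PathCover G X (I.val.map fun i => (s i, t i)) →
      ∃ f : Fin k → Finset V, (∀ i ∈ I, ∃ p : G.Walk (s i) (t i), p.IsPath ∧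
        p.support.toFinset = f i) ∧ (I : Set (Fin k)).PairwiseDisjoint f ∧ I.biUnion f = X := by
    intro I
    induction I using Finset.induction_on with
    | empty => intro X hX; exact ⟨fun _ => ∅, by simp, by simp, by simp [hX.eq_empty]⟩
    | insert j I hj ih =>
      intro X hX
      rw [Finset.insert_val_of_notMem hj, Multiset.map_cons] at hX
      obtain ⟨p, Y, hp, hd, rfl, hY⟩ := hX.uncons
      obtain ⟨f, h1, h2, rfl⟩ := ih Y hY
      have hne : ∀ i ∈ I, i ≠ j := fun i hi e => hj (e ▸ hi)
      refine ⟨Function.update f j p.support.toFinset, ?_, ?_, ?_⟩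
      · intro i hi
        rcases Finset.mem_insert.1 hi with rfl | hi
        · exact ⟨p, hp, by simp⟩
        · rw [Function.update_of_ne (hne i hi)]; exact h1 i hi
      · rw [Finset.coe_insert, Set.pairwiseDisjoint_insert]
        constructor
        · intro x hx y hy hxy
          simp only [Function.onFun]
          rw [Function.update_of_ne (hne x hx), Function.update_of_ne (hne y hy)]
          exact h2 hx hy hxy
        · intro i hi hji
          rw [Function.update_self, Function.update_of_ne hji.symm]
          exact hd.mono_right (Finset.subset_biUnion_of_mem f hi)
      · rw [Finset.biUnion_insert, Function.update_self]
        congr 1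
        exact Finset.biUnion_congr rfl fun i hi => by rw [Function.update_of_ne (hne i hi)]
  obtain ⟨f, h1, h2, h3⟩ := key _ _ h
  choose P hP hf using fun i => h1 i (Finset.mem_univ i)
  refine ⟨P, hP, fun v => ?_⟩
  have hv : v ∈ Finset.univ.biUnion f := h3 ▸ Finset.mem_univ v
  obtain ⟨i, -, hi⟩ := Finset.mem_biUnion.1 hv
  refine ⟨i, by simpa [← hf] using hi, fun j hj => ?_⟩
  by_contra hne
  exact Finset.disjoint_left.1 (h2 (by simp) (by simp) hne) (by simpa [← hf] using hj) hi

end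

/-! ### Two-coloured demands and counting along alternating paths. -/

section

variable {V : Type*} [DecidableEq V] {G : SimpleGraph V}

/-- The pairs in `D` have pairwise distinct entries, first entries coloured `b` and second entries
coloured `!b`. -/
structure Good (col : V → Bool) (b : Bool) (D : Multiset (V × V)) : Prop where
  nodup : (D.map Prod.fst + D.map Prod.snd).Nodup
  col : ∀ p ∈ D, col p.1 = b ∧ col p.2 = !b

/-- All entries of the pairs in `D` lie in `X`. -/
def Inside (X : Finset V) (D : Multiset (V × V)) : Prop := ∀ p ∈ D, p.1 ∈ X ∧ p.2 ∈ X

/-- Every admissible demand of `j` pairs inside `X` is met by a path cover of `X`. -/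
def Coverable (G : SimpleGraph V) (col : V → Bool) (X : Finset V) (j : ℕ) : Prop :=
  ∀ (b : Bool) (D : Multiset (V × V)), Good col b D → Inside X D → D.card = j → PathCover G X D

variable {col : V → Bool} {b : Bool} {X Y : Finset V} {D E : Multiset (V × V)}

theorem Good.of_nodup (h1 : (D.map Prod.fst).Nodup) (h2 : (D.map Prod.snd).Nodup)
    (hc : ∀ p ∈ D, col p.1 = b ∧ col p.2 = !b) : Good col b D := by
  refine ⟨Multiset.nodup_add.2 ⟨h1, h2, ?_⟩, hc⟩
  rw [Multiset.disjoint_left]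
  intro v hv hv'
  obtain ⟨p, hp, rfl⟩ := Multiset.mem_map.1 hv
  obtain ⟨q, hq, h⟩ := Multiset.mem_map.1 hv'
  have e1 := (hc p hp).1
  have e2 := (hc q hq).2
  rw [h, e1] at e2
  simp at e2

theorem Good.fst_nodup (h : Good col b D) : (D.map Prod.fst).Nodup :=
  (Multiset.nodup_add.1 h.nodup).1

theorem Good.snd_nodup (h : Good col b D) : (D.map Prod.snd).Nodup :=
  (Multiset.nodup_add.1 h.nodup).2.1

theorem Good.mono (h : Good col b E) (hD : D ≤ E) : Good col b D :=
  ⟨Multiset.nodup_of_le (add_le_add (Multiset.map_le_map hD) (Multiset.map_le_map hD)) h.nodup,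
    fun p hp => h.col p (Multiset.mem_of_le hD hp)⟩

theorem Good.swap (h : Good col b D) : Good col (!b) (D.map Prod.swap) := by
  refine ⟨?_, ?_⟩
  · simp only [Multiset.map_map, Function.comp_def, Prod.fst_swap, Prod.snd_swap]
    rw [add_comm]; exact h.nodup
  · intro p hp
    obtain ⟨q, hq, rfl⟩ := Multiset.mem_map.1 hp
    simpa [and_comm] using h.col q hq

theorem Inside.swap (h : Inside X D) : Inside X (D.map Prod.swap) := by
  intro p hp
  obtain ⟨q, hq, rfl⟩ := Multiset.mem_map.1 hp
  simpa [and_comm] using h q hq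

theorem Inside.mono (h : Inside X E) (hD : D ≤ E) : Inside X D :=
  fun p hp => h p (Multiset.mem_of_le hD hp)

theorem map_swap_swap (D : Multiset (V × V)) : (D.map Prod.swap).map Prod.swap = D := by
  simp [Multiset.map_map]

theorem PathCover.of_swap (h : PathCover G X (D.map Prod.swap)) : PathCover G X D := by
  simpa [map_swap_swap] using h.reverse_all

/-- Two finite sets of the same size can be paired up. -/
theorem exists_pairing {S T : Finset V} (h : S.card = T.card) :
    ∃ D : Multiset (V × V), D.map Prod.fst = S.val ∧ D.map Prod.snd = T.val := by
  refine ⟨(S.toList.zip T.toList : List (V × V)), ?_, ?_⟩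
  · rw [Multiset.map_coe, List.map_fst_zip (by simp [h])]; simp
  · rw [Multiset.map_coe, List.map_snd_zip (by simp [h])]; simp

theorem exists_good_pairing {S T : Finset V} (h : S.card = T.card) (hS : ∀ v ∈ S, col v = b)
    (hT : ∀ v ∈ T, col v = !b) (hSX : S ⊆ X) (hTX : T ⊆ X) :
    ∃ D : Multiset (V × V), D.map Prod.fst = S.val ∧ D.map Prod.snd = T.val ∧ Good col b D ∧
      Inside X D ∧ D.card = S.card := by
  obtain ⟨D, h1, h2⟩ := exists_pairing h
  have hm : ∀ p ∈ D, p.1 ∈ S ∧ p.2 ∈ T := fun p hp =>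
    ⟨Finset.mem_def.2 (h1 ▸ Multiset.mem_map_of_mem _ hp),
      Finset.mem_def.2 (h2 ▸ Multiset.mem_map_of_mem _ hp)⟩
  refine ⟨D, h1, h2, .of_nodup (h1 ▸ S.nodup) (h2 ▸ T.nodup) fun p hp =>
    ⟨hS _ (hm p hp).1, hT _ (hm p hp).2⟩, fun p hp => ⟨hSX (hm p hp).1, hTX (hm p hp).2⟩, ?_⟩
  rw [← Multiset.card_map Prod.fst D, h1, Finset.card_val]

/-- Colours alternate, and both neighbours on the walk of a vertex of `M` avoid `R`. A run of
consecutive `b`-coloured vertices in `M` is thus followed by equally many vertices outside `R`, and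
preceded by one more unless the walk starts with the run. The second half, for walks starting in the
other colour, is what the induction needs after the first vertex is dropped. -/
theorem walk_count (hcol : ∀ u v, G.Adj u v → col v = !col u) (M R : Finset V)
    (hM : ∀ v ∈ M, col v = b) (hMR : ∀ u ∈ M, ∀ v ∈ R, ¬ G.Adj u v) {x t : V} (p : G.Walk x t)
    (ht : col t = !b) :
    (col x = b → p.support.countP (· ∈ M) + (if x ∉ M ∧ t ∉ R then 1 else 0) ≤
      p.support.countP (fun v => col v = !b ∧ v ∉ R)) ∧
    (col x = !b → p.support.countP (· ∈ M) + (if t ∉ R then 1 else if x ∉ R then 1 else 0) ≤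
      p.support.countP (fun v => col v = !b ∧ v ∉ R)) := by
  induction p with
  | nil =>
    rename_i x
    have hxM : x ∉ M := fun h => by simp [hM x h] at ht
    refine ⟨fun h => by simp [h] at ht, fun h => ?_⟩
    by_cases hR : x ∈ R <;> simp [hxM, hR, h]
  | @cons x w t haw p ih =>
    have hw := hcol _ _ haw
    obtain ⟨ih1, ih2⟩ := ih ht
    simp only [SimpleGraph.Walk.support_cons, List.countP_cons]
    constructor
    · intro hx
      have h2 := ih2 (by rw [hw, hx])
      have hxc : ¬ (col x = !b) := by simp [hx]
      by_cases hxM : x ∈ M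
      · have hwR : w ∉ R := fun h => hMR x hxM w h haw
        simp only [hxM, hwR, hxc] at h2 ⊢
        simp at h2 ⊢
        omega
      · simp only [hxM, hxc] at h2 ⊢
        simp at h2 ⊢
        split_ifs at h2 ⊢ <;> omega
    · intro hx
      have h1 := ih1 (by rw [hw, hx, Bool.not_not])
      have hxM : x ∉ M := fun h => by simp [hM x h] at hx
      by_cases hxR : x ∈ R
      · have hwM : w ∉ M := fun h => hMR w h x hxR haw.symm
        simp only [hxM, hxR, hwM, hx] at h1 ⊢
        simp at h1 ⊢
        omega
      · simp only [hxM, hxR, hx] at h1 ⊢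
        simp at h1 ⊢
        omega

/-- If no edge joins `M` to `R`, then the number of paths that start outside of `M` and end outside
of `R` is bounded. -/
theorem PathCover.count (hcol : ∀ u v, G.Adj u v → col v = !col u) (M R : Finset V)
    (hM : ∀ v ∈ M, col v = b) (hMR : ∀ u ∈ M, ∀ v ∈ R, ¬ G.Adj u v) (h : PathCover G X D)
    (hD : ∀ p ∈ D, col p.1 = b ∧ col p.2 = !b) :
    (X.filter (· ∈ M)).card + (D.filter fun p => p.1 ∉ M ∧ p.2 ∉ R).card ≤
      (X.filter fun v => col v = !b ∧ v ∉ R).card := by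
  induction h with
  | nil => simp
  | @cons x t X D p hp hd h ih =>
    have ih := ih fun q hq => hD q (Multiset.mem_cons_of_mem hq)
    have hxt := hD (x, t) (Multiset.mem_cons_self _ _)
    have h1 := (walk_count hcol M R hM hMR p hxt.2).1 hxt.1
    have hc : ∀ P : V → Prop, ∀ [DecidablePred P],
        (p.support.toFinset.filter P).card = p.support.countP (fun v => P v) := by
      intro P _
      rw [List.countP_eq_length_filter,
        ← List.toFinset_card_of_nodup (hp.support_nodup.filter _), List.toFinset_filter]
      simp
    rw [Finset.filter_union, Finset.filter_union,
      Finset.card_union_of_disjoint (Finset.disjoint_filter_filter hd),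
      Finset.card_union_of_disjoint (Finset.disjoint_filter_filter hd), hc, hc,
      Multiset.filter_cons, Multiset.card_add]
    have h2 : (if x ∉ M ∧ t ∉ R then ({(x, t)} : Multiset (V × V)) else 0).card =
        if x ∉ M ∧ t ∉ R then 1 else 0 := by split_ifs <;> simp
    simp only [] at h2 h1 ⊢
    rw [h2]
    omega

/-- This is `PathCover.count` with `M` a whole colour class and `R` empty. Reversing all paths gives
the opposite inequality. -/
theorem PathCover.card_le (hcol : ∀ u v, G.Adj u v → col v = !col u) (h : PathCover G X D)
    (hD : ∀ p ∈ D, col p.1 = b ∧ col p.2 = !b) :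
    (X.filter (col · = b)).card ≤ (X.filter (col · = !b)).card := by
  have := h.count hcol (X.filter (col · = b)) ∅ (by simp) (by simp) hD
  have e1 : X.filter (· ∈ X.filter (col · = b)) = X.filter (col · = b) := by ext; simp
  have e2 : (X.filter fun v => col v = !b ∧ v ∉ (∅ : Finset V)) = X.filter (col · = !b) := by
    ext; simp
  rw [e1, e2] at this
  omega

/-- A set covered by paths whose ends have different colours is balanced. -/
theorem PathCover.balanced (hcol : ∀ u v, G.Adj u v → col v = !col u) (h : PathCover G X D)
    (hD : ∀ p ∈ D, col p.1 = b ∧ col p.2 = !b) :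
    (X.filter (col · = b)).card = (X.filter (col · = !b)).card := by
  refine le_antisymm (h.card_le hcol hD) ?_
  have := h.reverse_all.card_le (b := !b) hcol (by
    intro p hp
    obtain ⟨q, hq, rfl⟩ := Multiset.mem_map.1 hp
    simpa [and_comm] using hD q hq)
  simpa using this

/-- A path joining vertices of different colours is an edge or can be cut in the middle. -/
theorem PathCover.edge_or_cut (hcol : ∀ u v, G.Adj u v → col v = !col u) {s t : V}
    (h : PathCover G X ((s, t) ::ₘ D)) (hs : col s = b) (ht : col t = !b) :
    (G.Adj s t ∧ PathCover G X ((s, s) ::ₘ (t, t) ::ₘ D)) ∨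
      ∃ u w, G.Adj u w ∧ col u = (!b) ∧ col w = b ∧
        PathCover G X ((s, u) ::ₘ (w, t) ::ₘ D) := by
  obtain ⟨u, hsu, h1⟩ := h.cut_first (by rintro rfl; simp [hs] at ht)
  by_cases hut : u = t
  · subst hut; exact .inl ⟨hsu, h1⟩
  · rw [Multiset.cons_swap] at h1
    obtain ⟨w, huw, h2⟩ := h1.cut_first hut
    have hu : col u = !b := by rw [hcol _ _ hsu, hs]
    refine .inr ⟨u, w, huw, hu, by rw [hcol _ _ huw, hu, Bool.not_not], ?_⟩
    refine PathCover.join (b := s) (c := u) (h2.congr ?_) hsu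
    simp only [← Multiset.singleton_add]; abel

/-- Coverability by `j` paths forces every vertex to have more than `j` neighbours, if there is
enough room. -/
theorem Coverable.lt_degree (hcol : ∀ u v, G.Adj u v → col v = !col u) {j m : ℕ}
    (hX : ∀ c, (X.filter (col · = c)).card = m) (hj : Coverable G col X j) (hm : j + 1 ≤ m) {v : V}
    (hv : v ∈ X) [DecidableRel G.Adj] : j < (X.filter (G.Adj v)).card := by
  by_contra hlt
  push Not at hlt
  set b := col v
  have hN : X.filter (G.Adj v) ⊆ X.filter (col · = !b) := by
    intro u hu
    rw [Finset.mem_filter] at hu ⊢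
    exact ⟨hu.1, hcol _ _ hu.2⟩
  -- All neighbours of `v` become sinks, while `v` is kept out of the sources. The predecessor of
  -- `v` on its path would then be a sink at which no path ends.
  obtain ⟨T, hNT, hT, hTc⟩ := Finset.exists_subsuperset_card_eq hN hlt (by rw [hX]; omega)
  obtain ⟨S, hS, hSc⟩ := Finset.exists_subset_card_eq
    (s := (X.filter (col · = b)).erase v) (n := j) (by
      rw [Finset.card_erase_of_mem (by simp [hv, b]), hX]; omega)
  obtain ⟨D, h1, h2, hD, hDX, hDc⟩ := exists_good_pairing (col := col) (b := b) (X := X)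
    (hSc.trans hTc.symm)
    (fun u hu => (Finset.mem_filter.1 (Finset.mem_of_mem_erase (hS hu))).2)
    (fun u hu => (Finset.mem_filter.1 (hT hu)).2)
    (fun u hu => (Finset.mem_filter.1 (Finset.mem_of_mem_erase (hS hu))).1)
    (fun u hu => (Finset.mem_filter.1 (hT hu)).1)
  have hP := hj b D hD hDX (hDc.trans hSc)
  obtain ⟨e, f, E, rfl, rfl | ⟨u, hu, hP'⟩⟩ := hP.exists_cut hv
  · have : v ∈ S := Finset.mem_def.2 (h1 ▸ Multiset.mem_map_of_mem _ (Multiset.mem_cons_self _ _))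
    exact Finset.notMem_erase _ _ (hS this)
  · have huT : u ∈ T := hNT (by simp [hP'.right_mem, hu.symm])
    rw [← Finset.mem_val, ← h2, Multiset.mem_map] at huT
    obtain ⟨p, hp, rfl⟩ := huT
    have hends := hP'.disjoint_ends
    rcases Multiset.mem_cons.1 hp with rfl | hp
    · exact (hends _ (Multiset.mem_cons_self _ _)).2.2.2 rfl
    · exact (hends p (Multiset.mem_cons_of_mem hp)).2.2.2 rfl

end

/-! ### Covers with prescribed ends on one side and free ends on the other. -/

section

variable {V : Type*} [DecidableEq V] {G : SimpleGraph V} {col : V → Bool} {b : Bool}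
  {X Y : Finset V} {D E : Multiset (V × V)}

/-- `X` is covered by disjoint paths such that one path leads from every vertex of `A` to a vertex
coloured `!b`, and one path leads to every vertex of `B` from a vertex coloured `b`. -/
def FreeCover (G : SimpleGraph V) (col : V → Bool) (b : Bool) (X A B : Finset V) : Prop :=
  ∃ EA EB : Multiset (V × V), PathCover G X (EA + EB) ∧ EA.map Prod.fst = A.val ∧
    EB.map Prod.snd = B.val ∧ (∀ p ∈ EA, col p.2 = !b) ∧ (∀ p ∈ EB, col p.1 = b)

theorem FreeCover.of_swap {A B : Finset V} (h : FreeCover G col (!b) X B A) :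
    FreeCover G col b X A B := by
  obtain ⟨EB, EA, hP, hB, hA, hB', hA'⟩ := h
  refine ⟨EA.map Prod.swap, EB.map Prod.swap, ?_, ?_, ?_, ?_, ?_⟩
  · rw [← Multiset.map_add, add_comm]; exact hP.reverse_all
  · simpa [Multiset.map_map] using hA
  · simpa [Multiset.map_map] using hB
  · intro p hp
    obtain ⟨q, hq, rfl⟩ := Multiset.mem_map.1 hp
    exact hA' q hq
  · intro p hp
    obtain ⟨q, hq, rfl⟩ := Multiset.mem_map.1 hp
    simpa using hB' q hq

/-- The paths in `RA` end next to `s`, those in `RB` start next to `t`. An edge from `a` in `RA` to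
`w` frees the pair: the path through `a` is cut on both sides of `a`, and its tail, reversed,
becomes the path from `s`. If `w = t`, then `a` is simply put before `t`. Otherwise the path through
`w` is cut before `w`; `a` heads its tail, and its first part, reversed, becomes the path to `t`. -/
theorem freeCover_of_reroute (hcol : ∀ u v, G.Adj u v → col v = !col u) {A B RA RB : Finset V}
    {EA EB : Multiset (V × V)} {s t a w : V} (hRA : PathCover G RA EA) (hRB : PathCover G RB EB)
    (hd : Disjoint RA RB) (hst : s ≠ t) (hsX : s ∉ RA ∪ RB) (htX : t ∉ RA ∪ RB)
    (hX : X = insert s (insert t (RA ∪ RB)))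
    (hA : EA.map Prod.fst = A.val) (hB : EB.map Prod.snd = B.val)
    (hEA : ∀ p ∈ EA, col p.2 = (!b) ∧ G.Adj p.2 s) (hEB : ∀ p ∈ EB, col p.1 = b ∧ G.Adj p.1 t)
    (ha : a ∈ RA) (hac : col a = b) (haA : a ∉ A) (hw : w = t ∨ w ∈ RB) (hwc : col w = !b)
    (haw : G.Adj a w) : FreeCover G col b X (insert s A) (insert t B) := by
  have hfst : ∀ p ∈ EA, p.1 ∈ A := fun p hp => Finset.mem_def.2 (hA ▸ Multiset.mem_map_of_mem _ hp)
  have hsnd : ∀ p ∈ EB, p.2 ∈ B := fun p hp => Finset.mem_def.2 (hB ▸ Multiset.mem_map_of_mem _ hp)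
  have hsA : s ∉ A := by
    intro h
    rw [← Finset.mem_val, ← hA, Multiset.mem_map] at h
    obtain ⟨p, hp, rfl⟩ := h
    exact hsX (Finset.mem_union_left _ (hRA.mem_of_mem p hp).1)
  have htB : t ∉ B := by
    intro h
    rw [← Finset.mem_val, ← hB, Multiset.mem_map] at h
    obtain ⟨p, hp, rfl⟩ := h
    exact htX (Finset.mem_union_right _ (hRB.mem_of_mem p hp).2)
  have hunion : ∀ {D E}, PathCover G RA D → PathCover G RB E →
      PathCover G X ((s, s) ::ₘ (t, t) ::ₘ (D + E)) := by
    intro D E h1 h2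
    have h3 := (PathCover.single t).union (h1.union h2 hd) (by simpa using htX)
    have h4 := (PathCover.single s).union h3 (by simpa [hst] using hsX)
    rw [hX, Finset.insert_eq, Finset.insert_eq]
    simpa only [Multiset.singleton_add] using h4
  obtain ⟨e, f, E1, rfl, rfl | ⟨u, hu, h1⟩⟩ := hRA.exists_cut ha
  · exact absurd (hfst _ (Multiset.mem_cons_self _ _)) haA
  obtain ⟨hf, hfs⟩ := hEA _ (Multiset.mem_cons_self _ _)
  rw [Multiset.cons_swap] at h1
  obtain ⟨w', hw', h2⟩ := h1.cut_first (by rintro rfl; simp [hac] at hf)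
  have huc : col u = !b := by rw [hcol _ _ hu.symm, hac]
  have hw'c : col w' = !b := by rw [hcol _ _ hw', hac]
  have hA' : ((e, u) ::ₘ (s, w') ::ₘ E1).map Prod.fst = (insert s A).val := by
    rw [Finset.insert_val_of_notMem hsA, ← hA]
    simp [Multiset.cons_swap]
  have hEA' : ∀ p ∈ (e, u) ::ₘ (s, w') ::ₘ E1, col p.2 = !b := by
    intro p hp
    simp only [Multiset.mem_cons] at hp
    rcases hp with rfl | rfl | hp
    exacts [huc, hw'c, (hEA p (Multiset.mem_cons_of_mem hp)).1]
  rcases hw with rfl | hw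
  · have h3 := hunion h2 hRB
    have h4 : PathCover G X ((s, w') ::ₘ (a, a) ::ₘ (w, w) ::ₘ ((e, u) ::ₘ (E1 + EB))) := by
      refine (PathCover.join (b := f) (c := s) (a := w') (d := s) (h3.congr ?_) hfs).reverse
      simp only [← Multiset.singleton_add]; abel
    have h5 : PathCover G X ((a, w) ::ₘ ((s, w') ::ₘ (e, u) ::ₘ (E1 + EB))) := by
      refine PathCover.join (b := a) (c := w) (h4.congr ?_) haw
      simp only [← Multiset.singleton_add]; abel
    refine ⟨(e, u) ::ₘ (s, w') ::ₘ E1, (a, w) ::ₘ EB, h5.congr ?_, hA', ?_, hEA', ?_⟩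
    · simp only [← Multiset.singleton_add]; abel
    · rw [Finset.insert_val_of_notMem htB, ← hB]; simp
    · intro p hp
      rcases Multiset.mem_cons.1 hp with rfl | hp
      exacts [hac, (hEB p hp).1]
  · obtain ⟨e2, f2, E2, rfl, rfl | ⟨u2, hu2, h3⟩⟩ := hRB.exists_cut hw
    · have := (hEB _ (Multiset.mem_cons_self _ _)).1
      simp [hwc] at this
    have he2 := hEB _ (Multiset.mem_cons_self _ _)
    have h3 := hunion h2 h3
    have h4 : PathCover G X ((s, w') ::ₘ (a, a) ::ₘ (w, f2) ::ₘ ((e, u) ::ₘ (t, t) ::ₘ (e2, u2) ::ₘ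
        (E1 + E2))) := by
      refine (PathCover.join (b := f) (c := s) (a := w') (d := s) (h3.congr ?_) hfs).reverse
      simp only [← Multiset.singleton_add]; abel
    have h5 : PathCover G X ((a, f2) ::ₘ ((s, w') ::ₘ (e, u) ::ₘ (t, t) ::ₘ (e2, u2) ::ₘ
        (E1 + E2))) := by
      refine PathCover.join (b := a) (c := w) (h4.congr ?_) haw
      simp only [← Multiset.singleton_add]; abel
    have h6 : PathCover G X ((u2, t) ::ₘ ((a, f2) ::ₘ (s, w') ::ₘ (e, u) ::ₘ (E1 + E2))) := by
      refine (PathCover.join (b := t) (c := e2) (a := t) (d := u2) (h5.congr ?_)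
        he2.2.symm).reverse
      simp only [← Multiset.singleton_add]; abel
    have hu2c : col u2 = b := by rw [hcol _ _ hu2.symm, hwc, Bool.not_not]
    refine ⟨(e, u) ::ₘ (s, w') ::ₘ E1, (u2, t) ::ₘ (a, f2) ::ₘ E2, h6.congr ?_, hA', ?_, hEA', ?_⟩
    · simp only [← Multiset.singleton_add]; abel
    · rw [Finset.insert_val_of_notMem htB, ← hB]; simp
    · intro p hp
      simp only [Multiset.mem_cons] at hp
      rcases hp with rfl | rfl | hp
      exacts [hu2c, hac, (hEB p (Multiset.mem_cons_of_mem hp)).1]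

/-- If the edge needed by `freeCover_of_reroute` does not exist, then no edge joins the `b`-coloured
part of `RA` outside `A` to `t` or to the `!b`-coloured part of `RB`. A suitable demand then
contradicts `PathCover.count`. -/
theorem freeCover_of_room (hcol : ∀ u v, G.Adj u v → col v = !col u) {A B RA RB : Finset V}
    {EA EB : Multiset (V × V)} {s t : V} (hRA : PathCover G RA EA) (hRB : PathCover G RB EB)
    (hd : Disjoint RA RB) (hst : s ≠ t) (hsX : s ∉ RA ∪ RB) (htX : t ∉ RA ∪ RB)
    (hX : X = insert s (insert t (RA ∪ RB))) (hs : col s = b) (ht : col t = !b)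
    (hA : EA.map Prod.fst = A.val) (hB : EB.map Prod.snd = B.val)
    (hEA : ∀ p ∈ EA, col p.1 = b ∧ col p.2 = (!b) ∧ G.Adj p.2 s)
    (hEB : ∀ p ∈ EB, col p.1 = b ∧ G.Adj p.1 t)
    (hroom : A.card + 1 ≤ (RA.filter (col · = b)).card) (hcov : Coverable G col X (A.card + 1)) :
    FreeCover G col b X (insert s A) (insert t B) := by
  have hAR : A ⊆ RA.filter (col · = b) := by
    intro v hv
    rw [← Finset.mem_val, ← hA, Multiset.mem_map] at hv
    obtain ⟨p, hp, rfl⟩ := hv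
    exact Finset.mem_filter.2 ⟨(hRA.mem_of_mem p hp).1, (hEA p hp).1⟩
  have hsA : s ∉ A := fun h => hsX (Finset.mem_union_left _ (Finset.mem_filter.1 (hAR h)).1)
  have hbal := hRA.balanced hcol (b := b) fun p hp => ⟨(hEA p hp).1, (hEA p hp).2.1⟩
  by_contra hno
  have hedge : ∀ a ∈ RA.filter (col · = b) \ A, ∀ w ∈ insert t (RB.filter (col · = !b)),
      ¬ G.Adj a w := by
    intro a ha w hw haw
    simp only [Finset.mem_sdiff, Finset.mem_filter] at ha
    refine hno (freeCover_of_reroute (w := w) (a := a) hcol hRA hRB hd hst hsX htX hX hA hB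
      (fun p hp => (hEA p hp).2) hEB ha.1.1 ha.1.2 ha.2 ?_ ?_ haw)
    · simp only [Finset.mem_insert, Finset.mem_filter] at hw
      exact hw.imp_right And.left
    · rw [hcol _ _ haw, ha.1.2]
  -- All `A.card + 1` pairs from `insert s A` to `T` start outside `M` and end outside `R`. Together
  -- with the vertices of `M` they exceed the `!b`-coloured vertices of `RA` by one.
  obtain ⟨T, hT, hTc⟩ := Finset.exists_subset_card_eq (hbal ▸ hroom)
  have hRAX : RA ⊆ X := by
    rw [hX]; intro v hv; simp [hv]
  obtain ⟨D, h1, h2, hD, hDX, hDc⟩ := exists_good_pairing (col := col) (b := b) (X := X)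
    (S := insert s A) (T := T) (by rw [Finset.card_insert_of_notMem hsA, hTc])
    (by
      intro v hv
      rcases Finset.mem_insert.1 hv with rfl | hv
      exacts [hs, (Finset.mem_filter.1 (hAR hv)).2])
    (fun v hv => (Finset.mem_filter.1 (hT hv)).2)
    (by
      intro v hv
      rcases Finset.mem_insert.1 hv with rfl | hv
      · simp [hX]
      · exact hRAX (Finset.mem_filter.1 (hAR hv)).1)
    (fun v hv => hRAX (Finset.mem_filter.1 (hT hv)).1)
  rw [Finset.card_insert_of_notMem hsA] at hDc
  have hP := hcov b D hD hDX hDc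
  have hcount := hP.count hcol _ _ (by
    intro v hv
    exact (Finset.mem_filter.1 (Finset.mem_sdiff.1 hv).1).2) hedge hD.col
  rw [Multiset.filter_eq_self.2, hDc] at hcount
  · have e1 : X.filter (· ∈ RA.filter (col · = b) \ A) = RA.filter (col · = b) \ A := by
      ext v
      simp only [Finset.mem_filter, Finset.mem_sdiff]
      exact ⟨fun h => h.2, fun h => ⟨hRAX h.1.1, h⟩⟩
    have e2 : (X.filter fun v => col v = (!b) ∧ v ∉ insert t (RB.filter (col · = !b))) ⊆
        RA.filter (col · = !b) := by
      intro v hv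
      simp only [hX, Finset.mem_filter, Finset.mem_insert, Finset.mem_union, not_or, not_and] at hv
      obtain ⟨hv, hvc, hvt, hvB⟩ := hv
      rcases hv with rfl | rfl | hv | hv
      · simp [hs] at hvc
      · exact absurd rfl hvt
      · simp [hv, hvc]
      · exact absurd hvc (hvB hv)
    rw [e1, Finset.card_sdiff_of_subset hAR] at hcount
    have := Finset.card_le_card e2
    have := Finset.card_le_card hAR
    omega
  · intro p hp
    have hp1 : p.1 ∈ insert s A := Finset.mem_def.2 (h1 ▸ Multiset.mem_map_of_mem _ hp)
    have hp2 : p.2 ∈ T := Finset.mem_def.2 (h2 ▸ Multiset.mem_map_of_mem _ hp)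
    have hp2' := (Finset.mem_filter.1 (hT hp2)).1
    constructor
    · intro h
      rw [Finset.mem_sdiff] at h
      rcases Finset.mem_insert.1 hp1 with h' | h'
      · rw [h'] at h; exact hsX (Finset.mem_union_left _ (Finset.mem_filter.1 h.1).1)
      · exact h.2 h'
    · intro h
      rcases Finset.mem_insert.1 h with h' | h'
      · rw [h'] at hp2'; exact htX (Finset.mem_union_left _ hp2')
      · exact Finset.disjoint_left.1 hd hp2' (Finset.mem_filter.1 h').1

/-- With sources only, `j` paths give `j + 1`: one source is left out of the demand, and the path
through it is cut in front of it. -/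
theorem freeCover_of_sources (hcol : ∀ u v, G.Adj u v → col v = !col u) {A : Finset V} {j : ℕ}
    (hA : A ⊆ X.filter (col · = b)) (hj : A.card = j + 1)
    (hX : j ≤ (X.filter (col · = !b)).card) (hcov : Coverable G col X j) :
    FreeCover G col b X A ∅ := by
  obtain ⟨s, hs⟩ : A.Nonempty := Finset.card_pos.1 (by omega)
  obtain ⟨T, hT, hTc⟩ := Finset.exists_subset_card_eq hX
  have hAe : (A.erase s).card = j := by rw [Finset.card_erase_of_mem hs, hj]; rfl
  have hA' : A.erase s ⊆ X.filter (col · = b) := (Finset.erase_subset _ _).trans hA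
  obtain ⟨D, h1, h2, hD, hDX, hDc⟩ := exists_good_pairing (col := col) (b := b) (X := X)
    (S := A.erase s) (T := T) (by rw [hAe, hTc])
    (fun v hv => (Finset.mem_filter.1 (hA' hv)).2) (fun v hv => (Finset.mem_filter.1 (hT hv)).2)
    (fun v hv => (Finset.mem_filter.1 (hA' hv)).1) (fun v hv => (Finset.mem_filter.1 (hT hv)).1)
  have hP := hcov b D hD hDX (hDc.trans hAe)
  have hs' := Finset.mem_filter.1 (hA hs)
  obtain ⟨e, f, E, rfl, rfl | ⟨u, hu, h⟩⟩ := hP.exists_cut hs'.1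
  · have : s ∈ A.erase s := Finset.mem_def.2 (h1 ▸ Multiset.mem_map_of_mem _ (Multiset.mem_cons_self _ _))
    simp at this
  · refine ⟨(e, u) ::ₘ (s, f) ::ₘ E, 0, by simpa using h, ?_, rfl, ?_, by simp⟩
    · have : A.val = s ::ₘ (A.erase s).val := by
        rw [← Finset.insert_val_of_notMem (Finset.notMem_erase _ _), Finset.insert_erase hs]
      rw [this, ← h1]
      simp [Multiset.cons_swap]
    · intro p hp
      simp only [Multiset.mem_cons] at hp
      rcases hp with rfl | rfl | hp
      · rw [hcol _ _ hu.symm, hs'.2]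
      · exact (hD.col _ (Multiset.mem_cons_self _ _)).2
      · exact (hD.col _ (Multiset.mem_cons_of_mem hp)).2

/-- Pick `s ∈ A` and `t ∈ B` and demand one path between them, which makes `k - 1` pairs in all. If
that path is longer than an edge, cutting it in the middle gives the missing free ends. If it is the
edge itself, the other free ends, chosen next to `s` and `t`, allow a rerouting. -/
theorem freeCover (hcol : ∀ u v, G.Adj u v → col v = !col u) {A B : Finset V} {k m : ℕ}
    (hX : ∀ c, (X.filter (col · = c)).card = m) (hk : 2 ≤ k) (hkm : k ≤ m)
    (hcov : ∀ j, 1 ≤ j → j < k → Coverable G col X j)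
    (hA : A ⊆ X.filter (col · = b)) (hB : B ⊆ X.filter (col · = !b)) (hAB : A.card + B.card = k) :
    FreeCover G col b X A B := by
  classical
  rcases B.eq_empty_or_nonempty with rfl | ⟨t, ht⟩
  · exact freeCover_of_sources hcol (j := k - 1) hA (by simp at hAB; omega) (by rw [hX]; omega)
      (hcov _ (by omega) (by omega))
  rcases A.eq_empty_or_nonempty with rfl | ⟨s, hs⟩
  · exact .of_swap (freeCover_of_sources hcol (j := k - 1) hB (by simp at hAB; omega)
      (by rw [hX]; omega) (hcov _ (by omega) (by omega)))
  have hs' := Finset.mem_filter.1 (hA hs)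
  have ht' := Finset.mem_filter.1 (hB ht)
  have hcA : (A.erase s).card + 1 = A.card := Finset.card_erase_add_one hs
  have hcB : (B.erase t).card + 1 = B.card := Finset.card_erase_add_one ht
  have hpart : ∀ {c : Bool} {A B : Finset V} {v : V}, v ∈ X → col v = c → A.card + B.card = k →
      1 ≤ A.card → A ⊆ X.filter (col · = c) → v ∈ A →
      ∃ EA : Multiset (V × V), EA.map Prod.fst = (A.erase v).val ∧ Good col c EA ∧ Inside X EA ∧
        (∀ p ∈ EA, G.Adj p.2 v ∧ p.2 ∉ B) := by
    intro c A B v hv hvc hAB h1 hA hvA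
    -- The vertex `v` has at least `k = A.card + B.card` neighbours, so enough of them remain after
    -- removing `B`.
    have hdeg := (hcov (k - 1) (by omega) (by omega)).lt_degree hcol hX (by omega) hv
    have hcard : (A.erase v).card ≤ (X.filter (G.Adj v) \ B).card := by
      have := Finset.le_card_sdiff B (X.filter (G.Adj v))
      rw [Finset.card_erase_of_mem hvA]
      omega
    obtain ⟨T, hT, hTc⟩ := Finset.exists_subset_card_eq hcard
    have hT' : ∀ u ∈ T, (u ∈ X ∧ G.Adj v u) ∧ u ∉ B := fun u hu => by
      simpa using hT hu
    have hA' : A.erase v ⊆ X.filter (col · = c) := (Finset.erase_subset _ _).trans hA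
    obtain ⟨D, h1, h2, hD, hDX, -⟩ := exists_good_pairing (col := col) (b := c) (X := X)
      (S := A.erase v) (T := T) hTc.symm (fun u hu => (Finset.mem_filter.1 (hA' hu)).2)
      (fun u hu => by rw [hcol _ _ (hT' u hu).1.2, hvc])
      (fun u hu => (Finset.mem_filter.1 (hA' hu)).1) (fun u hu => (hT' u hu).1.1)
    refine ⟨D, h1, hD, hDX, fun p hp => ?_⟩
    have hp2 : p.2 ∈ T := Finset.mem_def.2 (h2 ▸ Multiset.mem_map_of_mem _ hp)
    exact ⟨(hT' _ hp2).1.2.symm, (hT' _ hp2).2⟩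
  obtain ⟨EA, hEA, hEAg, hEAX, hEAs⟩ := hpart (B := B) hs'.1 hs'.2 hAB (by omega) hA hs
  obtain ⟨EB, hEB, hEBg, hEBX, hEBt⟩ := hpart (B := A) ht'.1 ht'.2 (by omega) (by omega) hB ht
  have hEBg' := hEBg.swap
  rw [Bool.not_not] at hEBg'
  have hEBs : (EB.map Prod.swap).map Prod.snd = (B.erase t).val := by
    simpa [Multiset.map_map] using hEB
  have hEBt' : ∀ p ∈ EB.map Prod.swap, G.Adj p.1 t ∧ p.1 ∉ A := by
    intro p hp
    obtain ⟨q, hq, rfl⟩ := Multiset.mem_map.1 hp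
    exact hEBt q hq
  have hEBX' := hEBX.swap
  generalize EB.map Prod.swap = EB at hEBg' hEBs hEBt' hEBX'
  have hAval : A.val = s ::ₘ (A.erase s).val := by
    rw [← Finset.insert_val_of_notMem (Finset.notMem_erase _ _), Finset.insert_erase hs]
  have hBval : B.val = t ::ₘ (B.erase t).val := by
    rw [← Finset.insert_val_of_notMem (Finset.notMem_erase _ _), Finset.insert_erase ht]
  have hgood : Good col b ((s, t) ::ₘ (EA + EB)) := by
    refine .of_nodup ?_ ?_ ?_
    · have : ((s, t) ::ₘ (EA + EB)).map Prod.fst = A.val + EB.map Prod.fst := by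
        rw [hAval, ← hEA]; simp
      rw [this, Multiset.nodup_add]
      refine ⟨A.nodup, hEBg'.fst_nodup, ?_⟩
      rw [Multiset.disjoint_left]
      intro v hv hv'
      obtain ⟨p, hp, rfl⟩ := Multiset.mem_map.1 hv'
      exact (hEBt' p hp).2 hv
    · have : ((s, t) ::ₘ (EA + EB)).map Prod.snd = B.val + EA.map Prod.snd := by
        rw [hBval, ← hEBs]; simp [add_comm]
      rw [this, Multiset.nodup_add]
      refine ⟨B.nodup, hEAg.snd_nodup, ?_⟩
      rw [Multiset.disjoint_left]
      intro v hv hv'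
      obtain ⟨p, hp, rfl⟩ := Multiset.mem_map.1 hv'
      exact (hEAs p hp).2 hv
    · intro p hp
      rcases Multiset.mem_cons.1 hp with rfl | hp
      · exact ⟨hs'.2, ht'.2⟩
      · rcases Multiset.mem_add.1 hp with hp | hp
        exacts [hEAg.col p hp, hEBg'.col p hp]
  have hcardA : EA.card = (A.erase s).card := by rw [← Multiset.card_map Prod.fst, hEA]; rfl
  have hcardB : EB.card = (B.erase t).card := by rw [← Multiset.card_map Prod.snd, hEBs]; rfl
  have hP := hcov (k - 1) (by omega) (by omega) b _ hgood (by
    intro p hp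
    rcases Multiset.mem_cons.1 hp with rfl | hp
    · exact ⟨hs'.1, ht'.1⟩
    · rcases Multiset.mem_add.1 hp with hp | hp
      exacts [hEAX p hp, hEBX' p hp]) (by
    rw [Multiset.card_cons, Multiset.card_add, hcardA, hcardB]; omega)
  rcases hP.edge_or_cut hcol hs'.2 ht'.2 with ⟨hst, h⟩ | ⟨u, w, huw, hu, hw, h⟩
  · obtain ⟨Y, hY1, hY2, hY⟩ := h.eq_insert
    obtain ⟨Z, rfl, hZ2, hZ⟩ := hY.eq_insert
    obtain ⟨RA, RB, rfl, hd, hRA, hRB⟩ := hZ.split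
    have hne : s ≠ t := fun e => hY2 (by simp [e])
    have hsX : s ∉ RA ∪ RB := fun h => hY2 (by simp [h])
    have hc := hX b
    rw [hY1, Finset.filter_insert, if_pos hs'.2, Finset.filter_insert,
      if_neg (by rw [ht'.2]; simp), Finset.card_insert_of_notMem (by simp [hsX]),
      Finset.filter_union, Finset.card_union_of_disjoint (Finset.disjoint_filter_filter hd)] at hc
    have hbalB := hRB.balanced hcol hEBg'.col
    -- Since `RA` contains `A.erase s`, lack of room means that it has exactly `A.card - 1` vertices
    -- of colour `b`. Then `k ≤ m` leaves room in `RB`, and the argument applies with the roles of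
    -- the colours exchanged.
    by_cases hroom : A.card ≤ (RA.filter (col · = b)).card
    · have := freeCover_of_room (b := b) hcol hRA hRB hd hne hsX hZ2 hY1 hs'.2 ht'.2 hEA hEBs
        (fun p hp => ⟨(hEAg.col p hp).1, (hEAg.col p hp).2, (hEAs p hp).1⟩)
        (fun p hp => ⟨(hEBg'.col p hp).1, (hEBt' p hp).1⟩) (by omega)
        (by rw [hcA]; exact hcov _ (by omega) (by omega))
      rwa [Finset.insert_erase hs, Finset.insert_erase ht] at this
    · refine .of_swap ?_
      have := freeCover_of_room (b := !b) (s := t) (t := s) (A := B.erase t) (B := A.erase s)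
        (EA := EB.map Prod.swap) (EB := EA.map Prod.swap) (X := X) hcol hRB.reverse_all
        hRA.reverse_all hd.symm hne.symm (by rwa [Finset.union_comm])
        (by rwa [Finset.union_comm]) (by rw [hY1, Finset.insert_comm, Finset.union_comm]) ht'.2
        (by simpa using hs'.2) (by simpa [Multiset.map_map] using hEBs)
        (by simpa [Multiset.map_map] using hEA)
        (by
          intro p hp
          obtain ⟨q, hq, rfl⟩ := Multiset.mem_map.1 hp
          exact ⟨(hEBg'.col q hq).2, by simpa using (hEBg'.col q hq).1, (hEBt' q hq).1⟩)
        (by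
          intro p hp
          obtain ⟨q, hq, rfl⟩ := Multiset.mem_map.1 hp
          exact ⟨(hEAg.col q hq).2, (hEAs q hq).1⟩)
        (by omega) (by rw [hcB]; exact hcov _ (by omega) (by omega))
      rwa [Finset.insert_erase hs, Finset.insert_erase ht] at this
  · refine ⟨(s, u) ::ₘ EA, (w, t) ::ₘ EB, h.congr ?_, ?_, ?_, ?_, ?_⟩
    · simp only [← Multiset.singleton_add]; abel
    · rw [hAval, ← hEA]; simp
    · rw [hBval, ← hEBs]; simp
    · intro p hp
      rcases Multiset.mem_cons.1 hp with rfl | hp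
      exacts [hu, (hEAg.col p hp).2]
    · intro p hp
      rcases Multiset.mem_cons.1 hp with rfl | hp
      exacts [hw, (hEBg'.col p hp).1]

end

/-! ### Welds: free matching edges, crossing pairs, fewer than `k` pairs. -/

section

variable {V ι : Type*} [Fintype V] [DecidableEq V] [DecidableEq ι] {G : SimpleGraph V}
  {col : V → Bool} {b : Bool} {blk : V → ι} {m k : ℕ} {D E : Multiset (V × V)}

/-- The union of the blocks with index in `J`. -/
def group (blk : V → ι) (J : Finset ι) : Finset V := Finset.univ.filter fun v => blk v ∈ J

@[simp]
theorem mem_group {J : Finset ι} {v : V} : v ∈ group blk J ↔ blk v ∈ J := by simp [group]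

/-- A bipartite weld, with proper 2-colouring `col`, of blocks `blk ⁻¹' {i}` that have `m` vertices
of each colour and in which all demands of fewer than `k` pairs can be met. -/
structure Weld (G : SimpleGraph V) (col : V → Bool) (blk : V → ι) (m k : ℕ) : Prop where
  hcol : ∀ u v, G.Adj u v → col v = !col u
  size : ∀ i c, ((group blk {i}).filter (col · = c)).card = m
  exists_nb : ∀ v i, blk v ≠ i → ∃ w, blk w = i ∧ G.Adj v w
  nb_unique : ∀ v w x, G.Adj v w → G.Adj v x → blk w = blk x → blk v ≠ blk w → w = x
  cov : ∀ i j, 1 ≤ j → j < k → Coverable G col (group blk {i}) j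
  two_le : 2 ≤ k
  room : k * (k - 1) ≤ 2 * m

/-- The number of pairs in `F` that touch block `i`. -/
def touching (blk : V → ι) (F : Multiset (V × V)) (i : ι) : ℕ :=
  (F.filter fun p => blk p.1 = i ∨ blk p.2 = i).card

theorem touching_cons (p : V × V) (F : Multiset (V × V)) (i : ι) :
    touching blk (p ::ₘ F) i = (if blk p.1 = i ∨ blk p.2 = i then 1 else 0) + touching blk F i := by
  unfold touching
  rw [Multiset.filter_cons, Multiset.card_add]
  split_ifs <;> simp

theorem touching_add (D F : Multiset (V × V)) (i : ι) :
    touching blk (D + F) i = touching blk D i + touching blk F i := by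
  simp [touching]

theorem touching_le (F : Multiset (V × V)) (i : ι) : touching blk F i ≤ F.card :=
  Multiset.card_le_card (Multiset.filter_le _ _)

theorem touching_eq_zero {F : Multiset (V × V)} {J : Finset ι} {i : ι}
    (hF : Inside (group blk J) F) (hi : i ∉ J) : touching blk F i = 0 := by
  unfold touching
  rw [Multiset.card_eq_zero, Multiset.filter_eq_nil]
  rintro p hp (h | h)
  · exact hi (h ▸ mem_group.1 (hF p hp).1)
  · exact hi (h ▸ mem_group.1 (hF p hp).2)

theorem group_union (J K : Finset ι) : group blk (J ∪ K) = group blk J ∪ group blk K := by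
  ext; simp

theorem group_disjoint {J K : Finset ι} (h : Disjoint J K) :
    Disjoint (group blk J) (group blk K) := by
  rw [Finset.disjoint_left] at h ⊢
  intro v hv
  simpa using h (mem_group.1 hv)

namespace Weld

/-- The bound follows from `(k - 2) * (k - 3) ≥ 0`. In the form `2 * (k - 1) ≤ m + 1` it is the
budget for all later choices of edges. -/
theorem two_mul_le (W : Weld G col blk m k) : 2 * k ≤ m + 3 := by
  have h1 := W.room
  have h2 := W.two_le
  obtain ⟨k, rfl⟩ : ∃ l, k = l + 2 := ⟨k - 2, by omega⟩
  have : (k + 2) * (k + 2 - 1) = k * k + 3 * k + 2 := by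
    rw [show k + 2 - 1 = k + 1 by omega]; ring
  rw [this] at h1
  have : k ≤ k * k := Nat.le_mul_self k
  omega

theorem le_room (W : Weld G col blk m k) (hk : 3 ≤ k) : k ≤ m := by
  have := W.two_mul_le
  omega

/-- A vertex has a neighbour outside of a small set `F` in one of many blocks. -/
theorem exists_landing (W : Weld G col blk m k) {v : V} {J : Finset ι} (hv : blk v ∉ J)
    {F : Finset V} (hF : F.card < J.card) :
    ∃ w, blk w ∈ J ∧ G.Adj v w ∧ col w = (!col v) ∧ w ∉ F := by
  have hne : ∀ i ∈ J, blk v ≠ i := fun i hi e => hv (e ▸ hi)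
  choose f hf1 hf2 using fun i : J => W.exists_nb v i (hne i i.2)
  have hinj : Function.Injective f := fun i j h => by
    ext; rw [← hf1 i, ← hf1 j, h]
  by_contra hno
  push Not at hno
  have : Finset.univ.image f ⊆ F := by
    intro w hw
    obtain ⟨i, -, rfl⟩ := Finset.mem_image.1 hw
    exact hno _ (by rw [hf1]; exact i.2) (hf2 i) (W.hcol _ _ (hf2 i))
  have := Finset.card_le_card this
  rw [Finset.card_image_of_injective _ hinj] at this
  simp at this
  omega

/-- There is an edge between two blocks that avoids few given pairs. -/
theorem exists_edge (W : Weld G col blk m k) {i j : ι} (hij : i ≠ j) (c : Bool)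
    {F : Multiset (V × V)} (hF : Good col b F) (h : touching blk F i + touching blk F j < m) :
    ∃ x y, blk x = i ∧ blk y = j ∧ col x = c ∧ col y = (!c) ∧ G.Adj x y ∧
      x ∉ F.map Prod.fst + F.map Prod.snd ∧ y ∉ F.map Prod.fst + F.map Prod.snd := by
  -- A pair has only one entry of each colour, so it blocks at most one vertex of a given colour in
  -- a block, even if both entries lie there.
  have key : ∀ (i : ι) (c : Bool), ∃ S : Finset V, S.card ≤ touching blk F i ∧
      ∀ x, blk x = i → col x = c → x ∈ F.map Prod.fst + F.map Prod.snd → x ∈ S := by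
    intro i c
    refine ⟨((F.filter fun p => blk p.1 = i ∨ blk p.2 = i).map
      fun p => if c = b then p.1 else p.2).toFinset,
      (Multiset.toFinset_card_le _).trans (by rw [Multiset.card_map]; rfl), ?_⟩
    intro x hx hxc hxF
    rw [Multiset.mem_toFinset, Multiset.mem_map]
    rcases Multiset.mem_add.1 hxF with h | h <;> obtain ⟨p, hp, rfl⟩ := Multiset.mem_map.1 h
    · refine ⟨p, Multiset.mem_filter.2 ⟨hp, .inl hx⟩, ?_⟩
      rw [if_pos (by rw [← hxc, (hF.col p hp).1])]
    · refine ⟨p, Multiset.mem_filter.2 ⟨hp, .inr hx⟩, ?_⟩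
      rw [if_neg (by rw [← hxc, (hF.col p hp).2]; simp)]
  obtain ⟨S, hS, hS'⟩ := key i c
  obtain ⟨T, hT, hT'⟩ := key j (!c)
  have hne : ∀ v ∈ (group blk {i}).filter (col · = c), blk v ≠ j := by
    intro v hv
    simp only [Finset.mem_filter, mem_group, Finset.mem_singleton] at hv
    rw [hv.1]; exact hij
  choose f hf1 hf2 using fun v : (group blk {i}).filter (col · = c) => W.exists_nb v j (hne v v.2)
  by_contra hno
  push Not at hno
  have hcov : (group blk {i}).filter (col · = c) ⊆
      S ∪ (Finset.univ.filter fun v => f v ∈ T).image Subtype.val := by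
    intro v hv
    have hv' := hv
    simp only [Finset.mem_filter, mem_group, Finset.mem_singleton] at hv'
    by_cases hvS : v ∈ S
    · exact Finset.mem_union_left _ hvS
    · refine Finset.mem_union_right _ (Finset.mem_image.2 ⟨⟨v, hv⟩, ?_, rfl⟩)
      have hfc : col (f ⟨v, hv⟩) = !c := by rw [W.hcol _ _ (hf2 ⟨v, hv⟩), hv'.2]
      have := hno v (f ⟨v, hv⟩) hv'.1 (hf1 _) hv'.2 hfc (hf2 ⟨v, hv⟩)
        fun h => hvS (hS' v hv'.1 hv'.2 h)
      exact Finset.mem_filter.2 ⟨Finset.mem_univ _, hT' _ (hf1 _) hfc this⟩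
  have h1 := Finset.card_le_card hcov
  have h2 : (Finset.univ.filter fun v => f v ∈ T).card ≤ T.card := by
    refine Finset.card_le_card_of_injOn f (fun v hv => (Finset.mem_filter.1 hv).2) ?_
    intro v _ w _ hvw
    have hv := v.2
    have hw := w.2
    simp only [Finset.mem_filter, mem_group, Finset.mem_singleton] at hv hw
    refine Subtype.ext (W.nb_unique (f v) v w (hf2 v).symm (hvw ▸ (hf2 w).symm) ?_ ?_)
    · rw [hv.1, hw.1]
    · rw [hf1, hv.1]; exact hij.symm
  have h3 := Finset.card_union_le S ((Finset.univ.filter fun v => f v ∈ T).image Subtype.val)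
  have h4 : ((Finset.univ.filter fun v => f v ∈ T).image Subtype.val).card ≤ _ :=
    Finset.card_image_le
  rw [W.size] at h1
  omega

/-- A pair `p` is crossing if one entry lies in the blocks of `J₁` and the other one in those of
`J₂`. -/
def Crossing (blk : V → ι) (J₁ J₂ : Finset ι) (p : V × V) : Prop :=
  (blk p.1 ∈ J₁ ∧ blk p.2 ∈ J₂) ∨ (blk p.1 ∈ J₂ ∧ blk p.2 ∈ J₁)

/-- A crossing pair can be replaced by two pairs, one on each side, joined by an edge between the
blocks `i` and `j`. -/
theorem exists_step (W : Weld G col blk m k) {J₁ J₂ : Finset ι} (hJ : Disjoint J₁ J₂) {i j : ι}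
    (hi : i ∈ J₁) (hj : j ∈ J₂) {p : V × V} {F : Multiset (V × V)} (hp : Crossing blk J₁ J₂ p)
    (hF : Good col b (p ::ₘ F)) (h : touching blk F i + touching blk F j < m) :
    ∃ q r, (blk q.1 ∈ J₁ ∧ blk q.2 ∈ J₁) ∧ (blk r.1 ∈ J₂ ∧ blk r.2 ∈ J₂) ∧
      Good col b (q ::ₘ r ::ₘ F) ∧
      ∀ Y E, PathCover G Y (q ::ₘ r ::ₘ E) → PathCover G Y (p ::ₘ E) := by
  have hij : i ≠ j := fun e => Finset.disjoint_left.1 hJ hi (e ▸ hj)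
  have hdis : ∀ {x y}, blk x ∈ J₁ → blk y ∈ J₂ → x ≠ y := fun hx hy e =>
    Finset.disjoint_left.1 hJ hx (e ▸ hy)
  have hF' : Good col b F := hF.mono (Multiset.le_cons_self _ _)
  obtain ⟨s, t⟩ := p
  obtain ⟨hsc, htc⟩ := hF.col _ (Multiset.mem_cons_self _ _)
  have hnod := hF.nodup
  have hdiff : ∀ {x y c}, col x = c → col y = (!c) → x ≠ y := by
    rintro x _ c rfl h rfl; simp at h
  simp only [Multiset.map_cons, Multiset.cons_add, Multiset.add_cons] at hnod
  rw [Multiset.cons_swap] at hnod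
  have hgood : ∀ {x y : V} {c : Bool}, col x = c → col y = (!c) →
      x ∉ F.map Prod.fst + F.map Prod.snd → y ∉ F.map Prod.fst + F.map Prod.snd →
      x ≠ s → x ≠ t → y ≠ s → y ≠ t →
      (x ::ₘ y ::ₘ s ::ₘ t ::ₘ (F.map Prod.fst + F.map Prod.snd)).Nodup := by
    intro x y c hx hy hxF hyF h1 h2 h3 h4
    refine Multiset.nodup_cons.2 ⟨?_, Multiset.nodup_cons.2 ⟨?_, hnod⟩⟩
    · simp only [Multiset.mem_cons, not_or]
      exact ⟨hdiff hx hy, h1, h2, hxF⟩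
    · simp only [Multiset.mem_cons, not_or]
      exact ⟨h3, h4, hyF⟩
  rcases hp with ⟨hs, ht⟩ | ⟨hs, ht⟩ <;> simp only at hs ht hsc htc
  · obtain ⟨x, y, hx, hy, hxc, hyc, hxy, hxF, hyF⟩ := W.exists_edge hij (!b) hF' h
    refine ⟨(s, x), (y, t), ⟨hs, hx ▸ hi⟩, ⟨hy ▸ hj, ht⟩, ⟨?_, ?_⟩, fun Y E hY => hY.join hxy⟩
    · have := hgood hxc hyc hxF hyF (hdiff hsc hxc).symm (hdis (hx ▸ hi) ht)
        (hdis hs (hy ▸ hj)).symm (by rw [Bool.not_not] at hyc; exact hdiff hyc htc)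
      refine Multiset.nodup_of_le (le_of_eq ?_) this
      simp only [Multiset.map_cons]
      simp only [← Multiset.singleton_add]; abel
    · intro p hp
      simp only [Multiset.mem_cons] at hp
      rcases hp with rfl | rfl | hp
      exacts [⟨hsc, hxc⟩, ⟨by simpa using hyc, htc⟩, hF'.col p hp]
  · obtain ⟨x, y, hx, hy, hxc, hyc, hxy, hxF, hyF⟩ := W.exists_edge hij b hF' h
    refine ⟨(x, t), (s, y), ⟨hx ▸ hi, ht⟩, ⟨hs, hy ▸ hj⟩, ⟨?_, ?_⟩, fun Y E hY => ?_⟩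
    · have := hgood hxc hyc hxF hyF (hdis (hx ▸ hi) hs) (hdiff hxc htc)
        (hdiff hsc hyc).symm (hdis ht (hy ▸ hj)).symm
      refine Multiset.nodup_of_le (le_of_eq ?_) this
      simp only [Multiset.map_cons]
      simp only [← Multiset.singleton_add]; abel
    · intro p hp
      simp only [Multiset.mem_cons] at hp
      rcases hp with rfl | rfl | hp
      exacts [⟨hxc, htc⟩, ⟨hsc, hyc⟩, hF'.col p hp]
    · rw [Multiset.cons_swap] at hY
      exact hY.join hxy.symm

/-- All cuts use edges between the same blocks `i` and `j`. A cut adds at most one touching pair to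
each of them and removes one crossing pair, so the budget is preserved. The bound is `m + 1` because
the pair being cut and its two new entries need not be avoided. -/
theorem exists_cross (W : Weld G col blk m k) {J₁ J₂ : Finset ι} (hJ : Disjoint J₁ J₂) {i j : ι}
    (hi : i ∈ J₁) (hj : j ∈ J₂) (C K : Multiset (V × V)) (hC : ∀ p ∈ C, Crossing blk J₁ J₂ p)
    (hG : Good col b (C + K))
    (h : C = 0 ∨ touching blk K i + touching blk K j + 2 * C.card ≤ m + 1) :
    ∃ EX EY : Multiset (V × V), EX.card = C.card ∧ EY.card = C.card ∧ Inside (group blk J₁) EX ∧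
      Inside (group blk J₂) EY ∧ Good col b (EX + EY + K) ∧
      ∀ Y E, PathCover G Y (EX + EY + E) → PathCover G Y (C + E) := by
  induction C using Multiset.induction_on generalizing K with
  | empty => exact ⟨0, 0, rfl, rfl, by simp [Inside], by simp [Inside], by simpa using hG,
      fun Y E h => by simpa using h⟩
  | cons p C ih =>
    have hb : touching blk K i + touching blk K j + 2 * (C.card + 1) ≤ m + 1 := by
      rcases h with h | h
      · exact absurd h (Multiset.cons_ne_zero)
      · rwa [Multiset.card_cons] at h
    rw [Multiset.cons_add] at hG
    obtain ⟨q, r, hq, hr, hG', hjoin⟩ := W.exists_step hJ hi hj (hC p (Multiset.mem_cons_self _ _))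
      hG (by
        rw [touching_add, touching_add]
        have := touching_le (blk := blk) C i
        have := touching_le (blk := blk) C j
        omega)
    have hdis := Finset.disjoint_left.1 hJ
    have hqj : ¬ (blk q.1 = j ∨ blk q.2 = j) := by
      rintro (e | e)
      exacts [hdis hq.1 (e ▸ hj), hdis hq.2 (e ▸ hj)]
    have hri : ¬ (blk r.1 = i ∨ blk r.2 = i) := by
      rintro (e | e)
      exacts [hdis hi (e ▸ hr.1), hdis hi (e ▸ hr.2)]
    obtain ⟨EX, EY, h1, h2, h3, h4, h5, h6⟩ := ih (q ::ₘ r ::ₘ K)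
      (fun p hp => hC p (Multiset.mem_cons_of_mem hp))
      (by
        refine hG'.mono (le_of_eq ?_)
        simp only [← Multiset.singleton_add]; abel)
      (by
        right
        simp only [touching_cons, if_neg hqj, if_neg hri]
        split_ifs <;> omega)
    refine ⟨q ::ₘ EX, r ::ₘ EY, by simp [h1], by simp [h2], ?_, ?_, ?_, ?_⟩
    · intro p hp
      rcases Multiset.mem_cons.1 hp with rfl | hp
      exacts [by simpa using hq, h3 p hp]
    · intro p hp
      rcases Multiset.mem_cons.1 hp with rfl | hp
      exacts [by simpa using hr, h4 p hp]
    · refine h5.mono (le_of_eq ?_)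
      simp only [← Multiset.singleton_add]; abel
    · intro Y E hY
      have := h6 Y (q ::ₘ r ::ₘ E) (hY.congr (by simp only [← Multiset.singleton_add]; abel))
      rw [Multiset.cons_add]
      refine hjoin Y _ (this.congr ?_)
      simp only [← Multiset.singleton_add]; abel

theorem exists_parts {J₁ J₂ : Finset ι} (D : Multiset (V × V))
    (hD : Inside (group blk (J₁ ∪ J₂)) D) :
    ∃ DX DY C, D = DX + DY + C ∧ Inside (group blk J₁) DX ∧ Inside (group blk J₂) DY ∧
      ∀ p ∈ C, Crossing blk J₁ J₂ p := by
  induction D using Multiset.induction_on with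
  | empty => exact ⟨0, 0, 0, rfl, by simp [Inside], by simp [Inside], by simp⟩
  | cons p D ih =>
    obtain ⟨DX, DY, C, rfl, h1, h2, h3⟩ := ih (hD.mono (Multiset.le_cons_self _ _))
    have hp := hD p (Multiset.mem_cons_self _ _)
    simp only [mem_group, Finset.mem_union] at hp
    have hcons : ∀ {J : Finset ι} {E : Multiset (V × V)}, Inside (group blk J) E →
        blk p.1 ∈ J → blk p.2 ∈ J → Inside (group blk J) (p ::ₘ E) := by
      intro J E hE hp1 hp2 q hq
      rcases Multiset.mem_cons.1 hq with rfl | hq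
      exacts [⟨by simpa using hp1, by simpa using hp2⟩, hE q hq]
    have hcross : Crossing blk J₁ J₂ p → ∀ q ∈ p ::ₘ C, Crossing blk J₁ J₂ q := by
      intro hp q hq
      rcases Multiset.mem_cons.1 hq with rfl | hq
      exacts [hp, h3 q hq]
    rcases hp with ⟨hp1 | hp1, hp2 | hp2⟩
    · exact ⟨p ::ₘ DX, DY, C, by simp, hcons h1 hp1 hp2, h2, h3⟩
    · exact ⟨DX, DY, p ::ₘ C, by simp, h1, h2, hcross (.inl ⟨hp1, hp2⟩)⟩
    · exact ⟨DX, DY, p ::ₘ C, by simp, h1, h2, hcross (.inr ⟨hp1, hp2⟩)⟩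
    · exact ⟨DX, p ::ₘ DY, C, by simp, h1, hcons h2 hp1 hp2, h3⟩

/-- After all cuts each side must meet its own pairs and one half of every crossing pair. Pairs
inside one side touch at most one of the two chosen blocks, so they count once in the budget,
whereas crossing pairs count twice. -/
theorem cover_of_cross (W : Weld G col blk m k) {J₁ J₂ : Finset ι} (hJ : Disjoint J₁ J₂)
    (h₁ : J₁.Nonempty) (h₂ : J₂.Nonempty) {DX DY C : Multiset (V × V)}
    (hDX : Inside (group blk J₁) DX) (hDY : Inside (group blk J₂) DY)
    (hC : ∀ p ∈ C, Crossing blk J₁ J₂ p) (hG : Good col b (DX + DY + C))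
    (h : DX.card + DY.card + 2 * C.card ≤ m + 1)
    (hc₁ : Coverable G col (group blk J₁) (DX.card + C.card))
    (hc₂ : Coverable G col (group blk J₂) (DY.card + C.card)) :
    PathCover G (group blk (J₁ ∪ J₂)) (DX + DY + C) := by
  obtain ⟨i, hi⟩ := h₁
  obtain ⟨j, hj⟩ := h₂
  have hdis := Finset.disjoint_left.1 hJ
  obtain ⟨EX, EY, h1, h2, h3, h4, h5, h6⟩ := W.exists_cross hJ hi hj C (DX + DY) hC
    (by rwa [add_comm]) (by
      right
      rw [touching_add, touching_add, touching_eq_zero hDY (hdis hi),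
        touching_eq_zero hDX fun h => hdis h hj]
      have := touching_le (blk := blk) DX i
      have := touching_le (blk := blk) DY j
      omega)
  have hin : ∀ {J : Finset ι} {D E : Multiset (V × V)}, Inside (group blk J) D →
      Inside (group blk J) E → Inside (group blk J) (D + E) := fun hD hE p hp =>
    (Multiset.mem_add.1 hp).elim (hD p) (hE p)
  have hP := (hc₁ b (DX + EX) (h5.mono (by
    rw [show EX + EY + (DX + DY) = (DX + EX) + (EY + DY) by abel]
    exact Multiset.le_add_right _ _)) (hin hDX h3) (by simp [h1])).union
    (hc₂ b (DY + EY) (h5.mono (by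
    rw [show EX + EY + (DX + DY) = (DY + EY) + (EX + DX) by abel]
    exact Multiset.le_add_right _ _)) (hin hDY h4) (by simp [h2])) (group_disjoint hJ)
  rw [group_union, add_comm]
  exact h6 _ _ (hP.congr (by abel))

/-- An untouched group of blocks can be inserted into any path cover of other blocks. -/
theorem absorb (W : Weld G col blk m k) {J : Finset ι} (h₁ : J.Nonempty) {Y : Finset V}
    (hJ : Disjoint (group blk J) Y) {D : Multiset (V × V)} (hD : D ≠ 0)
    (hG : ∀ p ∈ D, col p.1 = b ∧ col p.2 = !b) (hc : Coverable G col (group blk J) 1)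
    (h : PathCover G Y D) : PathCover G (group blk J ∪ Y) D := by
  obtain ⟨⟨s, t⟩, hp⟩ := Multiset.exists_mem_of_ne_zero hD
  obtain ⟨D, rfl⟩ := Multiset.exists_cons_of_mem hp
  obtain ⟨hs, ht⟩ := hG _ hp
  -- The first edge of some path is replaced by a detour spanning the new blocks. The matching
  -- neighbours of its ends have different colours again.
  obtain ⟨v, hsv, h⟩ := h.cut_first (by rintro rfl; simp [hs] at ht)
  obtain ⟨i, hi⟩ := h₁
  have hne : ∀ x ∈ Y, blk x ≠ i := fun x hx e =>
    Finset.disjoint_left.1 hJ (mem_group.2 (e ▸ hi)) hx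
  have hsY := h.left_mem
  rw [Multiset.cons_swap] at h
  have hvY := h.left_mem
  obtain ⟨s', hs', hss'⟩ := W.exists_nb s i (hne s hsY)
  obtain ⟨v', hv', hvv'⟩ := W.exists_nb v i (hne v hvY)
  have hsc' := W.hcol _ _ hss'
  have hvc' := W.hcol _ _ hvv'
  have hvc := W.hcol _ _ hsv
  have h1 := hc (!b) {(s', v')} (by
    refine .of_nodup (by simp) (by simp) ?_
    simp only [Multiset.mem_singleton, forall_eq]
    rw [hsc', hvc', hvc, hs]; simp) (by
    simp only [Inside, Multiset.mem_singleton, forall_eq, mem_group, hs', hv']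
    exact ⟨hi, hi⟩) (by simp)
  have h2 := h1.union h hJ
  have h3 : PathCover G (group blk J ∪ Y) ((s, v') ::ₘ (v, t) ::ₘ D) := by
    refine PathCover.join (b := s) (c := s') (h2.congr ?_) hss'
    simp only [← Multiset.singleton_add]; abel
  exact h3.join hvv'.symm

/-- All demands of fewer than `k` pairs can be met in every union of blocks. -/
theorem coverable_group (W : Weld G col blk m k) {J : Finset ι} (hJ : J.Nonempty) {l : ℕ}
    (h1 : 1 ≤ l) (hl : l < k) : Coverable G col (group blk J) l := by
  have hb := W.two_mul_le
  induction J using Finset.induction_on generalizing l with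
  | empty => simp at hJ
  | insert i J hi ih =>
    rcases J.eq_empty_or_nonempty with rfl | hJ'
    · exact W.cov i l h1 hl
    intro b D hG hD hDc
    rw [Finset.insert_eq] at hD ⊢
    have hdis : Disjoint {i} J := by simpa using hi
    obtain ⟨DX, DY, C, rfl, hX, hY, hC⟩ := exists_parts D hD
    simp only [Multiset.card_add] at hDc
    -- Nothing is known about empty demands, so a side without any pair has to be absorbed by the
    -- other one.
    by_cases hx : DX.card + C.card = 0
    · obtain ⟨rfl, rfl⟩ : DX = 0 ∧ C = 0 := by
        simpa only [Multiset.card_eq_zero] using (by omega : DX.card = 0 ∧ C.card = 0)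
      simp only [add_zero, zero_add, Multiset.card_zero] at hG hDc ⊢
      rw [group_union]
      exact W.absorb (by simp) (group_disjoint hdis) (by rintro rfl; simp at hDc; omega) hG.col
        (W.cov i 1 le_rfl (by omega)) (ih hJ' h1 hl _ _ hG hY hDc)
    by_cases hy : DY.card + C.card = 0
    · obtain ⟨rfl, rfl⟩ : DY = 0 ∧ C = 0 := by
        simpa only [Multiset.card_eq_zero] using (by omega : DY.card = 0 ∧ C.card = 0)
      simp only [add_zero, Multiset.card_zero] at hG hDc ⊢
      rw [Finset.union_comm, group_union]
      exact W.absorb hJ' (group_disjoint hdis.symm) (by rintro rfl; simp at hDc; omega) hG.col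
        (ih hJ' le_rfl (by omega)) (W.cov i l h1 hl _ _ hG hX hDc)
    exact W.cover_of_cross hdis (by simp) hJ' hX hY hC hG (by omega)
      (W.cov i _ (by omega) (by omega)) (ih hJ' (by omega) (by omega))

/-- Two path ends of different colours can be joined through an untouched group of blocks. -/
theorem bridge (W : Weld G col blk m k) {J : Finset ι} (h₁ : J.Nonempty) {Y : Finset V}
    (hJ : Disjoint (group blk J) Y) {a w v c : V} (hvw : col v = !col w)
    (h : PathCover G Y ((a, w) ::ₘ (v, c) ::ₘ D)) :
    PathCover G (group blk J ∪ Y) ((a, c) ::ₘ D) := by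
  obtain ⟨i, hi⟩ := h₁
  have hne : ∀ x ∈ Y, blk x ≠ i := fun x hx e =>
    Finset.disjoint_left.1 hJ (mem_group.2 (e ▸ hi)) hx
  have hwY := h.right_mem
  have hvY := (Multiset.cons_swap _ _ _ ▸ h : PathCover G Y ((v, c) ::ₘ (a, w) ::ₘ D)).left_mem
  obtain ⟨w', hw', hww'⟩ := W.exists_nb w i (hne w hwY)
  obtain ⟨v', hv', hvv'⟩ := W.exists_nb v i (hne v hvY)
  have hc := W.coverable_group ⟨i, hi⟩ le_rfl W.two_le
  have h1 := hc (!col w) {(w', v')} (by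
    refine .of_nodup (by simp) (by simp) ?_
    simp only [Multiset.mem_singleton, forall_eq]
    rw [W.hcol _ _ hww', W.hcol _ _ hvv', hvw]; simp) (by
    simp only [Inside, Multiset.mem_singleton, forall_eq, mem_group, hw', hv']
    exact ⟨hi, hi⟩) (by simp)
  have h2 : PathCover G (group blk J ∪ Y) ((a, v') ::ₘ (v, c) ::ₘ D) := by
    refine PathCover.join (b := w) (c := w') ((h1.union h hJ).congr ?_) hww'
    simp only [← Multiset.singleton_add]; abel
  exact h2.join hvv'.symm

/-- A demand of `k` pairs can be met if some pairs are confined to complementary sides. -/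
theorem cover_of_split (W : Weld G col blk m k) {J₁ J₂ : Finset ι} (hJ : Disjoint J₁ J₂)
    {D : Multiset (V × V)} (hG : Good col b D) (hD : Inside (group blk (J₁ ∪ J₂)) D)
    (hDk : D.card = k) {p q : V × V} (hp : p ∈ D) (hq : q ∈ D) (hp1 : blk p.1 ∈ J₁)
    (hp2 : blk p.2 ∈ J₁) (hq1 : blk q.1 ∈ J₂) (hq2 : blk q.2 ∈ J₂) :
    PathCover G (group blk (J₁ ∪ J₂)) D := by
  have hb := W.two_mul_le
  have hdis := Finset.disjoint_left.1 hJ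
  obtain ⟨DX, DY, C, rfl, hX, hY, hC⟩ := exists_parts D hD
  have hpX : p ∈ DX := by
    simp only [Multiset.mem_add] at hp
    rcases hp with (hp | hp) | hp
    · exact hp
    · exact absurd (mem_group.1 (hY p hp).1) (hdis hp1)
    · rcases hC p hp with ⟨-, h⟩ | ⟨h, -⟩
      exacts [absurd h (hdis hp2), absurd h (hdis hp1)]
  have hqY : q ∈ DY := by
    simp only [Multiset.mem_add] at hq
    rcases hq with (hq | hq) | hq
    · exact absurd hq1 (hdis (mem_group.1 (hX q hq).1))
    · exact hq
    · rcases hC q hq with ⟨h, -⟩ | ⟨-, h⟩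
      exacts [absurd hq1 (hdis h), absurd hq2 (hdis h)]
  have h1 := Multiset.card_pos_iff_exists_mem.2 ⟨p, hpX⟩
  have h2 := Multiset.card_pos_iff_exists_mem.2 ⟨q, hqY⟩
  simp only [Multiset.card_add] at hDk
  -- As `DX` and `DY` are nonempty, the budget is at most `2 * k - 2 ≤ m + 1`, and each side
  -- receives at most `k - 1` pairs.
  exact W.cover_of_cross hJ ⟨_, hp1⟩ ⟨_, hq1⟩ hX hY hC hG (by omega)
    (W.coverable_group ⟨_, hp1⟩ (by omega) (by omega))
    (W.coverable_group ⟨_, hq1⟩ (by omega) (by omega))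

end Weld

end

/-! ### Demands of `k` pairs: rerouting, triangles, and stars with a pair inside the centre. -/

section

theorem PathCover.exists_cut_cons {V : Type*} [DecidableEq V] {G : SimpleGraph V} {X : Finset V}
    {D : Multiset (V × V)} {a b v : V} (h : PathCover G X ((a, b) ::ₘ D)) (hv : v ∈ X) :
    (v = a ∨ ∃ u, G.Adj u v ∧ PathCover G X ((a, u) ::ₘ (v, b) ::ₘ D)) ∨
      ∃ c d E, D = (c, d) ::ₘ E ∧
        (v = c ∨ ∃ u, G.Adj u v ∧ PathCover G X ((a, b) ::ₘ (c, u) ::ₘ (v, d) ::ₘ E)) := by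
  obtain ⟨c, d, E, hE, h'⟩ := h.exists_cut hv
  rcases Multiset.cons_eq_cons.1 hE with ⟨h1, rfl⟩ | ⟨-, F, rfl, rfl⟩
  · cases h1; exact .inl h'
  · refine .inr ⟨c, d, F, rfl, h'.imp_right ?_⟩
    rintro ⟨u, hu, h''⟩
    refine ⟨u, hu, h''.congr ?_⟩
    simp only [← Multiset.singleton_add]; abel

variable {V ι : Type*} [Fintype V] [DecidableEq V] [DecidableEq ι] {G : SimpleGraph V}
  {col : V → Bool} {b : Bool} {blk : V → ι} {m k : ℕ} {D E : Multiset (V × V)}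

theorem Inside.cons {X : Finset V} {p : V × V} (h1 : p.1 ∈ X) (h2 : p.2 ∈ X) (h : Inside X D) :
    Inside X (p ::ₘ D) := by
  intro q hq
  rcases Multiset.mem_cons.1 hq with rfl | hq
  exacts [⟨h1, h2⟩, h q hq]

theorem Inside.add {X : Finset V} (h : Inside X D) (h' : Inside X E) : Inside X (D + E) :=
  fun p hp => (Multiset.mem_add.1 hp).elim (h p) (h' p)

theorem touching_lt {F : Multiset (V × V)} {i : ι} {q : V × V} (hq : q ∈ F) (h1 : blk q.1 ≠ i)
    (h2 : blk q.2 ≠ i) : touching blk F i + 1 ≤ F.card := by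
  obtain ⟨F, rfl⟩ := Multiset.exists_cons_of_mem hq
  rw [touching_cons, if_neg (by simp [h1, h2]), Multiset.card_cons]
  have := touching_le (blk := blk) F i
  omega

theorem touching_cons_of_ne {F : Multiset (V × V)} {i : ι} {q : V × V} (h1 : blk q.1 ≠ i)
    (h2 : blk q.2 ≠ i) : touching blk (q ::ₘ F) i = touching blk F i := by
  rw [touching_cons, if_neg (by simp [h1, h2]), zero_add]

theorem touching_cons_le (p : V × V) (F : Multiset (V × V)) (i : ι) :
    touching blk (p ::ₘ F) i ≤ touching blk F i + 1 := by
  rw [touching_cons]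
  split_ifs <;> omega

theorem group_univ [Fintype ι] : group blk (Finset.univ : Finset ι) = Finset.univ := by
  ext; simp

namespace Weld

/-- If the remaining pairs `D` are covered inside the blocks `I`, then the pair `(s, t)` inside `I`
can be added with the help of the blocks `J`. -/
theorem cover_of_inner (W : Weld G col blk m k) {I J : Finset ι} (hIJ : Disjoint I J)
    (hJ : J.Nonempty) {s t : V} (hG : Good col b ((s, t) ::ₘ D)) (hs : blk s ∈ I)
    (ht : blk t ∈ I) (hcard : 2 ≤ D.card → 3 ≤ J.card) (h : PathCover G (group blk I) D) :
    PathCover G (group blk (J ∪ I)) ((s, t) ::ₘ D) := by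
  have hcol := W.hcol
  obtain ⟨hsc, htc⟩ := hG.col _ (Multiset.mem_cons_self _ _)
  have hsD : ∀ p ∈ D, s ≠ p.1 := by
    intro p hp e
    have := hG.fst_nodup
    rw [Multiset.map_cons, Multiset.nodup_cons] at this
    exact this.1 (Multiset.mem_map.2 ⟨p, hp, e.symm⟩)
  have htD : ∀ p ∈ D, t ≠ p.2 := by
    intro p hp e
    have := hG.snd_nodup
    rw [Multiset.map_cons, Multiset.nodup_cons] at this
    exact this.1 (Multiset.mem_map.2 ⟨p, hp, e.symm⟩)
  have hDc : ∀ p ∈ D, col p.1 = b ∧ col p.2 = !b := fun p hp =>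
    hG.col p (Multiset.mem_cons_of_mem hp)
  have hne : ∀ {x y : V} {c : Bool}, col x = c → col y = (!c) → x ≠ y := by
    rintro x _ c rfl h rfl; simp at h
  -- If `s` and `t` lie on the same path, the segment between them is the new path, and the two
  -- outer parts, whose loose ends have different colours, are bridged through `J`.
  obtain ⟨e, f, D, rfl, rfl | ⟨u, hus, h⟩⟩ := h.exists_cut (v := s) (by simpa using hs)
  · exact absurd rfl (hsD _ (Multiset.mem_cons_self _ _))
  obtain ⟨hec, hfc⟩ := hDc _ (Multiset.mem_cons_self _ _)
  have htf := htD _ (Multiset.mem_cons_self _ _)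
  simp only at hec hfc htf
  have huc : col u = !b := by rw [hcol _ _ hus.symm, hsc]
  rw [group_union]
  rcases h.exists_cut_cons (v := t) (by simpa using ht) with
    (rfl | ⟨w, hwt, h⟩) | ⟨c, d, E, hE, h'⟩
  · simp [hec] at htc
  · -- `t` precedes `s` on the path
    have h : PathCover G (group blk I) ((s, f) ::ₘ (e, w) ::ₘ (t, u) ::ₘ D) :=
      h.congr (by simp only [← Multiset.singleton_add]; abel)
    obtain ⟨v, hsv, h⟩ := h.cut_first (hne hsc hfc)
    have h : PathCover G (group blk I) ((t, s) ::ₘ (e, w) ::ₘ (v, f) ::ₘ D) := by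
      refine PathCover.join (b := u) (c := s) (h.congr ?_) hus
      simp only [← Multiset.singleton_add]; abel
    refine (W.bridge hJ (group_disjoint hIJ.symm) (w := w) (v := v) (a := e) (c := f)
      ?_ (h.reverse.congr ?_)).congr (Multiset.cons_swap _ _ _)
    · rw [hcol _ _ hsv, hcol _ _ hwt.symm, hsc, htc, Bool.not_not]
    · simp only [← Multiset.singleton_add]; abel
  · rcases Multiset.cons_eq_cons.1 hE with ⟨h1, rfl⟩ | ⟨-, F, rfl, rfl⟩
    · -- `s` precedes `t` on the path
      cases h1
      rcases h' with rfl | ⟨x, hxt, h⟩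
      · simp [hsc] at htc
      have h : PathCover G (group blk I) ((t, f) ::ₘ (s, x) ::ₘ (e, u) ::ₘ D) :=
        h.congr (by simp only [← Multiset.singleton_add]; abel)
      obtain ⟨z, htz, h⟩ := h.cut_first htf
      have h : PathCover G (group blk I) ((s, t) ::ₘ (e, u) ::ₘ (z, f) ::ₘ D) := by
        refine PathCover.join (b := x) (c := t) (h.congr ?_) hxt
        simp only [← Multiset.singleton_add]; abel
      refine (W.bridge hJ (group_disjoint hIJ.symm) (w := u) (v := z) (a := e) (c := f)
        ?_ (h.congr ?_)).congr (Multiset.cons_swap _ _ _)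
      · rw [hcol _ _ htz, huc, htc]
      · simp only [← Multiset.singleton_add]; abel
    · -- `t` lies on another path
      have hcd : (c, d) ∈ (e, f) ::ₘ (c, d) ::ₘ F := by simp
      obtain ⟨hcc, hdc⟩ := hDc _ hcd
      have htd := htD _ hcd
      simp only at hcc hdc htd
      rcases h' with rfl | ⟨w, hwt, h⟩
      · simp [hcc] at htc
      have h : PathCover G (group blk I) ((t, d) ::ₘ (c, w) ::ₘ (e, u) ::ₘ (s, f) ::ₘ F) :=
        h.congr (by simp only [← Multiset.singleton_add]; abel)
      -- Removing only `s` and `t` would leave gaps whose two ends have equal colours. Taking out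
      -- the edges `s u` and `t z` instead gives three gaps, `u` to `z`, `u₂` to `v` and `w` to
      -- `z₂`, each with ends of different colours.
      obtain ⟨z, htz, h⟩ := h.cut_first htd
      have hzc : col z = b := by rw [hcol _ _ htz, htc, Bool.not_not]
      rw [Multiset.cons_swap] at h
      obtain ⟨z₂, hz, h⟩ := h.cut_first (hne hzc hdc)
      have h : PathCover G (group blk I)
          ((s, f) ::ₘ (t, z) ::ₘ (z₂, d) ::ₘ (c, w) ::ₘ (e, u) ::ₘ F) := by
        refine (PathCover.join (b := t) (c := z) (a := t) (d := z)
          (D := (s, f) ::ₘ (z₂, d) ::ₘ (c, w) ::ₘ (e, u) ::ₘ F) (h.congr ?_) htz).congr ?_ <;>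
        · simp only [← Multiset.singleton_add]; abel
      obtain ⟨v, hsv, h⟩ := h.cut_first (hne hsc hfc)
      have h : PathCover G (group blk I)
          ((e, u) ::ₘ (s, s) ::ₘ (v, f) ::ₘ (t, z) ::ₘ (z₂, d) ::ₘ (c, w) ::ₘ F) :=
        h.congr (by simp only [← Multiset.singleton_add]; abel)
      obtain ⟨u₂, hu, h⟩ := h.cut_last (hne hec huc)
      have h : PathCover G (group blk I)
          ((s, u) ::ₘ (e, u₂) ::ₘ (v, f) ::ₘ (t, z) ::ₘ (z₂, d) ::ₘ (c, w) ::ₘ F) := by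
        refine PathCover.join (b := s) (c := u) (h.congr ?_) hus.symm
        simp only [← Multiset.singleton_add]; abel
      have h : PathCover G (group blk I)
          ((z, t) ::ₘ (s, u) ::ₘ (e, u₂) ::ₘ (v, f) ::ₘ (z₂, d) ::ₘ (c, w) ::ₘ F) := by
        refine (h.congr ?_ : PathCover G (group blk I)
          ((t, z) ::ₘ (s, u) ::ₘ (e, u₂) ::ₘ (v, f) ::ₘ (z₂, d) ::ₘ (c, w) ::ₘ F)).reverse
        simp only [← Multiset.singleton_add]; abel
      -- Each of the three gaps is bridged through its own group of blocks, and the groups must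
      -- exhaust `J`.
      have hJ3 : 2 < J.card := hcard (by simp)
      obtain ⟨x, hx, y, hy, z', hz', hxy, hxz, hyz⟩ := Finset.two_lt_card.1 hJ3
      set K : Finset ι := (J.erase x).erase y with hK
      have hKne : K.Nonempty := ⟨z', by simp [hK, hz', hxz.symm, hyz.symm]⟩
      have hJK : J = {x} ∪ ({y} ∪ K) := by
        ext i
        simp only [hK, Finset.mem_union, Finset.mem_singleton, Finset.mem_erase]
        by_cases h1 : i = x
        · simp [h1, hx]
        · by_cases h2 : i = y <;> simp [h1, h2, hy]
      have hdis := Finset.disjoint_left.1 hIJ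
      have hd1 : Disjoint K I := by
        rw [Finset.disjoint_right]
        intro i hi hiK
        exact hdis hi (Finset.mem_of_mem_erase (Finset.mem_of_mem_erase hiK))
      have hd2 : Disjoint {y} (K ∪ I) := by
        rw [Finset.disjoint_singleton_left, Finset.mem_union, not_or]
        exact ⟨by simp [hK], fun hi => hdis hi hy⟩
      have hd3 : Disjoint {x} ({y} ∪ (K ∪ I)) := by
        rw [Finset.disjoint_singleton_left]
        simp only [Finset.mem_union, Finset.mem_singleton, not_or]
        exact ⟨hxy, by simp [hK], fun hi => hdis hi hx⟩
      have h1 := W.bridge hKne (group_disjoint hd1) (w := u) (v := z) (a := s) (c := t)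
        (D := (e, u₂) ::ₘ (v, f) ::ₘ (z₂, d) ::ₘ (c, w) ::ₘ F) (by rw [huc, hzc, Bool.not_not])
        (h.congr (Multiset.cons_swap _ _ _))
      rw [← group_union] at h1
      have h2 := W.bridge (J := {y}) (by simp) (group_disjoint hd2) (w := u₂) (v := v) (a := e)
        (c := f) (D := (s, t) ::ₘ (z₂, d) ::ₘ (c, w) ::ₘ F)
        (by rw [hcol _ _ hsv, hcol _ _ hu.symm, hsc, huc, Bool.not_not])
        (h1.congr (by simp only [← Multiset.singleton_add]; abel))
      rw [← group_union] at h2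
      have h3 := W.bridge (J := {x}) (by simp) (group_disjoint hd3) (w := w) (v := z₂) (a := c)
        (c := d) (D := (e, f) ::ₘ (s, t) ::ₘ F)
        (by rw [hcol _ _ hz, hzc, hcol _ _ hwt.symm, htc, Bool.not_not])
        (h2.congr (by simp only [← Multiset.singleton_add]; abel))
      rw [← group_union, show {x} ∪ ({y} ∪ (K ∪ I)) = J ∪ I by
        rw [hJK, Finset.union_assoc, Finset.union_assoc]] at h3
      rw [← group_union]
      exact h3.congr (by simp only [← Multiset.singleton_add]; abel)

theorem disjoint_erase [Fintype ι] (i : ι) : Disjoint {i} (Finset.univ.erase i) := by simp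

theorem union_erase [Fintype ι] (i : ι) : {i} ∪ Finset.univ.erase i = Finset.univ := by
  rw [← Finset.insert_eq, Finset.insert_erase (Finset.mem_univ i)]

theorem inside_univ [Fintype ι] (D : Multiset (V × V)) (i : ι) :
    Inside (group blk ({i} ∪ Finset.univ.erase i)) D := by
  rw [union_erase, group_univ]
  exact fun _ _ => ⟨Finset.mem_univ _, Finset.mem_univ _⟩

/-- No block contains both entries of a pair, and two pairs leave block `i` for different blocks,
while some pair does not touch block `i`. -/
theorem cover_of_triangle [Fintype ι] (W : Weld G col blk m k) {p q r : V × V} {i j l : ι}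
    (hG : Good col b (p ::ₘ r ::ₘ D)) (hDk : (p ::ₘ r ::ₘ D).card = k)
    (hloop : ∀ p ∈ D, blk p.1 ≠ blk p.2) (hij : i ≠ j) (hil : i ≠ l) (hjl : j ≠ l)
    (hp : Crossing blk {i} {j} p) (hr : Crossing blk {i} {l} r) (hq : q ∈ D) (hq1 : blk q.1 ≠ i)
    (hq2 : blk q.2 ≠ i) : PathCover G Finset.univ (p ::ₘ r ::ₘ D) := by
  have hb := W.two_mul_le
  simp only [Multiset.card_cons] at hDk
  have htD := touching_lt hq hq1 hq2
  have hrj : blk r.1 ≠ j ∧ blk r.2 ≠ j := by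
    rcases hr with ⟨h1, h2⟩ | ⟨h1, h2⟩ <;> rw [Finset.mem_singleton] at h1 h2 <;> rw [h1, h2] <;>
      simp [hij, hjl.symm]
  obtain ⟨q₁, r₁, hq₁, hr₁, hG, hjoin₁⟩ := W.exists_step (by simpa using hij)
    (Finset.mem_singleton_self i) (Finset.mem_singleton_self j) hp hG (by
      rw [touching_cons_of_ne hrj.1 hrj.2]
      have := touching_cons_le (blk := blk) r D i
      have := touching_le (blk := blk) D j
      omega)
  simp only [Finset.mem_singleton] at hq₁ hr₁
  obtain ⟨q₂, r₂, hq₂, hr₂, hG, hjoin₂⟩ := W.exists_step (F := q₁ ::ₘ r₁ ::ₘ D)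
    (by simpa using hil) (Finset.mem_singleton_self i) (Finset.mem_singleton_self l) hr
    (hG.mono (le_of_eq (by simp only [← Multiset.singleton_add]; abel))) (by
      have h1 := touching_cons_le (blk := blk) q₁ (r₁ ::ₘ D) i
      rw [touching_cons_of_ne (q := r₁) (by rw [hr₁.1]; exact hij.symm)
        (by rw [hr₁.2]; exact hij.symm)] at h1
      have h2 : touching blk (q₁ ::ₘ r₁ ::ₘ D) l = touching blk D l := by
        rw [touching_cons_of_ne (by rw [hq₁.1]; exact hil) (by rw [hq₁.2]; exact hil),
          touching_cons_of_ne (by rw [hr₁.1]; exact hjl) (by rw [hr₁.2]; exact hjl)]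
      have := touching_le (blk := blk) D l
      omega)
  simp only [Finset.mem_singleton] at hq₂ hr₂
  obtain ⟨DX, DY, C, rfl, hX, hY, hC⟩ := exists_parts D (inside_univ (blk := blk) D i)
  obtain rfl : DX = 0 := by
    refine Multiset.eq_zero_of_forall_notMem fun p hp => hloop p (by simp [hp]) ?_
    have := hX p hp
    simp only [mem_group, Finset.mem_singleton] at this
    rw [this.1, this.2]
  rw [zero_add] at *
  have hqDY : q ∈ DY := by
    rcases Multiset.mem_add.1 hq with h | h
    · exact h
    · rcases hC q h with ⟨h, -⟩ | ⟨-, h⟩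
      · exact absurd (Finset.mem_singleton.1 h) hq1
      · exact absurd (Finset.mem_singleton.1 h) hq2
  have hDYc := Multiset.card_pos_iff_exists_mem.2 ⟨q, hqDY⟩
  rw [Multiset.card_add] at hDk
  have hjm : j ∈ Finset.univ.erase i := by simp [hij.symm]
  have hlm : l ∈ Finset.univ.erase i := by simp [hil.symm]
  obtain ⟨EX, EY, h1, h2, h3, h4, h5, h6⟩ := W.exists_cross (disjoint_erase i)
    (Finset.mem_singleton_self i) hjm C (q₂ ::ₘ r₂ ::ₘ q₁ ::ₘ r₁ ::ₘ DY) hC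
    (hG.mono (le_of_eq (by simp only [← Multiset.singleton_add]; abel))) (by
      right
      have e1 := touching_cons_le (blk := blk) q₂ (r₂ ::ₘ q₁ ::ₘ r₁ ::ₘ DY) i
      have e2 := touching_cons_le (blk := blk) q₁ (r₁ ::ₘ DY) i
      rw [touching_cons_of_ne (q := r₂) (by rw [hr₂.1]; exact hil.symm)
        (by rw [hr₂.2]; exact hil.symm)] at e1
      rw [touching_cons_of_ne (q := r₁) (by rw [hr₁.1]; exact hij.symm)
        (by rw [hr₁.2]; exact hij.symm), touching_eq_zero hY (by simp)] at e2
      have e3 : touching blk (q₂ ::ₘ r₂ ::ₘ q₁ ::ₘ r₁ ::ₘ DY) j ≤ DY.card + 1 := by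
        rw [touching_cons_of_ne (by rw [hq₂.1]; exact hij) (by rw [hq₂.2]; exact hij),
          touching_cons_of_ne (by rw [hr₂.1]; exact hjl.symm) (by rw [hr₂.2]; exact hjl.symm),
          touching_cons_of_ne (by rw [hq₁.1]; exact hij) (by rw [hq₁.2]; exact hij)]
        have := touching_cons_le (blk := blk) r₁ DY j
        have := touching_le (blk := blk) DY j
        omega
      omega)
  -- The pair `q` avoids block `i`, so the block has to meet at most `k - 1` pairs.
  have hPX := W.cov i (C.card + 2) (by omega) (by omega) b (q₁ ::ₘ q₂ ::ₘ EX)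
    (h5.mono (by
      rw [show EX + EY + (q₂ ::ₘ r₂ ::ₘ q₁ ::ₘ r₁ ::ₘ DY) =
        (q₁ ::ₘ q₂ ::ₘ EX) + (r₂ ::ₘ r₁ ::ₘ (EY + DY)) by
          simp only [← Multiset.singleton_add]; abel]
      exact Multiset.le_add_right _ _))
    (.cons (by simp [hq₁]) (by simp [hq₁]) (.cons (by simp [hq₂]) (by simp [hq₂]) h3))
    (by simp [h1])
  have hspl : Finset.univ.erase i = {j} ∪ (Finset.univ.erase i).erase j := by
    rw [← Finset.insert_eq, Finset.insert_erase hjm]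
  have hPY : PathCover G (group blk (Finset.univ.erase i)) (r₁ ::ₘ r₂ ::ₘ (EY + DY)) := by
    have hin : Inside (group blk (Finset.univ.erase i)) (r₁ ::ₘ r₂ ::ₘ (EY + DY)) :=
      .cons (by simp [hr₁, hij.symm]) (by simp [hr₁, hij.symm])
        (.cons (by simp [hr₂, hil.symm]) (by simp [hr₂, hil.symm]) (h4.add hY))
    rw [hspl] at hin ⊢
    -- Outside of `i` there are still `k` pairs, but `r₁` is confined to block `j` and `r₂` to block
    -- `l`.
    refine W.cover_of_split (b := b) (p := r₁) (q := r₂) (by simp) (h5.mono ?_) hin ?_ (by simp)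
      (by simp) (by simp [hr₁]) (by simp [hr₁]) (by simp [hr₂, hil.symm, hjl.symm])
      (by simp [hr₂, hil.symm, hjl.symm])
    · rw [show EX + EY + (q₂ ::ₘ r₂ ::ₘ q₁ ::ₘ r₁ ::ₘ DY) =
        (r₁ ::ₘ r₂ ::ₘ (EY + DY)) + (q₁ ::ₘ q₂ ::ₘ EX) by
          simp only [← Multiset.singleton_add]; abel]
      exact Multiset.le_add_right _ _
    · simp [h2]; omega
  have hP := hPX.union hPY (group_disjoint (disjoint_erase i))
  rw [← group_union, union_erase, group_univ] at hP
  have hP := h6 _ (q₁ ::ₘ r₁ ::ₘ q₂ ::ₘ r₂ ::ₘ DY)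
    (hP.congr (by simp only [← Multiset.singleton_add]; abel))
  refine hjoin₁ _ _ ?_
  refine (hjoin₂ _ (q₁ ::ₘ r₁ ::ₘ (DY + C)) (hP.congr ?_)).congr ?_ <;>
  · simp only [← Multiset.singleton_add]; abel

/-- All pairs touch block `i`, one pair lies inside this block and one leaves it. -/
theorem cover_of_star_loop [Fintype ι] (W : Weld G col blk m k) (hι : k + 1 ≤ Fintype.card ι)
    {i : ι} {s t : V} {p₀ : V × V} (hG : Good col b ((s, t) ::ₘ D))
    (hDk : ((s, t) ::ₘ D).card = k) (hstar : ∀ p ∈ D, blk p.1 = i ∨ blk p.2 = i)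
    (hs : blk s = i) (ht : blk t ≠ i) (hp₀ : p₀ ∈ D) (h₁ : blk p₀.1 = i) (h₂ : blk p₀.2 = i) :
    PathCover G Finset.univ ((s, t) ::ₘ D) := by
  have hb := W.two_mul_le
  have hcol := W.hcol
  obtain ⟨hsc, htc⟩ := hG.col _ (Multiset.mem_cons_self _ _)
  simp only at hsc htc
  have hne : ∀ {x y : V} {c : Bool}, col x = c → col y = (!c) → x ≠ y := by
    rintro x _ c rfl h rfl; simp at h
  rw [Multiset.card_cons] at hDk
  obtain ⟨DX, DY, C, rfl, hX, hY, hC⟩ := exists_parts D (inside_univ (blk := blk) D i)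
  obtain rfl : DY = 0 := by
    refine Multiset.eq_zero_of_forall_notMem fun p hp => ?_
    have h1 := hY p hp
    simp only [mem_group, Finset.mem_erase, Finset.mem_univ, and_true] at h1
    rcases hstar p (by simp [hp]) with h | h
    exacts [h1.1 h, h1.2 h]
  rw [add_zero] at *
  have hp₀X : p₀ ∈ DX := by
    rcases Multiset.mem_add.1 hp₀ with h | h
    · exact h
    · rcases hC p₀ h with ⟨-, h⟩ | ⟨h, -⟩
      · exact absurd h₂ (Finset.mem_erase.1 h).1
      · exact absurd h₁ (Finset.mem_erase.1 h).1
  have hDXc := Multiset.card_pos_iff_exists_mem.2 ⟨p₀, hp₀X⟩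
  rw [Multiset.card_add] at hDk
  -- an untouched block `z`
  obtain ⟨z, hz, hzT⟩ : ∃ z ∈ Finset.univ.erase i,
      z ∉ insert (blk t) (C.map fun q => if blk q.1 = i then blk q.2 else blk q.1).toFinset := by
    refine Finset.exists_mem_notMem_of_card_lt_card ?_
    refine (Finset.card_insert_le _ _).trans_lt ?_
    have := Multiset.toFinset_card_le (C.map fun q => if blk q.1 = i then blk q.2 else blk q.1)
    rw [Multiset.card_map] at this
    rw [Finset.card_erase_of_mem (Finset.mem_univ _), Finset.card_univ]
    omega
  simp only [Finset.mem_insert, Multiset.mem_toFinset, Multiset.mem_map, not_or, not_exists,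
    not_and] at hzT
  have hzi : z ≠ i := (Finset.mem_erase.1 hz).1
  set J : Finset ι := (Finset.univ.erase i).erase z with hJ
  have hiJ : Disjoint {i} J := by simp [hJ]
  have hJc : k - 1 ≤ J.card := by
    rw [hJ, Finset.card_erase_of_mem hz, Finset.card_erase_of_mem (Finset.mem_univ _),
      Finset.card_univ]
    omega
  have htJ : blk t ∈ J := by simp [hJ, ht, Ne.symm hzT.1]
  have hCJ : ∀ p ∈ C, Crossing blk {i} J p := by
    intro p hp
    have hzp := hzT.2 p hp
    rcases hC p hp with ⟨h1, h2⟩ | ⟨h1, h2⟩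
    · rw [if_pos (by simpa using h1)] at hzp
      exact .inl ⟨h1, by simp only [hJ, Finset.mem_erase]; exact ⟨hzp, by simpa using h2⟩⟩
    · rw [if_neg (Finset.mem_erase.1 h1).1] at hzp
      exact .inr ⟨by simp only [hJ, Finset.mem_erase]; exact ⟨hzp, by simpa using h1⟩, h2⟩
  -- Cutting in a block other than that of `t` keeps `(s, t)` from being counted a second time,
  -- which the budget might not allow.
  obtain ⟨j, hj, hjt⟩ : ∃ j ∈ J, C = 0 ∨ j ≠ blk t := by
    rcases Multiset.empty_or_exists_mem C with h | ⟨c, hc⟩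
    · exact ⟨_, htJ, .inl h⟩
    · have := Multiset.card_pos_iff_exists_mem.2 ⟨c, hc⟩
      obtain ⟨j, hj, hjt⟩ := Finset.exists_mem_ne (s := J) (by omega) (blk t)
      exact ⟨j, hj, .inr hjt⟩
  have hji : j ≠ i := fun e => by simp [hJ, e] at hj
  obtain ⟨EX, EY, h1, h2, h3, h4, h5, h6⟩ := W.exists_cross hiJ (Finset.mem_singleton_self i) hj C
    ((s, t) ::ₘ DX) hCJ (hG.mono (le_of_eq (by simp only [← Multiset.singleton_add]; abel))) (by
      refine hjt.imp_right fun hjt => ?_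
      rw [touching_cons_of_ne (i := j) (by simpa [hs] using hji.symm) (Ne.symm hjt),
        touching_eq_zero hX (by simpa using hji)]
      have := touching_cons_le (blk := blk) (s, t) DX i
      have := touching_le (blk := blk) DX i
      omega)
  have hXg : Good col b (DX + EX) := h5.mono (by
    rw [show EX + EY + ((s, t) ::ₘ DX) = (DX + EX) + ((s, t) ::ₘ EY) by
      simp only [← Multiset.singleton_add]; abel]
    exact Multiset.le_add_right _ _)
  -- Every pair except `(s, t)` has a part in block `i`, which makes exactly `k - 1` paths. One of
  -- them passes through `s`.
  have hPX := W.cov i (k - 1) (by omega) (by omega) b (DX + EX) hXg (hX.add h3)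
    (by simp [h1]; omega)
  have hs5 : s ∉ (DX + EX).map Prod.fst := by
    have := (h5.mono (D := (s, t) ::ₘ (DX + EX)) (by
      rw [show EX + EY + ((s, t) ::ₘ DX) = ((s, t) ::ₘ (DX + EX)) + EY by
        simp only [← Multiset.singleton_add]; abel]
      exact Multiset.le_add_right _ _)).fst_nodup
    rw [Multiset.map_cons, Multiset.nodup_cons] at this
    exact this.1
  obtain ⟨e, f, E, hE, hP⟩ := hPX.exists_cut (v := s) (by simpa using hs)
  rw [hE] at hs5
  obtain ⟨hec, hfc⟩ := hXg.col (e, f) (by rw [hE]; simp)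
  simp only at hec hfc
  rcases hP with rfl | ⟨u, hus, hP⟩
  · simp at hs5
  have huc : col u = !b := by rw [hcol _ _ hus.symm, hsc]
  have hub : blk u = i := by simpa using hP.right_mem
  -- The edge `s u` is taken out of the path and will be continued from `u` to `t` through `J`. The
  -- gap between `u₂` and `v` has ends of different colours and is closed through the spare block
  -- `z`.
  obtain ⟨u₂, hu, hP⟩ := hP.cut_last (hne hec huc)
  have hP : PathCover G (group blk {i}) ((s, f) ::ₘ (u, u) ::ₘ (e, u₂) ::ₘ E) :=
    hP.congr (by simp only [← Multiset.singleton_add]; abel)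
  obtain ⟨v, hsv, hP⟩ := hP.cut_first (hne hsc hfc)
  have hP : PathCover G (group blk {i}) ((s, u) ::ₘ (e, u₂) ::ₘ (v, f) ::ₘ E) := by
    refine PathCover.join (b := s) (c := u) (hP.congr ?_) hus.symm
    simp only [← Multiset.singleton_add]; abel
  obtain ⟨u', hu'J, huu', hu'c, hu'F⟩ := W.exists_landing (v := u) (J := J)
    (F := (EY.map Prod.fst).toFinset)
    (by rw [hub]; simp [hJ])
    ((Multiset.toFinset_card_le _).trans_lt (by rw [Multiset.card_map]; omega))
  rw [Multiset.mem_toFinset] at hu'F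
  have hYg : Good col b ((s, t) ::ₘ EY) := h5.mono (by
    rw [show EX + EY + ((s, t) ::ₘ DX) = ((s, t) ::ₘ EY) + (DX + EX) by
      simp only [← Multiset.singleton_add]; abel]
    exact Multiset.le_add_right _ _)
  -- There are fewer than `k` pairs here, because some pair lies inside block `i`.
  have hPY := W.coverable_group (J := J) ⟨j, hj⟩ (l := C.card + 1) (by omega) (by omega) b
    ((u', t) ::ₘ EY) (by
      refine .of_nodup ?_ (by simpa using hYg.snd_nodup) ?_
      · have := hYg.fst_nodup
        rw [Multiset.map_cons, Multiset.nodup_cons] at this ⊢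
        exact ⟨hu'F, this.2⟩
      · intro p hp
        rcases Multiset.mem_cons.1 hp with rfl | hp
        · exact ⟨by rw [hu'c, huc, Bool.not_not], htc⟩
        · exact hYg.col p (Multiset.mem_cons_of_mem hp))
    (.cons (by simpa using hu'J) (by simpa using htJ) h4) (by simp [h2])
  have hU := hP.union hPY (group_disjoint hiJ)
  rw [← group_union] at hU
  have hU : PathCover G (group blk ({i} ∪ J)) ((s, t) ::ₘ (e, u₂) ::ₘ (v, f) ::ₘ (E + EY)) := by
    refine PathCover.join (b := u) (c := u') (hU.congr ?_) huu'
    simp only [← Multiset.singleton_add]; abel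
  have hdz : Disjoint {z} ({i} ∪ J) := by simp [hJ, hzi]
  have hU := W.bridge (J := {z}) (by simp) (group_disjoint hdz) (w := u₂) (v := v) (a := e)
    (c := f) (D := (s, t) ::ₘ (E + EY))
    (by rw [hcol _ _ hsv, hcol _ _ hu.symm, hsc, huc, Bool.not_not])
    (hU.congr (by simp only [← Multiset.singleton_add]; abel))
  have hall : {z} ∪ ({i} ∪ J) = (Finset.univ : Finset ι) := by
    ext x
    simp only [hJ, Finset.mem_union, Finset.mem_singleton, Finset.mem_erase, Finset.mem_univ,
      and_true, iff_true]
    by_cases h : x = z <;> by_cases h' : x = i <;> simp [h, h']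
  rw [← group_union, hall, group_univ] at hU
  refine (h6 _ ((s, t) ::ₘ DX) (hU.congr ?_)).congr ?_
  · rw [show (e, f) ::ₘ (s, t) ::ₘ (E + EY) = ((e, f) ::ₘ E) + ((s, t) ::ₘ EY) by
      simp only [← Multiset.singleton_add]; abel, ← hE]
    simp only [← Multiset.singleton_add]; abel
  · simp only [← Multiset.singleton_add]; abel

end Weld

end

/-! ### Continuing free ends into other blocks and linking them there. -/

section

namespace PathCover

variable {V : Type*} [DecidableEq V] {G : SimpleGraph V} {X Y : Finset V} {D E : Multiset (V × V)}

theorem swap_left (h : PathCover G X (D + E)) : PathCover G X (D.map Prod.swap + E) := by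
  obtain ⟨Y, Z, rfl, hd, h1, h2⟩ := h.split
  exact h1.reverse_all.union h2 hd

theorem fst_nodup (h : PathCover G X D) : (D.map Prod.fst).Nodup := by
  induction D using Multiset.induction_on generalizing X with
  | empty => simp
  | cons p D ih =>
    obtain ⟨a, b⟩ := p
    obtain ⟨q, Y, -, -, -, hY⟩ := h.uncons
    rw [Multiset.map_cons, Multiset.nodup_cons]
    refine ⟨fun hm => ?_, ih hY⟩
    obtain ⟨q, hq, e⟩ := Multiset.mem_map.1 hm
    exact (h.disjoint_ends q hq).1 e.symm

theorem snd_nodup (h : PathCover G X D) : (D.map Prod.snd).Nodup := by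
  simpa [Multiset.map_map] using h.reverse_all.fst_nodup

theorem join_all {f f' g g' : V × V → V} (C : Multiset (V × V))
    (hf : ∀ p ∈ C, G.Adj (f p) (f' p)) (hg : ∀ p ∈ C, G.Adj (g' p) (g p))
    (h : PathCover G X (C.map (fun p => (p.1, f p)) + C.map (fun p => (f' p, g' p)) +
      C.map (fun p => (g p, p.2)) + E)) : PathCover G X (C + E) := by
  induction C using Multiset.induction_on generalizing E with
  | empty => simpa using h
  | cons p C ih =>
    have hp := Multiset.mem_cons_self p C
    have h1 : PathCover G X ((p.1, f p) ::ₘ (f' p, g' p) ::ₘ (g p, p.2) ::ₘ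
        (C.map (fun p => (p.1, f p)) + C.map (fun p => (f' p, g' p)) +
        C.map (fun p => (g p, p.2)) + E)) := by
      refine h.congr ?_
      simp only [Multiset.map_cons]
      simp only [← Multiset.singleton_add]; abel
    have h2 := (h1.join (hf p hp)).join (hg p hp)
    have h3 := ih (fun q hq => hf q (Multiset.mem_cons_of_mem hq))
      (fun q hq => hg q (Multiset.mem_cons_of_mem hq)) (E := p ::ₘ E) (h2.congr (by
        simp only [← Multiset.singleton_add]; abel))
    exact h3.congr (by simp only [← Multiset.singleton_add]; abel)

end PathCover

/-- Distinct first entries turn the free cover into a function of the prescribed end. This matches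
the free ends found in two different blocks pair by pair. -/
theorem exists_fun_fst {V : Type*} {C E : Multiset (V × V)}
    (h : E.map Prod.fst = C.map Prod.fst) (hC : (C.map Prod.fst).Nodup) :
    ∃ f : V → V, E = C.map fun p => (p.1, f p.1) := by
  have hinj := Multiset.inj_on_of_nodup_map (h ▸ hC : (E.map Prod.fst).Nodup)
  have hex : ∀ a : V, ∃ x, ∀ y, (a, y) ∈ E → y = x := by
    intro a
    by_cases ha : ∃ x, (a, x) ∈ E
    · obtain ⟨x, hx⟩ := ha
      exact ⟨x, fun y hy => congrArg Prod.snd (hinj _ hy _ hx rfl)⟩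
    · exact ⟨a, fun y hy => absurd ⟨y, hy⟩ ha⟩
  choose f hf using hex
  refine ⟨f, ?_⟩
  have h1 : C.map (fun p => (p.1, f p.1)) = (C.map Prod.fst).map fun a => (a, f a) := by
    simp [Multiset.map_map]
  rw [h1, ← h, Multiset.map_map]
  conv_lhs => rw [← Multiset.map_id E]
  refine Multiset.map_congr rfl fun p hp => ?_
  obtain ⟨a, x⟩ := p
  simp [← hf a x hp]

theorem exists_fun_snd {V : Type*} {C E : Multiset (V × V)}
    (h : E.map Prod.snd = C.map Prod.snd) (hC : (C.map Prod.snd).Nodup) :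
    ∃ f : V → V, E = C.map fun p => (f p.2, p.2) := by
  obtain ⟨f, hf⟩ := exists_fun_fst (E := E.map Prod.swap) (C := C.map Prod.swap)
    (by simpa [Multiset.map_map] using h) (by simpa [Multiset.map_map] using hC)
  refine ⟨f, ?_⟩
  have := congrArg (Multiset.map Prod.swap) hf
  simpa [Multiset.map_map, Function.comp_def] using this

variable {V ι : Type*} [Fintype V] [DecidableEq V] [DecidableEq ι] {G : SimpleGraph V}
  {col : V → Bool} {b : Bool} {blk : V → ι} {m k : ℕ} {C C₁ C₂ D E : Multiset (V × V)}

theorem FreeCover.exists_of_map {X : Finset V} (h : FreeCover G col b X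
      (C₁.map Prod.fst).toFinset (C₂.map Prod.snd).toFinset)
    (h₁ : (C₁.map Prod.fst).Nodup) (h₂ : (C₂.map Prod.snd).Nodup) :
    ∃ EA EB : Multiset (V × V), PathCover G X (EA + EB) ∧ EA.map Prod.fst = C₁.map Prod.fst ∧
      EB.map Prod.snd = C₂.map Prod.snd ∧ (∀ p ∈ EA, p.2 ∈ X ∧ col p.2 = !b) ∧
      (∀ p ∈ EB, p.1 ∈ X ∧ col p.1 = b) := by
  obtain ⟨EA, EB, hP, h1, h2, h3, h4⟩ := h
  rw [Multiset.toFinset_val, Multiset.dedup_eq_self.2 h₁] at h1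
  rw [Multiset.toFinset_val, Multiset.dedup_eq_self.2 h₂] at h2
  exact ⟨EA, EB, hP, h1, h2,
    fun p hp => ⟨(hP.mem_of_mem p (Multiset.mem_add.2 (.inl hp))).2, h3 p hp⟩,
    fun p hp => ⟨(hP.mem_of_mem p (Multiset.mem_add.2 (.inr hp))).1, h4 p hp⟩⟩

namespace Weld

/-- Free ends in block `i` can be continued to distinct vertices of the blocks in `J`. -/
theorem exists_landings (W : Weld G col blk m k) {i : ι} {J : Finset ι} (hi : i ∉ J)
    (C EA : Multiset (V × V)) (h : EA.map Prod.fst = C.map Prod.fst)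
    (hEA : ∀ p ∈ EA, blk p.2 = i ∧ col p.2 = !b) (F : Finset V) (hF : F.card + C.card ≤ J.card) :
    ∃ EY : Multiset (V × V), EY.map Prod.snd = C.map Prod.snd ∧ (EY.map Prod.fst).Nodup ∧
      (∀ p ∈ EY, p.1 ∉ F ∧ blk p.1 ∈ J ∧ col p.1 = b) ∧
      ∀ Y E, PathCover G Y (EA + EY + E) → PathCover G Y (C + E) := by
  induction C using Multiset.induction_on generalizing EA with
  | empty =>
    obtain rfl : EA = 0 := by simpa using h
    exact ⟨0, by simp, by simp, by simp, fun Y E h => by simpa using h⟩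
  | cons p C ih =>
    rw [Multiset.map_cons] at h
    obtain ⟨⟨s, x⟩, hx, rfl, h⟩ := (Multiset.map_eq_cons _ _ _ _).2 h
    obtain ⟨EA, rfl⟩ := Multiset.exists_cons_of_mem hx
    rw [Multiset.erase_cons_head] at h
    rw [Multiset.card_cons] at hF
    obtain ⟨EY, h1, h2, h3, h4⟩ := ih EA h (fun q hq => hEA q (Multiset.mem_cons_of_mem hq))
      (by omega)
    have hEYc : EY.card = C.card := by
      rw [← Multiset.card_map Prod.snd, h1, Multiset.card_map]
    obtain ⟨hxi, hxc⟩ := hEA _ (Multiset.mem_cons_self _ _)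
    simp only at hxi hxc
    obtain ⟨w, hwJ, hxw, hwc, hwF⟩ := W.exists_landing (v := x) (J := J) (by rwa [hxi])
      -- Besides `F`, the landing vertices already chosen have to be avoided, whence the bound by
      -- `F.card + C.card`.
      (F := F ∪ (EY.map Prod.fst).toFinset) (by
        refine (Finset.card_union_le _ _).trans_lt ?_
        have := Multiset.toFinset_card_le (EY.map Prod.fst)
        rw [Multiset.card_map] at this
        omega)
    rw [Finset.mem_union, not_or, Multiset.mem_toFinset] at hwF
    refine ⟨(w, p.2) ::ₘ EY, by simp [h1], by simpa using ⟨by simpa using hwF.2, h2⟩, ?_, ?_⟩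
    · intro q hq
      rcases Multiset.mem_cons.1 hq with rfl | hq
      exacts [⟨hwF.1, hwJ, by rw [hwc, hxc, Bool.not_not]⟩, h3 q hq]
    · intro Y E hY
      have h5 : PathCover G Y ((p.1, p.2) ::ₘ (EA + EY + E)) := by
        refine PathCover.join (b := x) (c := w) (hY.congr ?_) hxw
        simp only [← Multiset.singleton_add]; abel
      refine (h4 Y (p ::ₘ E) (h5.congr ?_)).congr ?_
      · simp only [Prod.mk.eta, ← Multiset.singleton_add]; abel
      · simp only [← Multiset.singleton_add]; abel

/-- Matching free ends in blocks `i` and `q` can be joined through the blocks `J`. -/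
theorem link (W : Weld G col blk m k) {i q : ι} {J : Finset ι} (hJ : J.Nonempty) {Y : Finset V}
    (hJY : Disjoint (group blk J) Y) (hi : i ∉ J) (hq : q ∉ J) {f g : V × V → V}
    (hf : ∀ p ∈ C, blk (f p) = i ∧ col (f p) = !b) (hg : ∀ p ∈ C, blk (g p) = q ∧ col (g p) = b)
    (hfn : (C.map f).Nodup) (hgn : (C.map g).Nodup) (hC : 1 ≤ C.card) (hCk : C.card < k)
    (h : PathCover G Y (C.map (fun p => (p.1, f p)) + C.map (fun p => (g p, p.2)) + E)) :
    PathCover G (group blk J ∪ Y) (C + E) := by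
  obtain ⟨z, hz⟩ := hJ
  -- The matching into block `z` is made a total function. Its value on `z` itself is arbitrary and
  -- is not used.
  have hn : ∀ v, ∃ w, blk v ≠ z → blk w = z ∧ G.Adj v w := by
    intro v
    by_cases hv : blk v = z
    · exact ⟨v, fun h => absurd hv h⟩
    · obtain ⟨w, hw⟩ := W.exists_nb v z hv
      exact ⟨w, fun _ => hw⟩
  choose n hn using hn
  have hnf : ∀ p ∈ C, blk (n (f p)) = z ∧ G.Adj (f p) (n (f p)) := fun p hp =>
    hn _ (by rw [(hf p hp).1]; rintro rfl; exact hi hz)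
  have hng : ∀ p ∈ C, blk (n (g p)) = z ∧ G.Adj (g p) (n (g p)) := fun p hp =>
    hn _ (by rw [(hg p hp).1]; rintro rfl; exact hq hz)
  have hnod : ∀ {h : V × V → V} {x : ι}, x ∉ J → (∀ p ∈ C, blk (h p) = x) →
      (∀ p ∈ C, blk (n (h p)) = z ∧ G.Adj (h p) (n (h p))) → (C.map h).Nodup →
      (C.map fun p => n (h p)).Nodup := by
    intro h x hx hhx hnh hnod
    have : C.map (fun p => n (h p)) = (C.map h).map n := by simp [Multiset.map_map]
    rw [this]
    refine hnod.map_on ?_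
    intro u hu v hv huv
    obtain ⟨p, hp, rfl⟩ := Multiset.mem_map.1 hu
    obtain ⟨r, hr, rfl⟩ := Multiset.mem_map.1 hv
    refine W.nb_unique (n (h p)) _ _ (hnh p hp).2.symm (huv ▸ (hnh r hr).2.symm) ?_ ?_
    · rw [hhx p hp, hhx r hr]
    · rw [(hnh p hp).1, hhx p hp]; rintro rfl; exact hx hz
  have hPJ := W.coverable_group ⟨z, hz⟩ hC hCk b (C.map fun p => (n (f p), n (g p))) (by
    refine .of_nodup ?_ ?_ ?_
    · simpa [Multiset.map_map, Function.comp_def] using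
        hnod hi (fun p hp => (hf p hp).1) hnf hfn
    · simpa [Multiset.map_map, Function.comp_def] using
        hnod hq (fun p hp => (hg p hp).1) hng hgn
    · intro p hp
      obtain ⟨r, hr, rfl⟩ := Multiset.mem_map.1 hp
      simp only
      rw [W.hcol _ _ (hnf r hr).2, W.hcol _ _ (hng r hr).2, (hf r hr).2, (hg r hr).2]
      simp) (by
    intro p hp
    obtain ⟨r, hr, rfl⟩ := Multiset.mem_map.1 hp
    simp only [mem_group, (hnf r hr).1, (hng r hr).1]
    exact ⟨hz, hz⟩) (by simp)
  refine PathCover.join_all C (fun p hp => (hnf p hp).2) (fun p hp => (hng p hp).2.symm)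
    ((hPJ.union h hJY).congr ?_)
  abel

/-- A demand confined to two blocks `i` and `q` can be met if `k = 2`. -/
theorem cover_of_two_blocks [Fintype ι] (W : Weld G col blk m k) (hι : k + 1 ≤ Fintype.card ι)
    (hk : k = 2) {i q : ι} (hG : Good col b D) (hDk : D.card = k)
    (hD : ∀ p ∈ D, blk p.1 ∈ ({i, q} : Finset ι) ∧ blk p.2 ∈ ({i, q} : Finset ι)) :
    PathCover G Finset.univ D := by
  obtain ⟨⟨s, t⟩, hp⟩ := Multiset.card_pos_iff_exists_mem.1 (by omega : 0 < D.card)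
  obtain ⟨D, rfl⟩ := Multiset.exists_cons_of_mem hp
  rw [Multiset.card_cons] at hDk
  -- One of the two pairs is covered within the two blocks. Adding the other one by `cover_of_inner`
  -- then requires only one further block.
  have hP := W.coverable_group (J := {i, q}) (by simp) (l := D.card) (by omega) (by omega) b D
    (hG.mono (Multiset.le_cons_self _ _))
    (fun p hp => by simpa using hD p (Multiset.mem_cons_of_mem hp)) rfl
  have h := W.cover_of_inner (I := {i, q}) (J := Finset.univ \ {i, q}) (by
      rw [Finset.disjoint_right]; intro x hx; exact (Finset.mem_sdiff.1 hx).2)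
    (by
      rw [← Finset.card_pos]
      have := Finset.le_card_sdiff ({i, q} : Finset ι) Finset.univ
      have := Finset.card_le_two (a := i) (b := q)
      rw [Finset.card_univ] at *
      omega) hG (hD _ hp).1 (hD _ hp).2 (fun h => by omega) hP
  rwa [Finset.sdiff_union_of_subset (Finset.subset_univ _), group_univ] at h

/-- Block `i` is covered by `k` half-paths. Two of them have been continued by hand, so that their
remaining demands `pH` and `qH` lie inside and outside of `J`. However the others land,
`cover_of_split` applies to the blocks other than `i`. Landing avoids at most `k` vertices in total,
and there are at least `k` such blocks. -/
theorem cover_of_landed [Fintype ι] (W : Weld G col blk m k) (hι : k + 1 ≤ Fintype.card ι) {i : ι}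
    {p q ep eq pH qH : V × V} {EA EB : Multiset (V × V)} {J : Finset ι} (hJ : i ∉ J)
    (hk : C₁.card + C₂.card + 2 = k)
    (hX : PathCover G (group blk {i}) (ep ::ₘ eq ::ₘ (EA + EB)))
    (hp : ∀ Y E, PathCover G Y (ep ::ₘ pH ::ₘ E) → PathCover G Y (p ::ₘ E))
    (hq : ∀ Y E, PathCover G Y (eq ::ₘ qH ::ₘ E) → PathCover G Y (q ::ₘ E))
    (hEA : EA.map Prod.fst = C₁.map Prod.fst) (hEB : EB.map Prod.snd = C₂.map Prod.snd)
    (hEAc : ∀ p ∈ EA, blk p.2 = i ∧ col p.2 = !b) (hEBc : ∀ p ∈ EB, blk p.1 = i ∧ col p.1 = b)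
    (hn₁ : (pH.1 ::ₘ qH.1 ::ₘ C₂.map Prod.fst).Nodup)
    (hn₂ : (pH.2 ::ₘ qH.2 ::ₘ C₁.map Prod.snd).Nodup)
    (hpH : col pH.1 = b ∧ col pH.2 = !b) (hqH : col qH.1 = b ∧ col qH.2 = !b)
    (hpJ : blk pH.1 ∈ J ∧ blk pH.2 ∈ J)
    (hqJ : blk qH.1 ∉ J ∧ blk qH.2 ∉ J) (hqi : blk qH.1 ≠ i ∧ blk qH.2 ≠ i)
    (hC₁ : ∀ p ∈ C₁, blk p.2 ≠ i ∧ col p.2 = !b) (hC₂ : ∀ p ∈ C₂, blk p.1 ≠ i ∧ col p.1 = b) :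
    PathCover G Finset.univ (p ::ₘ q ::ₘ (C₁ + C₂)) := by
  have hcard : (Finset.univ.erase i).card + 1 = Fintype.card ι := by
    rw [Finset.card_erase_add_one (Finset.mem_univ _), Finset.card_univ]
  have hFc : ∀ (x y : V) (s : Multiset V), (insert x (insert y s.toFinset)).card ≤ s.card + 2 := by
    intro x y s
    have h1 := Finset.card_insert_le x (insert y s.toFinset)
    have h2 := Finset.card_insert_le y s.toFinset
    have h3 := Multiset.toFinset_card_le s
    omega
  obtain ⟨Y₁, h1, h2, h3, h4⟩ := W.exists_landings (i := i) (J := Finset.univ.erase i) (by simp)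
    C₁ EA hEA hEAc (insert pH.1 (insert qH.1 (C₂.map Prod.fst).toFinset)) (by
      have := hFc pH.1 qH.1 (C₂.map Prod.fst)
      rw [Multiset.card_map] at this
      omega)
  obtain ⟨Y₂, g1, g2, g3, g4⟩ := W.exists_landings (i := i) (J := Finset.univ.erase i) (b := !b)
    (by simp) (C₂.map Prod.swap) (EB.map Prod.swap) (by simpa [Multiset.map_map] using hEB)
    (by
      intro p hp
      obtain ⟨r, hr, rfl⟩ := Multiset.mem_map.1 hp
      simpa using hEBc r hr)
    (insert pH.2 (insert qH.2 (C₁.map Prod.snd).toFinset)) (by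
      have := hFc pH.2 qH.2 (C₁.map Prod.snd)
      rw [Multiset.card_map] at this ⊢
      omega)
  have h1m : ∀ r ∈ Y₁, ∃ c ∈ C₁, c.2 = r.2 := fun r hr =>
    Multiset.mem_map.1 (h1 ▸ Multiset.mem_map_of_mem Prod.snd hr)
  have g1' : Y₂.map Prod.snd = C₂.map Prod.fst := by simpa [Multiset.map_map] using g1
  have g1m : ∀ r ∈ Y₂, ∃ c ∈ C₂, c.1 = r.2 := fun r hr =>
    Multiset.mem_map.1 (g1' ▸ Multiset.mem_map_of_mem Prod.snd hr)
  have e1 : Y₁.card = C₁.card := by rw [← Multiset.card_map Prod.snd, h1, Multiset.card_map]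
  have e2 : Y₂.card = C₂.card := by rw [← Multiset.card_map Prod.snd, g1', Multiset.card_map]
  have hfst : (pH ::ₘ qH ::ₘ (Y₁ + Y₂.map Prod.swap)).map Prod.fst =
      Y₁.map Prod.fst + (pH.1 ::ₘ qH.1 ::ₘ C₂.map Prod.fst) := by
    simp only [Multiset.map_cons, Multiset.map_add, Multiset.map_map, Function.comp_def,
      Prod.fst_swap, ← g1']
    simp only [← Multiset.singleton_add]; abel
  have hsnd : (pH ::ₘ qH ::ₘ (Y₁ + Y₂.map Prod.swap)).map Prod.snd =
      Y₂.map Prod.fst + (pH.2 ::ₘ qH.2 ::ₘ C₁.map Prod.snd) := by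
    simp only [Multiset.map_cons, Multiset.map_add, Multiset.map_map, Function.comp_def,
      Prod.snd_swap, ← h1]
    simp only [← Multiset.singleton_add]; abel
  have hHg : Good col b (pH ::ₘ qH ::ₘ (Y₁ + Y₂.map Prod.swap)) := by
    refine .of_nodup ?_ ?_ ?_
    · rw [hfst, Multiset.nodup_add]
      refine ⟨h2, hn₁, ?_⟩
      rw [Multiset.disjoint_left]
      intro v hv hv'
      obtain ⟨r, hr, rfl⟩ := Multiset.mem_map.1 hv
      refine (h3 r hr).1 ?_
      simpa using hv'
    · rw [hsnd, Multiset.nodup_add]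
      refine ⟨g2, hn₂, ?_⟩
      rw [Multiset.disjoint_left]
      intro v hv hv'
      obtain ⟨r, hr, rfl⟩ := Multiset.mem_map.1 hv
      refine (g3 r hr).1 ?_
      simpa using hv'
    · intro r hr
      simp only [Multiset.mem_cons, Multiset.mem_add] at hr
      rcases hr with rfl | rfl | hr | hr
      · exact hpH
      · exact hqH
      · obtain ⟨c, hc, hcr⟩ := h1m r hr
        exact ⟨(h3 r hr).2.2, hcr ▸ (hC₁ c hc).2⟩
      · obtain ⟨r, hr', rfl⟩ := Multiset.mem_map.1 hr
        obtain ⟨c, hc, hcr⟩ := g1m r hr'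
        exact ⟨by simpa [← hcr] using (hC₂ c hc).2, (g3 r hr').2.2⟩
  have hJe : J ⊆ Finset.univ.erase i := fun x hx => by
    simp only [Finset.mem_erase, Finset.mem_univ, and_true]; rintro rfl; exact hJ hx
  have hHin : Inside (group blk (Finset.univ.erase i)) (pH ::ₘ qH ::ₘ (Y₁ + Y₂.map Prod.swap)) := by
    refine .cons ?_ ?_ (.cons ?_ ?_ (.add ?_ ?_))
    · exact mem_group.2 (hJe hpJ.1)
    · exact mem_group.2 (hJe hpJ.2)
    · simpa using hqi.1
    · simpa using hqi.2
    · intro r hr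
      obtain ⟨c, hc, hcr⟩ := h1m r hr
      exact ⟨mem_group.2 (h3 r hr).2.1, by simpa [← hcr] using (hC₁ c hc).1⟩
    · intro r hr
      obtain ⟨r, hr', rfl⟩ := Multiset.mem_map.1 hr
      obtain ⟨c, hc, hcr⟩ := g1m r hr'
      exact ⟨by simpa [← hcr] using (hC₂ c hc).1, mem_group.2 (g3 r hr').2.1⟩
  have hHu : J ∪ (Finset.univ.erase i \ J) = Finset.univ.erase i := Finset.union_sdiff_of_subset hJe
  rw [← hHu] at hHin
  have hPH := W.cover_of_split (Finset.disjoint_sdiff) hHg hHin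
    (by simp [e1, e2]; omega) (p := pH) (q := qH) (by simp) (by simp) hpJ.1 hpJ.2
    (by simp [hqi.1, hqJ.1]) (by simp [hqi.2, hqJ.2])
  rw [hHu] at hPH
  have hU := hX.union hPH (group_disjoint (disjoint_erase i))
  rw [← group_union, union_erase, group_univ] at hU
  have hU := hp _ (eq ::ₘ qH ::ₘ (EA + EB + Y₁ + Y₂.map Prod.swap))
    (hU.congr (by simp only [← Multiset.singleton_add]; abel))
  have hU := hq _ (p ::ₘ (EA + EB + Y₁ + Y₂.map Prod.swap))
    (hU.congr (by simp only [← Multiset.singleton_add]; abel))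
  have hU := h4 _ (p ::ₘ q ::ₘ (EB + Y₂.map Prod.swap))
    (hU.congr (by simp only [← Multiset.singleton_add]; abel))
  have hU := PathCover.swap_left (D := EB + Y₂.map Prod.swap) (E := p ::ₘ q ::ₘ C₁)
    (hU.congr (by simp only [← Multiset.singleton_add]; abel))
  rw [Multiset.map_add, map_swap_swap] at hU
  have hU := (g4 _ _ hU).swap_left
  rw [map_swap_swap] at hU
  exact hU.congr (by simp only [← Multiset.singleton_add]; abel)

end Weld

end

/-! ### Pairs between two blocks, and stars whose pairs all start in the centre. -/

section

theorem exists_cons_of_map_fst {V : Type*} {S : Multiset V} {D : Multiset (V × V)} {a : V}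
    (h : D.map Prod.fst = a ::ₘ S) : ∃ x D', D = (a, x) ::ₘ D' ∧ D'.map Prod.fst = S := by
  classical
  obtain ⟨⟨a, x⟩, hx, rfl, h'⟩ := (Multiset.map_eq_cons _ _ _ _).2 h
  obtain ⟨D, rfl⟩ := Multiset.exists_cons_of_mem hx
  rw [Multiset.erase_cons_head] at h'
  exact ⟨x, D, rfl, h'⟩

theorem exists_cons_of_map_snd {V : Type*} {S : Multiset V} {D : Multiset (V × V)} {a : V}
    (h : D.map Prod.snd = a ::ₘ S) : ∃ x D', D = (x, a) ::ₘ D' ∧ D'.map Prod.snd = S := by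
  classical
  obtain ⟨⟨x, a⟩, hx, rfl, h'⟩ := (Multiset.map_eq_cons _ _ _ _).2 h
  obtain ⟨D, rfl⟩ := Multiset.exists_cons_of_mem hx
  rw [Multiset.erase_cons_head] at h'
  exact ⟨x, D, rfl, h'⟩

variable {V ι : Type*} [Fintype V] [DecidableEq V] [DecidableEq ι] {G : SimpleGraph V}
  {col : V → Bool} {b : Bool} {blk : V → ι} {m k : ℕ} {C C₁ C₂ D E : Multiset (V × V)}

namespace Weld

/-- A group of blocks links only fewer than `k` pairs, so the demand is divided into two nonempty
classes. One class is linked through a single block, the other one through all the rest. For `k ≥ 3`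
at least two blocks besides `i` and `q` exist. -/
theorem cover_of_links [Fintype ι] (W : Weld G col blk m k) (hι : k + 1 ≤ Fintype.card ι)
    (hk : 3 ≤ k) {i q i₁ q₁ i₂ q₂ : ι} {f₁ g₁ f₂ g₂ : V × V → V}
    (hi₁ : i₁ ∈ ({i, q} : Finset ι)) (hq₁ : q₁ ∈ ({i, q} : Finset ι))
    (hi₂ : i₂ ∈ ({i, q} : Finset ι)) (hq₂ : q₂ ∈ ({i, q} : Finset ι))
    (hC₁ : C₁ ≠ 0) (hC₂ : C₂ ≠ 0) (hC : C₁.card + C₂.card = k)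
    (hf₁ : ∀ p ∈ C₁, blk (f₁ p) = i₁ ∧ col (f₁ p) = !b)
    (hg₁ : ∀ p ∈ C₁, blk (g₁ p) = q₁ ∧ col (g₁ p) = b)
    (hf₂ : ∀ p ∈ C₂, blk (f₂ p) = i₂ ∧ col (f₂ p) = !b)
    (hg₂ : ∀ p ∈ C₂, blk (g₂ p) = q₂ ∧ col (g₂ p) = b)
    (h : PathCover G (group blk {i, q}) (C₁.map (fun p => (p.1, f₁ p)) +
      C₁.map (fun p => (g₁ p, p.2)) + (C₂.map (fun p => (p.1, f₂ p)) +
      C₂.map (fun p => (g₂ p, p.2))))) : PathCover G Finset.univ (C₁ + C₂) := by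
  have hn1 := h.fst_nodup
  have hn2 := h.snd_nodup
  simp only [Multiset.map_add, Multiset.map_map, Function.comp_def] at hn1 hn2
  rw [← Multiset.card_pos] at hC₁ hC₂
  obtain ⟨z, hz, y, hy, hzy⟩ : ∃ z ∈ Finset.univ \ {i, q}, ∃ y ∈ Finset.univ \ {i, q}, z ≠ y := by
    refine Finset.one_lt_card.1 ?_
    have := Finset.le_card_sdiff ({i, q} : Finset ι) Finset.univ
    have := Finset.card_le_two (a := i) (b := q)
    rw [Finset.card_univ] at *
    omega
  have hz' := (Finset.mem_sdiff.1 hz).2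
  have hne : ∀ {x : ι}, x ∈ ({i, q} : Finset ι) → x ∉ (Finset.univ \ {i, q}).erase z := fun hx h =>
    (Finset.mem_sdiff.1 (Finset.mem_of_mem_erase h)).2 hx
  have n1 := Multiset.nodup_add.1 hn1
  have n2 := Multiset.nodup_add.1 hn2
  have h1 := W.link (J := {z}) (by simp) (group_disjoint (by simpa using hz'))
    (by rw [Finset.mem_singleton]; rintro rfl; exact hz' hi₁)
    (by rw [Finset.mem_singleton]; rintro rfl; exact hz' hq₁) hf₁ hg₁
    (Multiset.nodup_add.1 n2.1).1 (Multiset.nodup_add.1 n1.1).2.1 hC₁ (by omega) h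
  rw [← group_union] at h1
  have h2 := W.link (J := (Finset.univ \ {i, q}).erase z) (C := C₂) (E := C₁)
    ⟨y, Finset.mem_erase.2 ⟨hzy.symm, hy⟩⟩ (group_disjoint (by
      rw [Finset.disjoint_union_right]
      exact ⟨by simp, Finset.disjoint_left.2 fun x hx hx' => hne hx' hx⟩))
    (hne hi₂) (hne hq₂) hf₂ hg₂
    (Multiset.nodup_add.1 n2.2.1).1 (Multiset.nodup_add.1 n1.2.1).2.1 hC₂ (by omega)
    (h1.congr (add_comm _ _))
  rw [← group_union, show (Finset.univ \ {i, q}).erase z ∪ ({z} ∪ {i, q}) = Finset.univ by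
    rw [← Finset.union_assoc, Finset.union_comm _ {z}, ← Finset.insert_eq, Finset.insert_erase hz,
      Finset.sdiff_union_of_subset (Finset.subset_univ _)], group_univ] at h2
  exact h2.congr (add_comm _ _)

/-- All pairs run between blocks `i` and `q`. -/
theorem cover_of_parallel [Fintype ι] (W : Weld G col blk m k) (hι : k + 1 ≤ Fintype.card ι)
    (hk : 3 ≤ k) {i q : ι} (hiq : i ≠ q) (hC₁ : C₁ ≠ 0) (hC : C₁.card + C₂.card = k)
    (hG : Good col b (C₁ + C₂)) (h₁ : ∀ p ∈ C₁, blk p.1 = i ∧ blk p.2 = q)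
    (h₂ : ∀ p ∈ C₂, blk p.1 = q ∧ blk p.2 = i) : PathCover G Finset.univ (C₁ + C₂) := by
  have hG₁ := hG.mono (Multiset.le_add_right C₁ C₂)
  have hG₂ := hG.mono (Multiset.le_add_left C₂ C₁)
  have key : ∀ {j l : ι} {D E : Multiset (V × V)}, Good col b D → Good col b E →
      (∀ p ∈ D, blk p.1 = j ∧ blk p.2 = l) → (∀ p ∈ E, blk p.1 = l ∧ blk p.2 = j) →
      D.card + E.card = k → ∃ f g : V → V, (∀ p ∈ D, blk (f p.1) = j ∧ col (f p.1) = !b) ∧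
        (∀ p ∈ E, blk (g p.2) = j ∧ col (g p.2) = b) ∧ PathCover G (group blk {j})
          (D.map (fun p => (p.1, f p.1)) + E.map (fun p => (g p.2, p.2))) := by
    intro j l D E hD hE hDj hEj hc
    obtain ⟨EA, EB, hP, e1, e2, e3, e4⟩ := (freeCover W.hcol (b := b) (X := group blk {j})
      (A := (D.map Prod.fst).toFinset) (B := (E.map Prod.snd).toFinset) (W.size j) W.two_le
      (W.le_room hk) (W.cov j) (by
        intro v hv
        obtain ⟨p, hp, rfl⟩ := Multiset.mem_map.1 (Multiset.mem_toFinset.1 hv)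
        simpa using ⟨(hDj p hp).1, (hD.col p hp).1⟩) (by
        intro v hv
        obtain ⟨p, hp, rfl⟩ := Multiset.mem_map.1 (Multiset.mem_toFinset.1 hv)
        simpa using ⟨(hEj p hp).2, (hE.col p hp).2⟩) (by
        rw [Multiset.toFinset_card_of_nodup hD.fst_nodup,
          Multiset.toFinset_card_of_nodup hE.snd_nodup]
        simpa using hc)).exists_of_map hD.fst_nodup hE.snd_nodup
    obtain ⟨f, rfl⟩ := exists_fun_fst e1 hD.fst_nodup
    obtain ⟨g, rfl⟩ := exists_fun_snd e2 hE.snd_nodup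
    exact ⟨f, g, fun p hp => by simpa using e3 _ (Multiset.mem_map_of_mem _ hp),
      fun p hp => by simpa using e4 _ (Multiset.mem_map_of_mem _ hp), hP⟩
  -- Both blocks are covered freely by `k` half-paths. A pair of `C₁` has its source half in `i` and
  -- its sink half in `q`, a pair of `C₂` the other way round.
  obtain ⟨f₁, g₂, hf₁, hg₂, hi⟩ := key hG₁ hG₂ h₁ h₂ hC
  obtain ⟨f₂, g₁, hf₂, hg₁, hq⟩ := key hG₂ hG₁ h₂ h₁ (by omega)
  have hU := hi.union hq (group_disjoint (by simpa using hiq))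
  rw [← group_union, ← Finset.insert_eq] at hU
  -- If only one orientation occurs, a single pair is split off to serve as the second class.
  by_cases hC₂ : C₂ = 0
  · subst hC₂
    obtain ⟨p, hp⟩ := Multiset.exists_mem_of_ne_zero hC₁
    obtain ⟨C, rfl⟩ := Multiset.exists_cons_of_mem hp
    rw [Multiset.card_cons, Multiset.card_zero] at hC
    rw [add_zero, ← Multiset.singleton_add]
    refine W.cover_of_links hι hk (i := i) (q := q) (i₁ := i) (i₂ := i) (q₁ := q) (q₂ := q)
      (b := b) (f₁ := fun p => f₁ p.1) (g₁ := fun p => g₁ p.2)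
      (f₂ := fun p => f₁ p.1) (g₂ := fun p => g₁ p.2)
      (by simp) (by simp) (by simp) (by simp) (by simp) (by rintro rfl; simp at hC; omega)
      (by simp; omega)
      (fun r hr => hf₁ r (by simp [Multiset.mem_singleton.1 hr]))
      (fun r hr => hg₁ r (by simp [Multiset.mem_singleton.1 hr]))
      (fun r hr => hf₁ r (Multiset.mem_cons_of_mem hr))
      (fun r hr => hg₁ r (Multiset.mem_cons_of_mem hr)) (hU.congr ?_)
    simp only [Multiset.map_cons, Multiset.map_zero, Multiset.map_singleton]
    simp only [← Multiset.singleton_add]; abel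
  · refine W.cover_of_links hι hk (i := i) (q := q) (i₁ := i) (i₂ := q) (q₁ := q) (q₂ := i)
      (b := b) (f₁ := fun p => f₁ p.1) (g₁ := fun p => g₁ p.2)
      (f₂ := fun p => f₂ p.1) (g₂ := fun p => g₂ p.2)
      (by simp) (by simp) (by simp) (by simp) hC₁ hC₂ hC hf₁ hg₁ hf₂ hg₂ (hU.congr ?_)
    abel

/-- All pairs start in block `i` and end outside. -/
theorem cover_of_star_sources [Fintype ι] (W : Weld G col blk m k) (hι : k + 1 ≤ Fintype.card ι)
    {i : ι} (hG : Good col b D) (hDk : D.card = k) (hD : ∀ p ∈ D, blk p.1 = i ∧ blk p.2 ≠ i) :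
    PathCover G Finset.univ D := by
  have hk := W.two_le
  by_cases hpq : ∃ p ∈ D, ∃ q ∈ D, blk p.2 ≠ blk q.2
  · obtain ⟨p, hp, q, hq, hpq⟩ := hpq
    obtain ⟨C, rfl⟩ := Multiset.exists_cons_of_mem hp
    have hq : q ∈ C := (Multiset.mem_cons.1 hq).resolve_left (by rintro rfl; exact hpq rfl)
    obtain ⟨C, rfl⟩ := Multiset.exists_cons_of_mem hq
    -- The centre contains only sources, so the simple form of the free cover suffices, and `k ≤ m`
    -- is not required.
    obtain ⟨EA, EB, hP, e1, e2, e3, -⟩ := FreeCover.exists_of_map (C₂ := 0)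
      (freeCover_of_sources W.hcol (b := b) (X := group blk {i}) (j := k - 1)
      (A := ((p ::ₘ q ::ₘ C).map Prod.fst).toFinset) (by
        intro v hv
        obtain ⟨p, hp, rfl⟩ := Multiset.mem_map.1 (Multiset.mem_toFinset.1 hv)
        simpa using ⟨(hD p hp).1, (hG.col p hp).1⟩) (by
        rw [Multiset.toFinset_card_of_nodup hG.fst_nodup, Multiset.card_map]; omega) (by
        rw [W.size]; have := W.two_mul_le; omega) (W.cov i _ (by omega) (by omega)))
      hG.fst_nodup (by simp)
    obtain rfl : EB = 0 := by simpa using e2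
    simp only [Multiset.map_cons] at e1
    obtain ⟨x, EA, rfl, e1'⟩ := exists_cons_of_map_fst e1
    obtain ⟨y, EA, rfl, f1⟩ := exists_cons_of_map_fst e1'
    have hx := e3 _ (Multiset.mem_cons_self _ _)
    have hy := e3 _ (Multiset.mem_cons_of_mem (Multiset.mem_cons_self _ _))
    simp only [mem_group, Finset.mem_singleton] at hx hy
    obtain ⟨x', hx', hxx'⟩ := W.exists_nb x (blk p.2) (by rw [hx.1]; exact (hD p hp).2.symm)
    obtain ⟨y', hy', hyy'⟩ := W.exists_nb y (blk q.2)
      (by rw [hy.1]; exact (hD q (by simp)).2.symm)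
    have hsn := hG.snd_nodup
    rw [← add_zero C]
    refine W.cover_of_landed hι (i := i) (J := {blk p.2}) (ep := (p.1, x)) (eq := (q.1, y))
      (pH := (x', p.2)) (qH := (y', q.2)) (EA := EA) (EB := 0) (b := b)
      (by simpa using (hD p hp).2.symm) (by simpa using hDk)
      (by simpa using hP) (fun Y E h => h.join hxx') (fun Y E h => h.join hyy') f1 (by simp)
      (fun r hr => by simpa using e3 r (by simp [hr])) (by simp)
      ?_ (by simpa using hsn)
      ⟨by simp [W.hcol _ _ hxx', hx.2], (hG.col p hp).2⟩
      ⟨by simp [W.hcol _ _ hyy', hy.2], (hG.col q (by simp)).2⟩ (by simp [hx'])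
      (by simp [hy', hpq.symm]) (by simpa [hy'] using (hD q (by simp)).2)
      (fun r hr => ⟨(hD r (by simp [hr])).2, (hG.col r (by simp [hr])).2⟩) (by simp)
    simp only [Multiset.map_zero, Multiset.nodup_cons, Multiset.mem_cons]
    simp only [Multiset.notMem_zero, or_false, not_false_eq_true, Multiset.nodup_zero, and_true]
    rintro rfl
    exact hpq (hx'.symm.trans hy')
  · push Not at hpq
    obtain ⟨p, hp⟩ := Multiset.card_pos_iff_exists_mem.1 (by omega : 0 < D.card)
    have h : ∀ q ∈ D, blk q.1 = i ∧ blk q.2 = blk p.2 := fun q hq => ⟨(hD q hq).1, hpq q hq p hp⟩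
    by_cases hk3 : 3 ≤ k
    · rw [← add_zero D]
      exact W.cover_of_parallel hι hk3 (i := i) (q := blk p.2) (b := b) (hD p hp).2.symm
        (by rintro rfl; simp at hp) (by simpa using hDk) (by simpa using hG) h (by simp)
    · exact W.cover_of_two_blocks hι (by omega) (i := i) (q := blk p.2) hG hDk
        fun q hq => by simp [h q hq]

end Weld

end

/-! ### Stars with both orientations. -/

section

variable {V ι : Type*} [Fintype V] [DecidableEq V] [DecidableEq ι] {G : SimpleGraph V}
  {col : V → Bool} {b : Bool} {blk : V → ι} {m k : ℕ} {C C₁ C₂ D E : Multiset (V × V)}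

namespace Weld

theorem eq_of_size_one (W : Weld G col blk 1 k) {u v : V} (h : blk u = blk v)
    (hc : col u = col v) : u = v :=
  Finset.card_le_one.1 (W.size (blk v) (col v)).le u (by simp [h, hc]) v (by simp)

theorem cover_single_of_size_one (W : Weld G col blk 1 k) {u v : V} {i : ι} (hu : blk u = i)
    (hv : blk v = i) (hc : col v = !col u) : PathCover G (group blk {i}) {(u, u), (v, v)} := by
  have h := W.cov i 1 le_rfl W.two_le (col u) {(u, v)} (.of_nodup (by simp) (by simp) (by
    simpa using hc)) (by simp [Inside, hu, hv]) (by simp)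
  obtain ⟨w, huw, h⟩ := PathCover.cut_first (D := 0) h (by rintro rfl; simp at hc)
  obtain rfl : w = v := by
    refine W.eq_of_size_one ?_ (by rw [W.hcol _ _ huw, hc])
    rw [hv]
    simpa using (h.mem_of_mem (w, v) (by simp)).1
  exact h

/-- Every block is a single edge, so the paths can be written down. The source of `q` is matched to
its sink, and `p` visits the other vertex in the block of that source before spanning the block of
its own sink. The remaining blocks are absorbed. -/
theorem cover_of_size_one [Fintype ι] (W : Weld G col blk 1 2) {i : ι} {p q : V × V}
    (hG : Good col b {p, q}) (hp : blk p.1 = i ∧ blk p.2 ≠ i) (hq : blk q.1 ≠ i ∧ blk q.2 = i)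
    (hpq : blk p.2 ≠ blk q.1) : PathCover G Finset.univ {p, q} := by
  obtain ⟨s, t⟩ := p
  obtain ⟨u, v⟩ := q
  obtain ⟨hs, ht⟩ := hG.col (s, t) (by simp)
  obtain ⟨hu, hv⟩ := hG.col (u, v) (by simp)
  simp only at hs ht hu hv hp hq hpq
  obtain ⟨w, hw, hsw⟩ := W.exists_nb s (blk u) (by rw [hp.1]; exact hq.1.symm)
  obtain ⟨x, hx, hwx⟩ := W.exists_nb w (blk t) (by rw [hw]; exact hpq.symm)
  obtain ⟨y, hy, huy⟩ := W.exists_nb u i hq.1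
  have hwc := W.hcol _ _ hsw
  have hxc := W.hcol _ _ hwx
  have hyc := W.hcol _ _ huy
  obtain rfl : v = y := W.eq_of_size_one (by rw [hq.2, hy]) (by rw [hyc, hv, hu])
  have h1 := W.cover_single_of_size_one hp.1 hq.2 (by rw [hv, hs])
  have h2 := W.cover_single_of_size_one (i := blk u) (u := u) (v := w) rfl hw (by rw [hwc, hs, hu])
  have h3 := W.cov (blk t) 1 le_rfl W.two_le b {(x, t)} (.of_nodup (by simp) (by simp) (by
    simp [hxc, hwc, hs, ht])) (by simp [Inside, hx]) (by simp)
  have h := h1.union (h2.union h3 (group_disjoint (by simpa using hpq.symm))) (by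
    rw [← group_union]
    exact group_disjoint (by simpa using ⟨hq.1.symm, hp.2.symm⟩))
  rw [← group_union, ← group_union] at h
  have h : PathCover G (group blk ({i} ∪ ({blk u} ∪ {blk t})))
      ((s, s) ::ₘ (w, w) ::ₘ (x, t) ::ₘ (u, u) ::ₘ (v, v) ::ₘ 0) := by
    refine h.congr ?_
    simp only [Multiset.insert_eq_cons, ← Multiset.singleton_add]; abel
  have h := (h.join hsw).join hwx
  have h : PathCover G (group blk ({i} ∪ ({blk u} ∪ {blk t}))) {(s, t), (u, v)} := by
    refine (PathCover.join (a := u) (b := u) (c := v) (d := v) (D := {(s, t)})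
      (h.congr ?_) huy).congr ?_
    · simp only [← Multiset.singleton_add]; abel
    · exact Multiset.cons_swap _ _ _
  rcases (Finset.univ \ ({i} ∪ ({blk u} ∪ {blk t}))).eq_empty_or_nonempty with he | hne
  · rwa [Finset.univ_subset_iff.1 (Finset.sdiff_eq_empty_iff_subset.1 he), group_univ] at h
  · have h := W.absorb hne (group_disjoint Finset.sdiff_disjoint) (by simp) hG.col
      (W.coverable_group hne le_rfl (by omega)) h
    rwa [← group_union, Finset.sdiff_union_of_subset (Finset.subset_univ _), group_univ] at h

/-- All pairs have exactly one entry in block `i`; both orientations occur. -/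
theorem cover_of_star_mixed [Fintype ι] (W : Weld G col blk m k) (hι : k + 1 ≤ Fintype.card ι)
    {i : ι} (hG : Good col b (C₁ + C₂)) (hC : C₁.card + C₂.card = k) (hC₁ : C₁ ≠ 0) (hC₂ : C₂ ≠ 0)
    (h₁ : ∀ p ∈ C₁, blk p.1 = i ∧ blk p.2 ≠ i) (h₂ : ∀ p ∈ C₂, blk p.1 ≠ i ∧ blk p.2 = i) :
    PathCover G Finset.univ (C₁ + C₂) := by
  have hk := W.two_le
  have hm := W.two_mul_le
  by_cases hpq : ∃ p ∈ C₁, ∃ q ∈ C₂, blk p.2 ≠ blk q.1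
  · obtain ⟨p, hp, q, hq, hpq⟩ := hpq
    obtain ⟨C₁, rfl⟩ := Multiset.exists_cons_of_mem hp
    obtain ⟨C₂, rfl⟩ := Multiset.exists_cons_of_mem hq
    rw [Multiset.card_cons, Multiset.card_cons] at hC
    have hpc := hG.col p (by simp)
    have hqc := hG.col q (by simp)
    by_cases hkm : k ≤ m
    · have hG₁ := hG.mono (Multiset.le_add_right (p ::ₘ C₁) (q ::ₘ C₂))
      have hG₂ := hG.mono (Multiset.le_add_left (q ::ₘ C₂) (p ::ₘ C₁))
      obtain ⟨EA, EB, hP, e1, e2, e3, e4⟩ := (freeCover W.hcol (b := b) (X := group blk {i})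
        (A := ((p ::ₘ C₁).map Prod.fst).toFinset) (B := ((q ::ₘ C₂).map Prod.snd).toFinset)
        (W.size i) hk hkm (W.cov i) (by
          intro v hv
          obtain ⟨p, hp, rfl⟩ := Multiset.mem_map.1 (Multiset.mem_toFinset.1 hv)
          simpa using ⟨(h₁ p hp).1, (hG₁.col p hp).1⟩) (by
          intro v hv
          obtain ⟨p, hp, rfl⟩ := Multiset.mem_map.1 (Multiset.mem_toFinset.1 hv)
          simpa using ⟨(h₂ p hp).2, (hG₂.col p hp).2⟩) (by
          rw [Multiset.toFinset_card_of_nodup hG₁.fst_nodup,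
            Multiset.toFinset_card_of_nodup hG₂.snd_nodup]
          simp only [Multiset.card_map, Multiset.card_cons]
          omega)).exists_of_map hG₁.fst_nodup hG₂.snd_nodup
      rw [Multiset.map_cons] at e1 e2
      obtain ⟨x, EA, rfl, f1⟩ := exists_cons_of_map_fst e1
      obtain ⟨y, EB, rfl, f2⟩ := exists_cons_of_map_snd e2
      have hx := e3 _ (Multiset.mem_cons_self _ _)
      have hy := e4 _ (Multiset.mem_cons_self _ _)
      simp only [mem_group, Finset.mem_singleton] at hx hy e3 e4
      have hPi := (h₁ p hp).2
      have hQi := (h₂ q hq).1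
      have hι' : (Finset.univ.erase i).card + 1 = Fintype.card ι := by
        rw [Finset.card_erase_add_one (Finset.mem_univ _), Finset.card_univ]
      -- The natural landing place is the block of the sink of `p`. If the neighbour there is
      -- already a source of `C₂`, another block is used, still avoiding the source of `q`.
      obtain ⟨x', hxx', hx'i, hx'q, hx'F, hx'⟩ : ∃ x', G.Adj x x' ∧ blk x' ≠ i ∧
          blk x' ≠ blk q.1 ∧ x' ∉ C₂.map Prod.fst ∧ (blk x' = blk p.2 ∨ 1 ≤ C₂.card) := by
        obtain ⟨x', hx', hxx'⟩ := W.exists_nb x (blk p.2) (by rw [hx.1]; exact hPi.symm)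
        by_cases hF : x' ∈ C₂.map Prod.fst
        · have hc : 1 ≤ C₂.card := by
            rw [← Multiset.card_map Prod.fst]; exact Multiset.card_pos_iff_exists_mem.2 ⟨_, hF⟩
          obtain ⟨w, hw, hxw, -, hwF⟩ := W.exists_landing (v := x)
            (J := (Finset.univ.erase i).erase (blk q.1)) (by simp [hx.1])
            (F := (C₂.map Prod.fst).toFinset) (by
              have := Multiset.toFinset_card_le (C₂.map Prod.fst)
              rw [Multiset.card_map] at this
              rw [Finset.card_erase_of_mem (by simp [hQi])]
              omega)
          simp only [Finset.mem_erase, Finset.mem_univ, and_true] at hw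
          exact ⟨w, hxw, hw.2, hw.1, by simpa using hwF, .inr hc⟩
        · exact ⟨x', hxx', by rw [hx']; exact hPi, by rw [hx']; exact hpq, hF, .inl hx'⟩
      -- Avoiding two blocks instead of one is affordable: it happens only when `C₂` is nonempty,
      -- and then `C₁` has at most `k - 3` pairs.
      obtain ⟨y', hy'J, hyy', hy'c, hy'F⟩ := W.exists_landing (v := y)
        (J := Finset.univ.erase i \ {blk p.2, blk x'}) (by simp [hy.1])
        (F := (C₁.map Prod.snd).toFinset) (by
          have h1 := Multiset.toFinset_card_le (C₁.map Prod.snd)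
          rw [Multiset.card_map] at h1
          have h2 := Finset.le_card_sdiff ({blk p.2, blk x'} : Finset ι) (Finset.univ.erase i)
          rcases hx' with h | h
          · rw [h, Finset.pair_eq_singleton, Finset.card_singleton] at h2
            rw [h, Finset.pair_eq_singleton]
            omega
          · have := Finset.card_le_two (a := blk p.2) (b := blk x')
            omega)
      simp only [Finset.mem_sdiff, Finset.mem_erase, Finset.mem_univ, and_true, Finset.mem_insert,
        Finset.mem_singleton, not_or, Multiset.mem_toFinset] at hy'J hy'F
      have hfn := hG₂.fst_nodup
      have hsn := hG₁.snd_nodup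
      rw [Multiset.map_cons] at hfn hsn
      have hxc' : col x' = b := by rw [W.hcol _ _ hxx', hx.2, Bool.not_not]
      have hyc' : col y' = !b := by rw [hy'c, hy.2]
      refine (W.cover_of_landed hι (i := i) (J := {blk p.2, blk x'}) (ep := (p.1, x))
        (eq := (y, q.2)) (p := p) (q := q) (C₁ := C₁) (C₂ := C₂)
        (pH := (x', p.2)) (qH := (q.1, y')) (EA := EA) (EB := EB) (b := b)
        (by simpa using ⟨hPi.symm, hx'i.symm⟩) (by omega)
        (hP.congr (by simp only [← Multiset.singleton_add]; abel))
        (fun Y E h => h.join hxx') (fun Y E h => ?_) f1 f2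
        (fun r hr => e3 r (Multiset.mem_cons_of_mem hr))
        (fun r hr => e4 r (Multiset.mem_cons_of_mem hr))
        ?_ ?_ ⟨hxc', hpc.2⟩ ⟨hqc.1, hyc'⟩ (by simp)
        (by simpa using ⟨⟨hpq.symm, hx'q.symm⟩, hy'J.2⟩) ⟨hQi, hy'J.1⟩
        (fun r hr => ⟨(h₁ r (by simp [hr])).2, (hG.col r (by simp [hr])).2⟩)
        (fun r hr => ⟨(h₂ r (by simp [hr])).1, (hG.col r (by simp [hr])).1⟩)).congr ?_
      · rw [Multiset.cons_swap] at h
        exact h.join hyy'.symm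
      · refine Multiset.nodup_cons.2 ⟨?_, hfn⟩
        rw [Multiset.mem_cons, not_or]
        exact ⟨fun h => hx'q (congrArg blk h), hx'F⟩
      · rw [Multiset.cons_swap]
        refine Multiset.nodup_cons.2 ⟨?_, hsn⟩
        rw [Multiset.mem_cons, not_or]
        exact ⟨fun h => hy'J.2.1 (congrArg blk h), hy'F⟩
      · simp only [← Multiset.singleton_add]; abel
    -- The free cover fails to apply only for `k = 2` and `m = 1`.
    · obtain rfl : k = 2 := by
        by_contra
        exact hkm (W.le_room (by omega))
      obtain rfl : m = 1 := by omega
      obtain ⟨rfl, rfl⟩ : C₁ = 0 ∧ C₂ = 0 := by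
        simpa only [Multiset.card_eq_zero] using (by omega : C₁.card = 0 ∧ C₂.card = 0)
      exact W.cover_of_size_one hG (h₁ p hp) (h₂ q hq) hpq
  · push Not at hpq
    -- Every outer end of `C₁` shares its block with every outer end of `C₂`. As both classes are
    -- nonempty, there is one outer block only.
    obtain ⟨p, hp⟩ := Multiset.exists_mem_of_ne_zero hC₁
    obtain ⟨q, hq⟩ := Multiset.exists_mem_of_ne_zero hC₂
    have h₁' : ∀ r ∈ C₁, blk r.1 = i ∧ blk r.2 = blk p.2 := fun r hr =>
      ⟨(h₁ r hr).1, by rw [hpq r hr q hq, hpq p hp q hq]⟩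
    have h₂' : ∀ r ∈ C₂, blk r.1 = blk p.2 ∧ blk r.2 = i := fun r hr =>
      ⟨(hpq p hp r hr).symm, (h₂ r hr).2⟩
    by_cases hk3 : 3 ≤ k
    · exact W.cover_of_parallel hι hk3 (i := i) (q := blk p.2) (b := b) (h₁ p hp).2.symm
        hC₁ hC hG h₁' h₂'
    · refine W.cover_of_two_blocks hι (by omega) (i := i) (q := blk p.2) hG
        (by rwa [Multiset.card_add]) fun r hr => ?_
      rcases Multiset.mem_add.1 hr with hr | hr
      · simp [h₁' r hr]
      · simp [h₂' r hr]

/-- All pairs have exactly one entry in block `i`. -/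
theorem cover_of_star [Fintype ι] (W : Weld G col blk m k) (hι : k + 1 ≤ Fintype.card ι)
    {i : ι} (hG : Good col b D) (hDk : D.card = k)
    (hD : ∀ p ∈ D, (blk p.1 = i ∧ blk p.2 ≠ i) ∨ (blk p.1 ≠ i ∧ blk p.2 = i)) :
    PathCover G Finset.univ D := by
  have hsplit := Multiset.filter_add_not (fun p : V × V => blk p.1 = i) D
  set C₁ := D.filter fun p => blk p.1 = i
  set C₂ := D.filter fun p => ¬ blk p.1 = i
  have h₁ : ∀ p ∈ C₁, blk p.1 = i ∧ blk p.2 ≠ i := fun p hp => by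
    have := Multiset.mem_filter.1 hp
    exact (hD p this.1).resolve_right fun h => h.1 this.2
  have h₂ : ∀ p ∈ C₂, blk p.1 ≠ i ∧ blk p.2 = i := fun p hp => by
    have := Multiset.mem_filter.1 hp
    exact (hD p this.1).resolve_left fun h => this.2 h.1
  clear_value C₁ C₂
  subst hsplit
  rw [Multiset.card_add] at hDk
  by_cases hC₁ : C₁ = 0
  · subst hC₁
    rw [zero_add] at hG ⊢
    refine (W.cover_of_star_sources hι (i := i) hG.swap (by simpa using hDk) ?_).of_swap
    intro p hp
    obtain ⟨q, hq, rfl⟩ := Multiset.mem_map.1 hp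
    exact (h₂ q hq).symm
  by_cases hC₂ : C₂ = 0
  · subst hC₂
    rw [add_zero] at hG ⊢
    exact W.cover_of_star_sources hι hG (by simpa using hDk) h₁
  exact W.cover_of_star_mixed hι hG hDk hC₁ hC₂ h₁ h₂

end Weld

end

/-! ### Case distinction for `k` pairs. -/

section

variable {V ι : Type*} [Fintype V] [DecidableEq V] [DecidableEq ι] {G : SimpleGraph V}
  {col : V → Bool} {b : Bool} {blk : V → ι} {m k : ℕ} {C C₁ C₂ D E : Multiset (V × V)}

namespace Weld

/-- If all pairs lie inside block `i`, the block meets `k - 1` of them, and the last one is inserted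
with the help of the other blocks. Otherwise some pair leaves `i`, and up to reversal it starts
there. -/
theorem cover_of_loop [Fintype ι] (W : Weld G col blk m k) (hι : k + 1 ≤ Fintype.card ι)
    {i : ι} {p₀ : V × V} (hG : Good col b D) (hDk : D.card = k)
    (hstar : ∀ p ∈ D, blk p.1 = i ∨ blk p.2 = i)
    (hp₀ : p₀ ∈ D) (h₁ : blk p₀.1 = i) (h₂ : blk p₀.2 = i) : PathCover G Finset.univ D := by
  have hk := W.two_le
  by_cases hall : ∀ p ∈ D, blk p.1 = i ∧ blk p.2 = i
  · obtain ⟨C, rfl⟩ := Multiset.exists_cons_of_mem hp₀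
    rw [Multiset.card_cons] at hDk
    have hc : (Finset.univ.erase i).card + 1 = Fintype.card ι := by
      rw [Finset.card_erase_add_one (Finset.mem_univ _), Finset.card_univ]
    have h := W.cov i (k - 1) (by omega) (by omega) b C (hG.mono (Multiset.le_cons_self _ _))
      (fun p hp => by simpa using hall p (Multiset.mem_cons_of_mem hp)) (by omega)
    have h := W.cover_of_inner (I := {i}) (J := Finset.univ.erase i) (by simp)
      (by rw [← Finset.card_pos]; omega) hG (by simpa using h₁) (by simpa using h₂)
      (fun _ => by omega) h
    rwa [Finset.union_comm, union_erase, group_univ] at h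
  · push Not at hall
    obtain ⟨⟨s, t⟩, hp, hpi⟩ := hall
    have hne : p₀ ≠ (s, t) := by rintro rfl; exact hpi h₁ h₂
    obtain ⟨C, rfl⟩ := Multiset.exists_cons_of_mem hp
    have hp₀ := (Multiset.mem_cons.1 hp₀).resolve_left hne
    rcases hstar _ hp with hs | ht
    · exact W.cover_of_star_loop hι hG hDk (fun p hp => hstar p (Multiset.mem_cons_of_mem hp)) hs
        (hpi hs) hp₀ h₁ h₂
    · refine PathCover.of_swap ?_
      have hG' := hG.swap
      rw [Multiset.map_cons] at hG' ⊢
      refine W.cover_of_star_loop (s := t) (t := s) (i := i) (p₀ := p₀.swap) hι hG'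
        (by simpa using hDk) ?_ ht (fun h => hpi h ht) (Multiset.mem_map_of_mem _ hp₀) h₂ h₁
      intro p hp
      obtain ⟨q, hq, rfl⟩ := Multiset.mem_map.1 hp
      exact (hstar q (Multiset.mem_cons_of_mem hq)).symm

/-- Either two pairs can be separated, or the pairs form an intersecting family of edges and loops
on the set of blocks. A loop forces all pairs to touch its block. Without loops there is a common
block or a triangle. -/
theorem coverable_univ [Fintype ι] (W : Weld G col blk m k) (hι : k + 1 ≤ Fintype.card ι) {j : ℕ}
    (hj : 1 ≤ j) (hjk : j ≤ k) : Coverable G col Finset.univ j := by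
  have hk := W.two_le
  have : Nonempty ι := Fintype.card_pos_iff.1 (by omega)
  rcases hjk.lt_or_eq with hjk | rfl
  · rw [← group_univ (blk := blk)]
    exact W.coverable_group Finset.univ_nonempty hj hjk
  intro b D hG _ hDk
  by_cases hsep : ∃ p ∈ D, ∃ q ∈ D,
      blk q.1 ∉ ({blk p.1, blk p.2} : Finset ι) ∧ blk q.2 ∉ ({blk p.1, blk p.2} : Finset ι)
  · obtain ⟨p, hp, q, hq, h1, h2⟩ := hsep
    have hu : {blk p.1, blk p.2} ∪ (Finset.univ \ {blk p.1, blk p.2}) = (Finset.univ : Finset ι) :=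
      Finset.union_sdiff_of_subset (Finset.subset_univ _)
    have h := W.cover_of_split (J₁ := {blk p.1, blk p.2}) (J₂ := Finset.univ \ {blk p.1, blk p.2})
      Finset.disjoint_sdiff hG (by rw [hu, group_univ]; simp [Inside]) hDk hp hq (by simp)
      (by simp) (Finset.mem_sdiff.2 ⟨Finset.mem_univ _, h1⟩)
      (Finset.mem_sdiff.2 ⟨Finset.mem_univ _, h2⟩)
    rwa [hu, group_univ] at h
  push Not at hsep
  simp only [Finset.mem_insert, Finset.mem_singleton] at hsep
  by_cases hloop : ∃ p ∈ D, blk p.1 = blk p.2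
  · obtain ⟨p, hp, h⟩ := hloop
    refine W.cover_of_loop hι hG hDk (i := blk p.1) (fun q hq => ?_) hp rfl h.symm
    have := hsep p hp q hq
    rw [← h] at this
    tauto
  push Not at hloop
  obtain ⟨p, hp⟩ := Multiset.card_pos_iff_exists_mem.1 (by omega : 0 < D.card)
  have hstar : ∀ i, (∀ q ∈ D, blk q.1 = i ∨ blk q.2 = i) → PathCover G Finset.univ D := by
    intro i hi
    refine W.cover_of_star hι hG hDk (i := i) fun q hq => ?_
    have := hloop q hq
    rcases hi q hq with rfl | rfl
    exacts [.inl ⟨rfl, this.symm⟩, .inr ⟨this, rfl⟩]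
  by_cases h1 : ∀ q ∈ D, blk q.1 = blk p.1 ∨ blk q.2 = blk p.1
  · exact hstar _ h1
  by_cases h2 : ∀ q ∈ D, blk q.1 = blk p.2 ∨ blk q.2 = blk p.2
  · exact hstar _ h2
  push Not at h1 h2
  obtain ⟨q, hq, hq1, hq2⟩ := h1
  obtain ⟨r, hr, hr1, hr2⟩ := h2
  have hpr : p ≠ r := by rintro rfl; exact hr2 rfl
  obtain ⟨C, rfl⟩ := Multiset.exists_cons_of_mem hp
  obtain ⟨C, rfl⟩ := Multiset.exists_cons_of_mem ((Multiset.mem_cons.1 hr).resolve_left hpr.symm)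
  have hsr := hsep p hp r hr
  -- The pair `r` meets the blocks of `p` but misses that of `p.2`, so it touches that of `p.1`. The
  -- pair `q` does not, hence `q ≠ r`.
  have hqC : q ∈ C := by
    simp only [Multiset.mem_cons] at hq
    rcases hq with rfl | rfl | hq
    · exact absurd rfl hq1
    · tauto
    · exact hq
  have hrl := hloop r hr
  obtain ⟨l, hl, hlp⟩ : ∃ l, Crossing blk {blk p.1} {l} r ∧ l ≠ blk p.2 ∧ l ≠ blk p.1 := by
    simp only [Crossing, Finset.mem_singleton]
    by_cases h : blk r.1 = blk p.1
    · exact ⟨blk r.2, .inl ⟨h, rfl⟩, hr2, by rw [← h]; exact hrl.symm⟩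
    · have h' : blk r.2 = blk p.1 := by tauto
      exact ⟨blk r.1, .inr ⟨rfl, h'⟩, hr1, h⟩
  exact W.cover_of_triangle hG hDk (fun p hp => hloop p (by simp [hp])) (hloop p hp) hlp.2.symm
    hlp.1.symm (.inl ⟨by simp, by simp⟩) hl hqC hq1 hq2

end Weld

end

/-! ### The induction statement and its behaviour under welding. -/

section

section Stage

variable {V ι : Type*} [Fintype V] [DecidableEq V] [DecidableEq ι] {G : SimpleGraph V}
  {col : V → Bool} {b : Bool} {blk : V → ι} {m n : ℕ} {D : Multiset (V × V)}

/-- The properties of a balanced graph of rank `n` with proper 2-colouring `col`. -/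
def Stage (n : ℕ) (G : SimpleGraph V) (col : V → Bool) : Prop :=
  ∃ m, (∀ c, (Finset.univ.filter (col · = c)).card = m) ∧ (m = 0 ∨ n * (n - 1) ≤ 2 * m) ∧
    ∀ j, 1 ≤ j → (j < n ∨ j = 1) → Coverable G col Finset.univ j

theorem coverable_of_isEmpty [IsEmpty V] {X : Finset V} {j : ℕ} (hj : 1 ≤ j) :
    Coverable G col X j := by
  intro b D _ _ hD
  obtain ⟨p, -⟩ := Multiset.card_pos_iff_exists_mem.1 (by omega : 0 < D.card)
  exact isEmptyElim p.1

theorem stage_of_isEmpty [IsEmpty V] : Stage n G col :=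
  ⟨0, fun c => by simp [Finset.univ_eq_empty], .inl rfl, fun _ hj _ => coverable_of_isEmpty hj⟩

theorem coverable_one (h : ∀ u v, col u ≠ col v → PathCover G Finset.univ {(u, v)}) :
    Coverable G col Finset.univ 1 := by
  intro b D hG _ hD
  obtain ⟨p, rfl⟩ := Multiset.card_eq_one.1 hD
  obtain ⟨h1, h2⟩ := hG.col p (by simp)
  exact h p.1 p.2 (by rw [h1, h2]; simp)

theorem stage_one (hcol : ∀ u v, G.Adj u v → col v = !col u)
    (h : ∀ u v, col u ≠ col v → PathCover G Finset.univ {(u, v)})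
    (h' : ∃ u v, col u ≠ col v) : Stage 1 G col := by
  obtain ⟨u, v, huv⟩ := h'
  have hb := (h u v huv).balanced (b := col u) hcol (by simpa using Bool.eq_not.2 huv.symm)
  refine ⟨(Finset.univ.filter (col · = col u)).card, fun c => ?_, .inr (by simp),
    fun j hj hj' => ?_⟩
  · by_cases hc : c = col u
    · rw [hc]
    · rw [Bool.eq_not.2 hc, hb]
  · obtain rfl : j = 1 := by omega
    exact coverable_one h

/-- For nonempty blocks the size bound is inherited: there are at least `n + 1` blocks, and `n ≤ 2 *
m` holds in each of them. Empty blocks are allowed and make everything vacuous. -/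
theorem stage_of_weld [Fintype ι] (hn : 1 ≤ n) (hι : n + 1 ≤ Fintype.card ι)
    (hcol : ∀ u v, G.Adj u v → col v = !col u)
    (hsize : ∀ i c, ((group blk {i}).filter (col · = c)).card = m)
    (hnb : ∀ v i, blk v ≠ i → ∃ w, blk w = i ∧ G.Adj v w)
    (huniq : ∀ v w x, G.Adj v w → G.Adj v x → blk w = blk x → blk v ≠ blk w → w = x)
    (hm : m = 0 ∨ n * (n - 1) ≤ 2 * m)
    (hcov : ∀ i j, 1 ≤ j → (j < n ∨ j = 1) → Coverable G col (group blk {i}) j) :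
    Stage (n + 1) G col := by
  rcases Nat.eq_zero_or_pos m with rfl | hm0
  · have : IsEmpty V := ⟨fun v => by
      have := hsize (blk v) (col v)
      rw [Finset.card_eq_zero, Finset.eq_empty_iff_forall_notMem] at this
      exact this v (by simp)⟩
    exact stage_of_isEmpty
  have hm := hm.resolve_left hm0.ne'
  have hne : Nonempty ι := Fintype.card_pos_iff.1 (by omega)
  refine ⟨Fintype.card ι * m, fun c => ?_, .inr ?_, fun j hj hjn => ?_⟩
  · rw [Finset.card_eq_sum_card_fiberwise (f := blk) (t := Finset.univ) (by simp),
      Finset.sum_congr rfl (g := fun _ => m), Finset.sum_const, Finset.card_univ, smul_eq_mul]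
    intro i _
    rw [← hsize i c]
    congr 1
    ext v
    simp [and_comm]
  · have h1 := Nat.mul_le_mul_right m hι
    rw [Nat.add_sub_cancel]
    rcases hn.eq_or_lt with rfl | hn
    · omega
    · have h2 : n * 1 ≤ n * (n - 1) := Nat.mul_le_mul_left n (by omega)
      have h3 : (n + 1) * n ≤ (n + 1) * (2 * m) := Nat.mul_le_mul_left _ (by omega)
      have h4 : (n + 1) * (2 * m) = 2 * ((n + 1) * m) := by ring
      omega
  · rcases hn.eq_or_lt with rfl | hn
    -- At rank `1` the blocks meet single pairs, which amounts to `k = 2`. Only a single pair is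
    -- asked for in the weld, so `coverable_group` suffices.
    · have W : Weld G col blk m 2 := ⟨hcol, hsize, hnb, huniq,
        fun i j h1 h2 => hcov i j h1 (by omega), le_rfl, by omega⟩
      rw [← group_univ (blk := blk)]
      exact W.coverable_group Finset.univ_nonempty hj (by omega)
    · have W : Weld G col blk m n := ⟨hcol, hsize, hnb, huniq,
        fun i j h1 h2 => hcov i j h1 (.inl h2), hn, hm⟩
      exact W.coverable_univ hι hj (by omega)

/-- A complete graph with a proper 2-colouring and at least two vertices is a single edge. This
starts the induction when the blocks are single vertices. -/
theorem stage_of_complete (hcol : ∀ u v, G.Adj u v → col v = !col u)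
    (h : ∀ u v, u ≠ v → G.Adj u v) (h' : ∃ u v : V, u ≠ v) : Stage 2 G col := by
  have hinj : Function.Injective col := by
    intro u v huv
    by_contra hne
    have := hcol u v (h u v hne)
    rw [huv] at this
    simp at this
  have hcov : ∀ u v, col u ≠ col v → PathCover G Finset.univ {(u, v)} := by
    intro u v huv
    have hne : u ≠ v := fun e => huv (congrArg col e)
    have h1 := ((PathCover.single (G := G) u).union (.single v) (by simpa using hne)).join
      (D := 0) (h u v hne)
    refine (?_ : Finset.univ = {u} ∪ {v}) ▸ h1
    symm
    rw [Finset.eq_univ_iff_forall]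
    intro w
    by_cases hw : col w = col u
    · simp [hinj hw]
    · have : col w = col v := by rw [Bool.eq_not.2 hw, Bool.eq_not.2 huv.symm]
      simp [hinj this]
  obtain ⟨u, v, huv⟩ := h'
  have huv : col u ≠ col v := fun e => huv (hinj e)
  refine ⟨1, fun c => le_antisymm ?_ ?_, .inr le_rfl, fun j hj hj' => ?_⟩
  · refine Finset.card_le_one.2 fun x hx y hy => hinj ?_
    rw [(Finset.mem_filter.1 hx).2, (Finset.mem_filter.1 hy).2]
  · rw [Nat.one_le_iff_ne_zero, Finset.card_ne_zero]
    by_cases hc : col u = c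
    · exact ⟨u, by simpa using hc⟩
    · exact ⟨v, by simpa using (Bool.eq_not.2 huv.symm).trans (Bool.eq_not.2 (Ne.symm hc)).symm⟩
  · obtain rfl : j = 1 := by omega
    exact coverable_one hcov

theorem Coverable.of_induce {S : Set V} [Fintype S] [DecidableEq S] {X : Finset V}
    (hX : ∀ v, v ∈ X ↔ v ∈ S) {j : ℕ}
    (h : Coverable (G.induce S) (fun v => col v) Finset.univ j) : Coverable G col X j := by
  intro b D hG hD hj
  have hD' : ∀ p ∈ D, p.1 ∈ S ∧ p.2 ∈ S := fun p hp =>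
    ⟨(hX _).1 (hD p hp).1, (hX _).1 (hD p hp).2⟩
  obtain ⟨D, rfl⟩ : ∃ E : Multiset (S × S), D = E.map fun p => (p.1.1, p.2.1) := by
    refine ⟨D.pmap (fun p h => (⟨p.1, h.1⟩, ⟨p.2, h.2⟩)) hD', ?_⟩
    rw [Multiset.map_pmap]
    simp [Multiset.pmap_eq_map]
  have hP := (h b D ⟨?_, fun p hp => hG.col _ (Multiset.mem_map_of_mem _ hp)⟩
    (fun p _ => by simp) (by simpa using hj)).map (SimpleGraph.Embedding.induce S)
  · refine (?_ : _ = X) ▸ hP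
    ext v
    simp [hX]
  · refine Multiset.Nodup.of_map Subtype.val ?_
    simpa [Multiset.map_map, Function.comp_def] using hG.nodup

end Stage

end

/-! ### From welding processes to the induction statement. -/

section

section Rank

variable {V : Type u} {G : SimpleGraph V} {col : V → Bool}

theorem exists_walk_of_hasPairedDPC {s t : V} (h : HasPairedDPC G (fun _ : Fin 1 => s) fun _ => t) :
    ∃ p : G.Walk s t, p.IsPath ∧ ∀ v, v ∈ p.support := by
  obtain ⟨P, hP, hv⟩ := h
  refine ⟨P 0, hP 0, fun v => ?_⟩
  obtain ⟨i, hi, -⟩ := hv v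
  rwa [Subsingleton.elim i 0] at hi

theorem pathCover_of_hasPairedDPC [Fintype V] [DecidableEq V] {s t : V}
    (h : HasPairedDPC G (fun _ : Fin 1 => s) fun _ => t) : PathCover G Finset.univ {(s, t)} := by
  obtain ⟨p, hp, hv⟩ := exists_walk_of_hasPairedDPC h
  have := PathCover.of_walk p hp
  rwa [show p.support.toFinset = Finset.univ by ext v; simp [hv]] at this

/-- Two proper 2-colourings agree up to a swap of the colours along every walk. -/
theorem xor_eq_of_walk {col' : V → Bool} (hcol : ∀ u v, G.Adj u v → col v = !col u)
    (hcol' : ∀ u v, G.Adj u v → col' v = !col' u) {u v : V} (p : G.Walk u v) :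
    (col u ^^ col' u) = (col v ^^ col' v) := by
  induction p with
  | nil => rfl
  | cons h p ih => rw [← ih, hcol _ _ h, hcol' _ _ h]; simp

theorem IsBipartition.col_eq {V₁ V₂ : Set V} (h : IsBipartition G V₁ V₂)
    [DecidablePred (· ∈ V₁)] (u v : V) (huv : G.Adj u v) :
    decide (v ∈ V₁) = !decide (u ∈ V₁) := by
  have hd := Set.disjoint_left.1 h.1.disjoint
  rcases h.1.mem_of_adj huv with ⟨h1, h2⟩ | ⟨h1, h2⟩
  · simp [h1, show v ∉ V₁ from fun h => hd h h2]
  · simp [h2, show u ∉ V₁ from fun h => hd h h1]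

/-- Hamiltonian paths between vertices of different colours alternate, so they also show that the
colour classes have equal size. -/
theorem stage_of_base [Fintype V] [DecidableEq V] (hcol : ∀ u v, G.Adj u v → col v = !col u)
    (h : IsHamiltonianConnected G ∨ IsHamiltonianLaceable G) (he : Even (Nat.card V)) :
    Stage 1 G col := by
  classical
  rcases isEmpty_or_nonempty V with hV | hV
  · exact stage_of_isEmpty
  have hc : 2 ≤ Nat.card V := by
    have : 0 < Nat.card V := Nat.card_pos
    obtain ⟨r, hr⟩ := he
    omega
  have hdis : ∀ {u v : V}, u ≠ v →
      Disjoint (Set.range fun _ : Fin 1 => u) (Set.range fun _ : Fin 1 => v) := by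
    intro u v huv
    simpa using huv
  rcases h with h | ⟨V₁, V₂, hV, hb, h⟩
  · have hH : ∀ u v, u ≠ v → PathCover G Finset.univ {(u, v)} := fun u v huv =>
      pathCover_of_hasPairedDPC (h _ _ (Function.injective_of_subsingleton _)
        (Function.injective_of_subsingleton _) (hdis huv))
    refine stage_one hcol (fun u v huv => hH u v fun e => huv (congrArg col e)) ?_
    have : Nontrivial V := Finite.one_lt_card_iff_nontrivial.1 (by omega)
    obtain ⟨u, v, huv⟩ := exists_pair_ne V
    obtain ⟨w, huw, -⟩ := PathCover.cut_first (D := 0) (hH u v huv) huv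
    exact ⟨u, w, by rw [hcol _ _ huw]; simp⟩
  · have hcol' := hV.col_eq
    have hd := Set.disjoint_left.1 hV.1.disjoint
    have hmem : ∀ v, v ∉ V₁ → v ∈ V₂ := fun v hv =>
      ((hV.2 ▸ Set.mem_univ v : v ∈ V₁ ∪ V₂)).resolve_left hv
    have hsum : V₁.ncard + V₂.ncard = Nat.card V := by
      rw [← Set.ncard_union_eq hV.1.disjoint, hV.2, Set.ncard_univ]
    -- Evenness excludes a difference of one. The balanced pairs are then exactly those with one
    -- vertex on each side.
    have heq : V₁.ncard = V₂.ncard := by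
      obtain ⟨r, hr⟩ := he
      rw [abs_le] at hb
      omega
    have hbal : ∀ u v, u ∈ V₁ → v ∈ V₂ → IsBalanced V₁ V₂ {u, v} := by
      intro u v hu hv
      have e1 : ({u, v} : Set V) ∩ V₁ = {u} := by
        ext w
        simp only [Set.mem_inter_iff, Set.mem_insert_iff, Set.mem_singleton_iff]
        constructor
        · rintro ⟨rfl | rfl, hw⟩
          exacts [rfl, absurd hv (hd hw)]
        · rintro rfl; exact ⟨.inl rfl, hu⟩
      have e2 : ({u, v} : Set V) ∩ V₂ = {v} := by
        ext w
        simp only [Set.mem_inter_iff, Set.mem_insert_iff, Set.mem_singleton_iff]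
        constructor
        · rintro ⟨rfl | rfl, hw⟩
          exacts [absurd hw (hd hu), rfl]
        · rintro rfl; exact ⟨.inr rfl, hv⟩
      rw [IsBalanced, e1, e2, heq]
      simp
    have hH : ∀ u v, decide (u ∈ V₁) ≠ decide (v ∈ V₁) →
        HasPairedDPC G (fun _ : Fin 1 => u) fun _ => v := by
      intro u v huv
      refine h _ _ (Function.injective_of_subsingleton _) (Function.injective_of_subsingleton _)
        (hdis (by rintro rfl; exact huv rfl)) ?_
      rw [Set.range_const, Set.range_const, Set.singleton_union]
      by_cases hu : u ∈ V₁
      · have hv : v ∉ V₁ := fun hv => huv (by simp [hu, hv])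
        exact hbal u v hu (hmem v hv)
      · have hv : v ∈ V₁ := by
          by_contra hv
          exact huv (by simp [hu, hv])
        rw [Set.pair_comm]
        exact hbal v u hv (hmem u hu)
    obtain ⟨x, hx⟩ : V₁.Nonempty := Set.nonempty_of_ncard_ne_zero (by omega)
    obtain ⟨y, hy⟩ : V₂.Nonempty := Set.nonempty_of_ncard_ne_zero (by omega)
    have hxy : decide (x ∈ V₁) ≠ decide (y ∈ V₁) := by simp [hx, show y ∉ V₁ from fun h => hd h hy]
    obtain ⟨p, -, hp⟩ := exists_walk_of_hasPairedDPC (hH x y hxy)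
    -- The partite sets witnessing laceability need not be those of `col`. A Hamiltonian path
    -- connects the graph, so the two colourings agree up to a swap.
    have hxor : ∀ v, (col x ^^ decide (x ∈ V₁)) = (col v ^^ decide (v ∈ V₁)) := fun v =>
      xor_eq_of_walk hcol hcol' (p.takeUntil v (hp v))
    have hne : ∀ u v, col u ≠ col v ↔ decide (u ∈ V₁) ≠ decide (v ∈ V₁) := by
      intro u v
      have := (hxor u).symm.trans (hxor v)
      revert this
      cases col u <;> cases col v <;> cases decide (u ∈ V₁) <;> cases decide (v ∈ V₁) <;> simp
    exact stage_one hcol (fun u v huv => pathCover_of_hasPairedDPC (hH u v ((hne u v).1 huv)))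
      ⟨x, y, (hne x y).2 hxy⟩

theorem Stage.card_eq [Fintype V] [DecidableEq V] {n : ℕ} (h : Stage n G col) :
    ∃ m, 2 * m = Nat.card V ∧ (∀ c, (Finset.univ.filter (col · = c)).card = m) ∧
      (m = 0 ∨ n * (n - 1) ≤ 2 * m) ∧
      ∀ j, 1 ≤ j → (j < n ∨ j = 1) → Coverable G col Finset.univ j := by
  obtain ⟨m, h1, h2, h3⟩ := h
  refine ⟨m, ?_, h1, h2, h3⟩
  have := Finset.card_filter_add_card_filter_not (s := (Finset.univ : Finset V)) (col · = true)
  simp only [Bool.not_eq_true, h1] at this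
  rw [Nat.card_eq_fintype_card, ← Finset.card_univ]
  omega

/-- All parts have the same size, so single vertices occur in all parts or in none. In the second
case the common size also gives a common value of `m`. -/
theorem stage_of_isWeld [Fintype V] [DecidableEq V] {n ℓ : ℕ} (hn : 1 ≤ n) (hℓ : n + 1 ≤ ℓ)
    {part : Fin ℓ → Set V} (hG : IsWeld G part) (hcol : ∀ u v, G.Adj u v → col v = !col u)
    (h : ∀ i, ∀ [Fintype (part i)] [DecidableEq (part i)], (n = 1 ∧ Nat.card (part i) = 1) ∨
      Stage n (G.induce (part i)) fun v => col v) : Stage (n + 1) G col := by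
  classical
  choose blk hblk hblk' using hG.partition
  have hiff : ∀ v i, v ∈ part i ↔ blk v = i := fun v i =>
    ⟨fun hv => (hblk' v i hv).symm, by rintro rfl; exact hblk v⟩
  have hnb : ∀ v i, blk v ≠ i → ∃ w, blk w = i ∧ G.Adj v w := by
    intro v i hi
    obtain ⟨w, ⟨hw, hvw⟩, -⟩ := hG.matching _ _ hi v (hblk v)
    exact ⟨w, (hiff _ _).1 hw, hvw⟩
  have huniq : ∀ v w x, G.Adj v w → G.Adj v x → blk w = blk x → blk v ≠ blk w → w = x := by
    intro v w x hw hx hwx hvw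
    exact (hG.matching _ _ hvw v (hblk v)).unique ⟨hblk w, hw⟩ ⟨(hiff _ _).2 hwx.symm, hx⟩
  have i₀ : Fin ℓ := ⟨0, by omega⟩
  by_cases h1 : n = 1 ∧ Nat.card (part i₀) = 1
  · obtain ⟨rfl, h1⟩ := h1
    have hinj : ∀ u v, blk u = blk v → u = v := by
      intro u v huv
      have := (Nat.card_eq_one_iff_unique.1 ((hG.card_eq (blk v) i₀).trans h1)).1
      exact congrArg Subtype.val (this.elim ⟨u, (hiff _ _).2 huv⟩ ⟨v, hblk v⟩)
    have hsurj : ∀ i, ∃ v, blk v = i := by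
      intro i
      obtain ⟨v⟩ := (Nat.card_eq_one_iff_unique.1 ((hG.card_eq i i₀).trans h1)).2
      exact ⟨v, (hiff _ _).1 v.2⟩
    refine stage_of_complete hcol (fun u v huv => ?_) ?_
    · obtain ⟨w, hw, huw⟩ := hnb u (blk v) fun e => huv (hinj _ _ e)
      rwa [hinj _ _ hw] at huw
    · obtain ⟨u, hu⟩ := hsurj ⟨0, by omega⟩
      obtain ⟨v, hv⟩ := hsurj ⟨1, by omega⟩
      refine ⟨u, v, ?_⟩
      rintro rfl
      rw [hu] at hv
      simp at hv
  · have hS : ∀ i, Stage n (G.induce (part i)) fun v => col v := fun i =>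
      (h i).resolve_left fun h' => h1 ⟨h'.1, (hG.card_eq i₀ i).trans h'.2⟩
    choose m e1 e2 e3 e4 using fun i => (hS i).card_eq
    have hm : ∀ i, m i = m i₀ := fun i => by
      have := hG.card_eq i i₀
      rw [← e1, ← e1] at this
      omega
    refine stage_of_weld hn (by simpa using hℓ) hcol (blk := blk) (m := m i₀) ?_ hnb huniq (e3 i₀) ?_
    · intro i c
      rw [← hm i, ← e2 i c, ← Finset.card_map (Function.Embedding.subtype (· ∈ part i))]
      congr 1
      ext v
      simp [← hiff, and_comm]
    · intro i j hj hj'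
      exact Coverable.of_induce (S := part i) (by simp [hiff]) (e4 i j hj hj')

theorem WeldingProcess.stage {n : ℕ} {V : Type u} {G : SimpleGraph V} (W : WeldingProcess n G) :
    ∀ [Fintype V] [DecidableEq V] (col : V → Bool), (∀ u v, G.Adj u v → col v = !col u) →
      W.BlocksSingleOrEven → (n = 1 ∧ Nat.card V = 1) ∨ Stage n G col := by
  induction W with
  | base h =>
    intro _ _ col hcol hW
    exact hW.imp (fun h => ⟨rfl, h⟩) (stage_of_base hcol h)
  | weld hn hℓ part hG p ih =>
    intro _ _ col hcol hW
    exact .inr (stage_of_isWeld hn hℓ hG hcol fun i _ _ =>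
      ih i (fun v => col v) (fun u v huv => hcol u v huv) (hW i))

end Rank

end

end TranspositionLike

theorem mainTheorem1 {V : Type u} [Finite V] (G : SimpleGraph V) (n : ℕ) (hn : 2 ≤ n)
    (W : TranspositionLike.WeldingProcess n G) (hW : W.BlocksSingleOrEven)
    (V₁ V₂ : Set V) (hG : TranspositionLike.IsBipartition G V₁ V₂)
    (s t : Fin (n - 1) → V) (hs : Function.Injective s) (ht : Function.Injective t)
    (hsV : ∀ i, s i ∈ V₁) (htV : ∀ i, t i ∈ V₂) :
    TranspositionLike.HasPairedDPC G s t := by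
  classical
  have := Fintype.ofFinite V
  -- The exceptional single vertex occurs at rank `1` only, which `2 ≤ n` excludes.
  obtain ⟨m, -, -, h⟩ := (W.stage (fun v => decide (v ∈ V₁)) hG.col_eq hW).resolve_left
    fun h => by omega
  refine TranspositionLike.PathCover.hasPairedDPC (h (n - 1) (by omega) (.inl (by omega)) true _
    (.of_nodup ?_ ?_ ?_) (fun _ _ => by simp) (by simp))
  · rw [Multiset.map_map]
    exact Finset.univ.nodup.map hs
  · rw [Multiset.map_map]
    exact Finset.univ.nodup.map ht
  · intro p hp
    obtain ⟨i, -, rfl⟩ := Multiset.mem_map.1 hp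
    simpa using ⟨hsV i, fun h => Set.disjoint_left.1 hG.1.disjoint h (htV i)⟩
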